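/- Theorem 1.1. Let $2<\mu<3$ and $p>2$, and let $u_0,u_1\in C_0^\infty(\mathbb R^2)$ be real-valued with $\operatorname{supp}u_0,\ \operatorname{supp}u_1\subset B(0,1)$, the open unit disc. Then there is an $\varepsilon_0>0$, depending only on $\mu$, $p$, $u_0$ and $u_1$, such that for every $\varepsilon$ with $0<\varepsilon<\varepsilon_0$ the Cauchy problem $$\partial_t^2u-\Delta u+\frac{\mu}{t}\,\partial_tu=|u|^p,\quad t\ge1,\ x\in\mathbb R^2,\qquad u(1,x)=\varepsilon u_0(x),\quad \partial_tu(1,x)=\varepsilon u_1(x),$$ has one and only one real-valued global solution $u$ in the class $$C\big([1,\infty);H^2(\mathbb R^2)\big)\cap C^1\big([1,\infty);H^1(\mathbb R^2)\big)\cap C^2\big([1,\infty);L^2(\mathbb R^2)\big),$$ where the equation is understood as an identity in $L^2(\mathbb R^2)$ for every $t\ge1$ (with one-sided time derivatives at $t=1$). -/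

import Mathlib

open MeasureTheory Set
open scoped ContDiff

noncomputable section

namespace DampedWave

/-- The Euclidean plane `ℝ²`. -/
abbrev Plane : Type := EuclideanSpace ℝ (Fin 2)

/-- The real Hilbert space `L²(ℝ²)`. -/
abbrev L2 : Type := Lp ℝ 2 (volume : Measure Plane)

/-- The classical partial derivative `∂ᵢ φ`. -/
def partialD (i : Fin 2) (φ : Plane → ℝ) : Plane → ℝ :=
  fun x => fderiv ℝ φ x (EuclideanSpace.single i 1)

/-- The classical partial derivative `∂₁^{α₁} ∂₂^{α₂} φ`. -/
def multiD (α : ℕ × ℕ) (φ : Plane → ℝ) : Plane → ℝ :=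
  (partialD 0)^[α.1] ((partialD 1)^[α.2] φ)

/-- Real-valued test functions, the elements of `C_c^∞(ℝ²)`. -/
def IsTest (φ : Plane → ℝ) : Prop :=
  ContDiff ℝ ∞ φ ∧ HasCompactSupport φ

/-- `g` is the weak derivative `D^α f`, for `f, g ∈ L²(ℝ²)`. -/
def IsWeakD (α : ℕ × ℕ) (f g : L2) : Prop :=
  ∀ φ : Plane → ℝ, IsTest φ →
    ∫ x, f x * multiD α φ x = (-1) ^ (α.1 + α.2) * ∫ x, g x * φ x

theorem IsTest.partialD {φ : Plane → ℝ} (h : IsTest φ) (i : Fin 2) :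
    IsTest (partialD i φ) := by
  refine ⟨?_, ?_⟩
  · exact (h.1.fderiv_right (m := ∞) (by simp)).clm_apply contDiff_const
  · exact h.2.fderiv_apply (𝕜 := ℝ) _

theorem IsTest.multiD {φ : Plane → ℝ} (h : IsTest φ) (α : ℕ × ℕ) :
    IsTest (multiD α φ) := by
  have key : ∀ (i : Fin 2) (n : ℕ) (ψ : Plane → ℝ), IsTest ψ →
      IsTest ((DampedWave.partialD i)^[n] ψ) := by
    intro i n
    induction n with
    | zero => intro ψ hψ; exact hψ
    | succ n ih => intro ψ hψ; exact ih _ (hψ.partialD i)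
  exact key 0 _ _ (key 1 _ _ h)

theorem IsTest.integrable_mul {φ : Plane → ℝ} (h : IsTest φ) (f : L2) :
    Integrable (fun x => f x * φ x) :=
  MemLp.integrable_mul (p := 2) (q := 2) (Lp.memLp f)
    (h.1.continuous.memLp_of_hasCompactSupport h.2)

theorem IsWeakD.add {α : ℕ × ℕ} {f g f' g' : L2} (h : IsWeakD α f g) (h' : IsWeakD α f' g') :
    IsWeakD α (f + f') (g + g') := by
  intro φ hφ
  have e1 : ∀ (a b : L2) (ψ : Plane → ℝ), IsTest ψ →
      ∫ x, (a + b : L2) x * ψ x = (∫ x, a x * ψ x) + ∫ x, b x * ψ x := by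
    intro a b ψ hψ
    rw [← integral_add (hψ.integrable_mul a) (hψ.integrable_mul b)]
    refine integral_congr_ae ?_
    filter_upwards [Lp.coeFn_add a b] with x hx
    rw [hx, Pi.add_apply, add_mul]
  rw [e1 _ _ _ (hφ.multiD α), e1 _ _ _ hφ, h φ hφ, h' φ hφ, mul_add]

theorem IsWeakD.smul {α : ℕ × ℕ} {f g : L2} (c : ℝ) (h : IsWeakD α f g) :
    IsWeakD α (c • f) (c • g) := by
  intro φ hφ
  have e1 : ∀ (a : L2) (ψ : Plane → ℝ),
      ∫ x, (c • a : L2) x * ψ x = c * ∫ x, a x * ψ x := by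
    intro a ψ
    rw [← integral_const_mul]
    refine integral_congr_ae ?_
    filter_upwards [Lp.coeFn_smul c a] with x hx
    rw [hx, Pi.smul_apply, smul_eq_mul, mul_assoc]
  rw [e1, e1, h φ hφ]
  ring

theorem IsWeakD.zero (α : ℕ × ℕ) : IsWeakD α 0 0 := by
  intro φ hφ
  have e1 : ∀ ψ : Plane → ℝ, ∫ x, (0 : L2) x * ψ x = 0 := by
    intro ψ
    rw [← integral_zero Plane ℝ]
    refine integral_congr_ae ?_
    filter_upwards [Lp.coeFn_zero ℝ 2 (volume : Measure Plane)] with x hx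
    rw [hx, Pi.zero_apply, zero_mul]
  rw [e1, e1, mul_zero]

/-- Multi-indices `α = (α₁, α₂)` of order `|α| ≤ k`. -/
abbrev MultiIndex (k : ℕ) : Type := {α : ℕ × ℕ // α.1 + α.2 ≤ k}

instance (k : ℕ) : Fintype (MultiIndex k) :=
  Fintype.subtype
    ((Finset.range (k + 1) ×ˢ Finset.range (k + 1)).filter fun α => α.1 + α.2 ≤ k)
    (by intro α; simp only [Finset.mem_filter, Finset.mem_product, Finset.mem_range]; omega)

/-- The order-zero multi-index. -/
def MultiIndex.zero (k : ℕ) : MultiIndex k := ⟨(0, 0), Nat.zero_le k⟩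

/-- The Sobolev space `H^k(ℝ²)`: a function `f ∈ L²` all of whose weak derivatives `D^α f` of order
`|α| ≤ k` lie in `L²` is represented by the family `(D^α f)_{|α| ≤ k}` (which `f` determines). The
norm inherited from the ambient `ℓ²` sum is the usual one, `‖f‖² = ∑_{|α| ≤ k} ‖D^α f‖²_{L²}`. -/
def Sobolev (k : ℕ) : Submodule ℝ (PiLp 2 fun _ : MultiIndex k => L2) where
  carrier := {F | ∀ α : MultiIndex k, IsWeakD α.1 (F (MultiIndex.zero k)) (F α)}
  add_mem' := fun hF hG α => (hF α).add (hG α)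
  zero_mem' := fun α => IsWeakD.zero α.1
  smul_mem' := fun c _ hF α => (hF α).smul c

/-- The weak derivative `D^α f ∈ L²(ℝ²)` of `f ∈ H^k(ℝ²)`, `|α| ≤ k`. -/
def weakD {k : ℕ} (f : Sobolev k) (α : MultiIndex k) : L2 := f.1 α

/-- The inclusion `H^k(ℝ²) ⊆ L²(ℝ²)`. -/
def toL2 {k : ℕ} (f : Sobolev k) : L2 := weakD f (MultiIndex.zero k)

/-- The inclusion `H^m(ℝ²) ⊆ H^k(ℝ²)` for `k ≤ m`. -/
def incl {k m : ℕ} (h : k ≤ m) (f : Sobolev m) : Sobolev k :=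
  ⟨WithLp.toLp 2 fun α => weakD f ⟨α.1, α.2.trans h⟩, fun α => f.2 ⟨α.1, α.2.trans h⟩⟩

/-- The Laplacian `Δ f = ∂₁² f + ∂₂² f ∈ L²(ℝ²)` of `f ∈ H²(ℝ²)`. -/
def laplacian (f : Sobolev 2) : L2 :=
  weakD f ⟨(2, 0), le_rfl⟩ + weakD f ⟨(0, 2), le_rfl⟩

/-- `u ∈ C([1,∞); H²) ∩ C¹([1,∞); H¹) ∩ C²([1,∞); L²)` is a global solution of the Cauchy problem
`∂ₜ² u - Δ u + (μ / t) ∂ₜ u = |u|^p` for `t ≥ 1`, `u(1,·) = f₀`, `∂ₜ u(1,·) = f₁`.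
Time derivatives are those of the `L²`-valued curve `t ↦ u(t,·)`, one-sided at `t = 1`;
the equation holds for every `t ≥ 1` and almost every `x ∈ ℝ²`. -/
structure IsGlobalSolution (μ p : ℝ) (f₀ f₁ : Plane → ℝ) (u : ℝ → Sobolev 2) : Prop where
  continuous_H2 : ContinuousOn u (Ici 1)
  contDiff_H1 : ContDiffOn ℝ 1 (fun t => incl one_le_two (u t)) (Ici 1)
  contDiff_L2 : ContDiffOn ℝ 2 (fun t => toL2 (u t)) (Ici 1)
  equation : ∀ t : ℝ, 1 ≤ t → ∀ᵐ x : Plane,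
    iteratedDerivWithin 2 (fun s => toL2 (u s)) (Ici 1) t x - laplacian (u t) x
      + μ / t * derivWithin (fun s => toL2 (u s)) (Ici 1) t x = |toL2 (u t) x| ^ p
  initial_value : ∀ᵐ x : Plane, toL2 (u 1) x = f₀ x
  initial_velocity : ∀ᵐ x : Plane, derivWithin (fun s => toL2 (u s)) (Ici 1) 1 x = f₁ x

end DampedWave

end

/-! Everything is carried to L² by Bessel potentials. With ⟨D⟩ = (1 - Δ)^{1/2}, an H² function is u
= ⟨D⟩⁻² a and an H¹ velocity is ∂ₜu = ⟨D⟩⁻¹ b, with a, b in L². So `bessel (bessel a)` is u, `bessel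
b` is ∂ₜu, and ‖bessel a‖² - ‖bessel (bessel a)‖² is ‖∇u‖². Since L² is real here, the Fourier
transform is replaced by the Hartley transform, a real isometric involution.

Local theory. In the interaction picture of the Klein-Gordon group the equation becomes an ordinary
differential equation for (a, b) in L² × L² with locally Lipschitz right-hand side, because H² ⊆ L^∞
and p > 2. By Gagliardo-Nirenberg, ⟨D⟩|u|^p grows at most linearly in ‖a‖ while the H¹ norm of u
stays bounded (`exists_nonlinHalf_bound`), so by Gronwall an H¹ bound is enough to continue the
solution (`exists_strong`). Uniqueness is an energy estimate for the difference of two solutions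
(`IsStrong.unique`).

The H¹ bound comes from a bootstrap on ‖u‖ ≤ B t^{-(1-δ)} and ‖∂ₜu‖, ‖∇u‖ ≤ B t^{-μ/2}, with δ
small. It rests on two energies.

The first gives the decay of ‖u‖ (`exists_norm_decay`). Put G = (λ - Δ)⁻¹ and E(s) = ⟨G(s∂ₜu + u),
s∂ₜu + u⟩ + (μ - 2)⟨Gu, u⟩ + s²⟨G∇u, ∇u⟩. For μ > 2 its derivative is at most 2s⟨G(s∂ₜu + u),
|u|^p⟩. If λ = (μ - 2)/T², then E(T) ≥ T²‖u(T)‖², because λG + G(-Δ) = 1. The dual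
Gagliardo-Nirenberg inequality bounds ⟨Gf, f⟩^{1/2} by λ^{-δ/2} times an L^q norm of f with q
slightly above 1. This costs a factor T^δ, and p > 2 makes the source integrable in time.

The second is t^μ(‖∂ₜu‖² + ‖∇u‖²) with lower-order corrections (`waveEnergy`). Without the
nonlinearity its derivative is μ(μ - 2)/2 · t^{μ-3}‖u‖², which the decay of ‖u‖ makes integrable
when μ < 3 (`exists_energy_decay`).

The L² estimate improves B to C(ε + B^p), and this improved constant is the one fed into the second
energy. The system therefore closes with B proportional to ε (`exists_bootstrap_radius`,
`exists_apriori_bound`). -/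

noncomputable section

/-! ### The Hartley transform on real L². -/

namespace DampedWave

open SchwartzMap FourierTransform

/-- The complexification of a real Schwartz function. -/
def complexify (φ : 𝓢(Plane, ℝ)) : 𝓢(Plane, ℂ) := φ.postcompCLM Complex.ofRealCLM

@[simp] theorem complexify_apply (φ : 𝓢(Plane, ℝ)) (x : Plane) : complexify φ x = (φ x : ℂ) := rfl

theorem complexify_add (φ ψ : 𝓢(Plane, ℝ)) :
    complexify (φ + ψ) = complexify φ + complexify ψ := by
  ext x; simp

theorem complexify_smul (c : ℝ) (φ : 𝓢(Plane, ℝ)) :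
    complexify (c • φ) = (c : ℂ) • complexify φ := by
  ext x; simp

theorem fourier_complexify_neg (φ : 𝓢(Plane, ℝ)) (ξ : Plane) :
    𝓕 (complexify φ) (-ξ) = star (𝓕 (complexify φ) ξ) := by
  rw [fourier_coe, Real.fourier_eq, Real.fourier_eq]
  change _ = (starRingEnd ℂ) _
  rw [← integral_conj]
  refine integral_congr_ae (Filter.Eventually.of_forall fun v => ?_)
  have : (Real.fourierChar (inner ℝ v ξ) : ℂ) =
      (starRingEnd ℂ) (Real.fourierChar (-inner ℝ v ξ) : ℂ) := by
    rw [← Circle.coe_inv_eq_conj, AddChar.map_neg_eq_inv, inv_inv]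
  simp only [inner_neg_right, neg_neg, Circle.smul_def, complexify_apply, smul_eq_mul, map_mul,
    Complex.conj_ofReal, this]

/-- The Hartley transform `∫ φ(x) (cos 2πx·ξ + sin 2πx·ξ) dx`, a real version of the Fourier
transform. -/
def hartleyFun : 𝓢(Plane, ℝ) →ₗ[ℝ] 𝓢(Plane, ℝ) where
  toFun φ := (𝓕 (complexify φ)).postcompCLM (Complex.reCLM - Complex.imCLM)
  map_add' φ ψ := by
    rw [complexify_add, FourierTransform.fourier_add, map_add]
  map_smul' c φ := by
    rw [complexify_smul, FourierTransform.fourier_smul]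
    ext x
    simp [mul_sub]

theorem hartleyFun_apply (φ : 𝓢(Plane, ℝ)) (ξ : Plane) :
    hartleyFun φ ξ = (𝓕 (complexify φ) ξ).re - (𝓕 (complexify φ) ξ).im := rfl

/-- For real φ the inverse transform is the complex conjugate of the Fourier transform, so Re - Im
is a fixed combination of the two. Involutivity then reduces to algebra with 𝓕𝓕 = reflection. -/
theorem complexify_hartleyFun (φ : 𝓢(Plane, ℝ)) :
    complexify (hartleyFun φ) =
      ((1 + Complex.I) / 2) • 𝓕 (complexify φ) + ((1 - Complex.I) / 2) • 𝓕⁻ (complexify φ) := by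
  ext ξ
  have h : 𝓕⁻ (complexify φ) ξ = star (𝓕 (complexify φ) ξ) := by
    rw [← fourier_complexify_neg]; rfl
  rw [complexify_apply, hartleyFun_apply, add_apply, smul_apply,
    smul_apply, h]
  apply Complex.ext
  · simp; ring
  · simp; ring

theorem fourier_fourier_apply (φ : 𝓢(Plane, ℂ)) (x : Plane) : 𝓕 (𝓕 φ) x = φ (-x) := by
  have h : 𝓕⁻ (𝓕 φ) (-x) = φ (-x) := by rw [fourierInv_fourier_eq]
  rw [← h, fourierInv_apply_eq]
  simp

theorem hartleyFun_involutive : Function.Involutive hartleyFun := by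
  intro φ
  ext x
  rw [hartleyFun_apply, complexify_hartleyFun, FourierTransform.fourier_add,
    FourierTransform.fourier_smul,
    FourierTransform.fourier_smul,
    fourier_fourierInv_eq]
  simp only [add_apply, smul_apply, fourier_fourier_apply]
  simp
  ring

/-- Re - Im is real-linear and the second factor is real, so it can be applied to both sides of the
multiplication formula for 𝓕. -/
theorem integral_hartleyFun_mul (φ ψ : 𝓢(Plane, ℝ)) :
    ∫ x, hartleyFun φ x * ψ x = ∫ x, φ x * hartleyFun ψ x := by
  have h := integral_fourier_mul_eq (complexify φ) (complexify ψ)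
  have e : ∀ (f g : 𝓢(Plane, ℂ)), (Complex.reCLM - Complex.imCLM) (∫ x, f x * g x)
      = ∫ x, (Complex.reCLM - Complex.imCLM) (f x * g x) := by
    intro f g
    refine (ContinuousLinearMap.integral_comp_comm _ ?_).symm
    exact MemLp.integrable_mul (p := 2) (q := 2) (f.memLp 2) (g.memLp 2)
  have h2 := congrArg (Complex.reCLM - Complex.imCLM) h
  rw [e, e] at h2
  convert h2 using 2
  · ext x; simp [hartleyFun_apply]; ring
  · ext x; simp [hartleyFun_apply]; ring

theorem inner_L2 (f g : L2) : inner ℝ f g = ∫ x, f x * g x := by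
  rw [L2.inner_def]
  refine integral_congr_ae (Filter.Eventually.of_forall fun x => ?_)
  simp [mul_comm]

theorem inner_toLp (f g : 𝓢(Plane, ℝ)) :
    inner ℝ (f.toLp 2 : L2) (g.toLp 2) = ∫ x, f x * g x := by
  rw [inner_L2]
  refine integral_congr_ae ?_
  filter_upwards [f.coeFn_toLp 2 volume, g.coeFn_toLp 2 volume] with x hf hg
  rw [hf, hg]

/-- Plancherel: a symmetric involution preserves the inner product. -/
theorem norm_hartleyFun_toLp (φ : 𝓢(Plane, ℝ)) :
    ‖((hartleyFun φ).toLp 2 : L2)‖ = ‖(φ.toLp 2 : L2)‖ := by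
  rw [norm_eq_sqrt_real_inner, norm_eq_sqrt_real_inner, inner_toLp, inner_toLp,
    integral_hartleyFun_mul, hartleyFun_involutive]

/-- The Hartley transform on `L²`. -/
def hartley : L2 ≃ₗᵢ[ℝ] L2 :=
  (LinearEquiv.ofInvolutive hartleyFun hartleyFun_involutive).extendOfIsometry
    (toLpCLM ℝ (E := Plane) ℝ 2 volume).toLinearMap (toLpCLM ℝ (E := Plane) ℝ 2 volume).toLinearMap
    (denseRange_toLpCLM ENNReal.ofNat_ne_top) (denseRange_toLpCLM ENNReal.ofNat_ne_top)
    norm_hartleyFun_toLp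

theorem hartley_toLp (φ : 𝓢(Plane, ℝ)) : hartley (φ.toLp 2) = (hartleyFun φ).toLp 2 := by
  apply LinearMap.extendOfNorm_eq
  · exact denseRange_toLpCLM ENNReal.ofNat_ne_top
  use 1
  intro f
  rw [one_mul]
  exact (norm_hartleyFun_toLp f).le

theorem hartley_hartley (f : L2) : hartley (hartley f) = f := by
  refine DenseRange.induction_on (p := fun f : L2 => hartley (hartley f) = f)
    (denseRange_toLpCLM (p := 2) ENNReal.ofNat_ne_top) f ?_ ?_
  · exact isClosed_eq (by fun_prop) continuous_id
  · intro φ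
    change hartley (hartley (φ.toLp 2)) = φ.toLp 2
    rw [hartley_toLp, hartley_toLp, hartleyFun_involutive]

theorem inner_hartley_left (f g : L2) : inner ℝ (hartley f) g = inner ℝ f (hartley g) := by
  conv_lhs => rw [← hartley_hartley g]
  exact hartley.inner_map_map _ _

/-- The Schwartz function underlying a test function. -/
def IsTest.toSchwartz {φ : Plane → ℝ} (h : IsTest φ) : 𝓢(Plane, ℝ) := h.2.toSchwartzMap h.1

@[simp] theorem IsTest.toSchwartz_apply {φ : Plane → ℝ} (h : IsTest φ) (x : Plane) :
    h.toSchwartz x = φ x := rfl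

/-- Classical partial derivatives of Schwartz functions. -/
def schwartzD (i : Fin 2) (φ : 𝓢(Plane, ℝ)) : 𝓢(Plane, ℝ) :=
  SchwartzMap.evalCLM ℝ Plane ℝ (EuclideanSpace.single i 1) (fderivCLM ℝ Plane ℝ φ)

theorem coe_schwartzD (i : Fin 2) (φ : 𝓢(Plane, ℝ)) : ⇑(schwartzD i φ) = partialD i φ := rfl

theorem fourier_schwartzD (i : Fin 2) (φ : 𝓢(Plane, ℝ)) (ξ : Plane) :
    𝓕 (complexify (schwartzD i φ)) ξ
      = (2 * Real.pi * Complex.I) * ((ξ i : ℂ) * 𝓕 (complexify φ) ξ) := by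
  have h1 : complexify (schwartzD i φ)
      = SchwartzMap.evalCLM ℝ Plane ℂ (EuclideanSpace.single i 1)
        (fderivCLM ℝ Plane ℂ (complexify φ)) := by
    ext x
    change ((fderiv ℝ φ x (EuclideanSpace.single i 1) : ℝ) : ℂ) =
      fderiv ℝ (fun y => ((φ y : ℝ) : ℂ)) x (EuclideanSpace.single i 1)
    have := (Complex.ofRealCLM.hasFDerivAt.comp x
      (φ.differentiableAt.hasFDerivAt (x := x))).fderiv
    change fderiv ℝ (fun y => ((φ y : ℝ) : ℂ)) x = _ at this
    rw [this]; rfl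
  rw [h1, fourier_evalCLM_eq, fourier_fderivCLM_eq]
  have h2 : (innerSL ℝ ξ) (EuclideanSpace.single i (1 : ℝ)) = ξ i := by
    simp [EuclideanSpace.inner_single_right]
  simp [smulRightCLM_apply_apply, mul_assoc, h2]

/-- Multiplication by i exchanges real and imaginary parts up to sign, which on the Hartley side is
a reflection of the frequency. All reflections and parity signs below originate here. -/
theorem hartleyFun_schwartzD (i : Fin 2) (φ : 𝓢(Plane, ℝ)) (ξ : Plane) :
    hartleyFun (schwartzD i φ) ξ = -(2 * Real.pi * ξ i) * hartleyFun φ (-ξ) := by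
  rw [hartleyFun_apply, hartleyFun_apply, fourier_schwartzD, fourier_complexify_neg]
  simp
  ring

end DampedWave

/-! ### Multiplication operators, Fourier multipliers and the reflection on L². -/

namespace DampedWave

open scoped BoundedContinuousFunction

theorem memLp_bcf_mul (m : Plane →ᵇ ℝ) (f : L2) : MemLp (fun x => m x * f x) 2 volume := by
  refine MemLp.of_le_mul (c := ‖m‖) (Lp.memLp f)
    (m.continuous.aestronglyMeasurable.mul (Lp.aestronglyMeasurable f))
    (Filter.Eventually.of_forall fun x => ?_)
  rw [norm_mul]
  exact mul_le_mul_of_nonneg_right (m.norm_coe_le_norm x) (norm_nonneg _)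

/-- Multiplication of `L²` functions by a bounded continuous function. -/
def mulOp (m : Plane →ᵇ ℝ) : L2 →L[ℝ] L2 :=
  LinearMap.mkContinuous
    { toFun := fun f => (memLp_bcf_mul m f).toLp _
      map_add' := fun f g => by
        rw [← MemLp.toLp_add]
        refine MemLp.toLp_congr _ _ ?_
        filter_upwards [Lp.coeFn_add f g] with x hx
        rw [hx]; simp [mul_add]
      map_smul' := fun c f => by
        rw [RingHom.id_apply, ← MemLp.toLp_const_smul]
        refine MemLp.toLp_congr _ _ ?_
        filter_upwards [Lp.coeFn_smul c f] with x hx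
        rw [hx]; simp [mul_left_comm] } ‖m‖
    (fun f => by
      refine Lp.norm_le_mul_norm_of_ae_le_mul ?_
      filter_upwards [(memLp_bcf_mul m f).coeFn_toLp] with x hx
      change ‖((memLp_bcf_mul m f).toLp _ : L2) x‖ ≤ _
      rw [hx, norm_mul]
      exact mul_le_mul_of_nonneg_right (m.norm_coe_le_norm x) (norm_nonneg _))

theorem coeFn_mulOp (m : Plane →ᵇ ℝ) (f : L2) : mulOp m f =ᵐ[volume] fun x => m x * f x :=
  (memLp_bcf_mul m f).coeFn_toLp

theorem inner_mulOp (m : Plane →ᵇ ℝ) (f g : L2) :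
    inner ℝ (mulOp m f) g = ∫ x, m x * (f x * g x) := by
  rw [inner_L2]
  refine integral_congr_ae ?_
  filter_upwards [coeFn_mulOp m f] with x hx
  rw [hx, mul_assoc]

theorem inner_mulOp_left (m : Plane →ᵇ ℝ) (f g : L2) :
    inner ℝ (mulOp m f) g = inner ℝ f (mulOp m g) := by
  rw [real_inner_comm _ f, inner_mulOp, inner_mulOp]
  simp only [mul_comm (f _)]

theorem mulOp_mul (m n : Plane →ᵇ ℝ) (f : L2) : mulOp (m * n) f = mulOp m (mulOp n f) := by
  refine Lp.ext ?_
  filter_upwards [coeFn_mulOp (m * n) f, coeFn_mulOp m (mulOp n f), coeFn_mulOp n f]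
    with x h1 h2 h3
  rw [h1, h2, h3, BoundedContinuousFunction.coe_mul, Pi.mul_apply, mul_assoc]

theorem mulOp_add (m n : Plane →ᵇ ℝ) (f : L2) : mulOp (m + n) f = mulOp m f + mulOp n f := by
  refine Lp.ext ?_
  filter_upwards [coeFn_mulOp (m + n) f, coeFn_mulOp m f, coeFn_mulOp n f,
    Lp.coeFn_add (mulOp m f) (mulOp n f)] with x h1 h2 h3 h4
  rw [h1, h4, Pi.add_apply, h2, h3, BoundedContinuousFunction.coe_add, Pi.add_apply, add_mul]

theorem mulOp_smul (c : ℝ) (m : Plane →ᵇ ℝ) (f : L2) : mulOp (c • m) f = c • mulOp m f := by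
  refine Lp.ext ?_
  filter_upwards [coeFn_mulOp (c • m) f, coeFn_mulOp m f,
    Lp.coeFn_smul c (mulOp m f)] with x h1 h2 h4
  rw [h1, h4, Pi.smul_apply, h2]
  simp [mul_assoc]

theorem mulOp_one (f : L2) : mulOp 1 f = f := by
  refine Lp.ext ?_
  filter_upwards [coeFn_mulOp 1 f] with x h1
  rw [h1]; simp

theorem norm_mulOp_le (m : Plane →ᵇ ℝ) (f : L2) {C : ℝ} (h : ∀ x, |m x| ≤ C) :
    ‖mulOp m f‖ ≤ C * ‖f‖ := by
  refine Lp.norm_le_mul_norm_of_ae_le_mul ?_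
  filter_upwards [coeFn_mulOp m f] with x hx
  rw [hx, norm_mul]
  exact mul_le_mul_of_nonneg_right (h x) (norm_nonneg _)

theorem inner_mulOp_nonneg (m : Plane →ᵇ ℝ) (f : L2) (h : ∀ x, 0 ≤ m x) :
    0 ≤ inner ℝ (mulOp m f) f := by
  rw [inner_mulOp]
  exact integral_nonneg fun x => mul_nonneg (h x) (mul_self_nonneg _)

/-- The Fourier multiplier with symbol `m`, acting on real `L²` functions; it is the usual one for
even `m`. -/
def mult (m : Plane →ᵇ ℝ) (f : L2) : L2 := hartley (mulOp m (hartley f))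

/-- `mult m` as a continuous linear map. -/
def multL (m : Plane →ᵇ ℝ) : L2 →L[ℝ] L2 :=
  (hartley.toContinuousLinearEquiv : L2 →L[ℝ] L2) ∘L mulOp m ∘L
    (hartley.toContinuousLinearEquiv : L2 →L[ℝ] L2)

@[simp] theorem multL_apply (m : Plane →ᵇ ℝ) (f : L2) : multL m f = mult m f := rfl

theorem hartley_mult (m : Plane →ᵇ ℝ) (f : L2) : hartley (mult m f) = mulOp m (hartley f) := by
  rw [mult, hartley_hartley]

theorem mult_add_right (m : Plane →ᵇ ℝ) (f g : L2) : mult m (f + g) = mult m f + mult m g :=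
  (multL m).map_add f g

theorem mult_sub_right (m : Plane →ᵇ ℝ) (f g : L2) : mult m (f - g) = mult m f - mult m g :=
  (multL m).map_sub f g

theorem mult_neg_right (m : Plane →ᵇ ℝ) (f : L2) : mult m (-f) = - mult m f :=
  (multL m).map_neg f

theorem mult_smul_right (m : Plane →ᵇ ℝ) (c : ℝ) (f : L2) : mult m (c • f) = c • mult m f :=
  (multL m).map_smul c f

theorem mult_zero_right (m : Plane →ᵇ ℝ) : mult m 0 = 0 := (multL m).map_zero

theorem mult_mul (m n : Plane →ᵇ ℝ) (f : L2) : mult (m * n) f = mult m (mult n f) := by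
  simp only [mult, hartley_hartley, mulOp_mul]

theorem mult_comm (m n : Plane →ᵇ ℝ) (f : L2) : mult m (mult n f) = mult n (mult m f) := by
  rw [← mult_mul, ← mult_mul, mul_comm]

theorem mult_add (m n : Plane →ᵇ ℝ) (f : L2) : mult (m + n) f = mult m f + mult n f := by
  simp only [mult, mulOp_add, map_add]

theorem mult_smul (c : ℝ) (m : Plane →ᵇ ℝ) (f : L2) : mult (c • m) f = c • mult m f := by
  simp only [mult, mulOp_smul, map_smul]

theorem mult_one (f : L2) : mult 1 f = f := by
  simp only [mult, mulOp_one, hartley_hartley]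

theorem norm_mult_le (m : Plane →ᵇ ℝ) (f : L2) {C : ℝ} (h : ∀ x, |m x| ≤ C) :
    ‖mult m f‖ ≤ C * ‖f‖ := by
  rw [mult, LinearIsometryEquiv.norm_map]
  exact (norm_mulOp_le m _ h).trans_eq (by rw [LinearIsometryEquiv.norm_map])

theorem inner_mult_left (m : Plane →ᵇ ℝ) (f g : L2) :
    inner ℝ (mult m f) g = inner ℝ f (mult m g) := by
  rw [mult, mult, inner_hartley_left, inner_mulOp_left, inner_hartley_left]

theorem inner_mult_self_nonneg (m : Plane →ᵇ ℝ) (f : L2) (h : ∀ x, 0 ≤ m x) :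
    0 ≤ inner ℝ (mult m f) f := by
  rw [mult, inner_hartley_left]
  exact inner_mulOp_nonneg m _ h

theorem measurePreserving_neg_plane :
    MeasurePreserving (fun x : Plane => -x) volume volume :=
  Measure.measurePreserving_neg volume

/-- The reflection `f ↦ f(-·)` on `L²`. -/
def reflect : L2 →ₗᵢ[ℝ] L2 :=
  Lp.compMeasurePreservingₗᵢ ℝ (fun x : Plane => -x) measurePreserving_neg_plane

theorem coeFn_reflect (f : L2) : reflect f =ᵐ[volume] fun x => f (-x) :=
  Lp.coeFn_compMeasurePreserving f measurePreserving_neg_plane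

theorem reflect_reflect (f : L2) : reflect (reflect f) = f := by
  refine Lp.ext ?_
  have h := measurePreserving_neg_plane.quasiMeasurePreserving.ae (coeFn_reflect f)
  filter_upwards [coeFn_reflect (reflect f), h] with x h1 h2
  rw [h1, h2, neg_neg]

theorem inner_reflect_left (f g : L2) : inner ℝ (reflect f) g = inner ℝ f (reflect g) := by
  conv_lhs => rw [← reflect_reflect g]
  exact reflect.inner_map_map _ _

theorem reflect_mulOp (m n : Plane →ᵇ ℝ) (h : ∀ x, m (-x) = n x) (f : L2) :
    reflect (mulOp m f) = mulOp n (reflect f) := by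
  refine Lp.ext ?_
  have h' := measurePreserving_neg_plane.quasiMeasurePreserving.ae (coeFn_mulOp m f)
  filter_upwards [coeFn_reflect (mulOp m f), coeFn_mulOp n (reflect f), h', coeFn_reflect f]
    with x h1 h2 h3 h4
  rw [h1, h2, h3, h4, h]

end DampedWave

/-! ### Density in L² of the image of the test functions under 1 - Δ. -/

namespace DampedWave

open SchwartzMap Filter Topology

theorem partialD_mul {f g : Plane → ℝ} (hf : Differentiable ℝ f) (hg : Differentiable ℝ g)
    (i : Fin 2) :
    partialD i (fun x => f x * g x) = fun x => partialD i f x * g x + f x * partialD i g x := by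
  ext x
  simp only [partialD]
  rw [fderiv_fun_mul (hf x) (hg x)]
  simp
  ring

theorem partialD_add {f g : Plane → ℝ} (hf : Differentiable ℝ f) (hg : Differentiable ℝ g)
    (i : Fin 2) :
    partialD i (fun x => f x + g x) = fun x => partialD i f x + partialD i g x := by
  ext x
  simp only [partialD]
  rw [fderiv_fun_add (hf x) (hg x)]
  simp

theorem partialD_dilate (f : Plane → ℝ) (c : ℝ) (i : Fin 2) :
    partialD i (fun x => f (c • x)) = fun x => c * partialD i f (c • x) := by
  ext x
  simp only [partialD]
  rw [fderiv_comp_smul]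
  simp

theorem contDiff_partialD {f : Plane → ℝ} (hf : ContDiff ℝ ∞ f) (i : Fin 2) :
    ContDiff ℝ ∞ (partialD i f) :=
  (hf.fderiv_right (m := ∞) (by simp)).clm_apply contDiff_const

theorem partialD_const_mul {f : Plane → ℝ} (hf : Differentiable ℝ f) (c : ℝ) (i : Fin 2) :
    partialD i (fun x => c * f x) = fun x => c * partialD i f x := by
  ext x
  simp only [partialD]
  rw [fderiv_const_mul (hf x)]
  simp

/-- The differential expression `φ - Δφ`. -/
def oneSubLaplace (φ : Plane → ℝ) : Plane → ℝ :=
  fun x => φ x - partialD 0 (partialD 0 φ) x - partialD 1 (partialD 1 φ) x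

theorem IsTest.sub {φ ψ : Plane → ℝ} (hφ : IsTest φ) (hψ : IsTest ψ) :
    IsTest (fun x => φ x - ψ x) :=
  ⟨hφ.1.sub hψ.1, hφ.2.sub hψ.2⟩

theorem IsTest.oneSubLaplace {φ : Plane → ℝ} (h : IsTest φ) : IsTest (oneSubLaplace φ) :=
  (h.sub ((h.partialD 0).partialD 0)).sub ((h.partialD 1).partialD 1)

/-- A smooth cut-off equal to one near the origin. -/
theorem exists_cutoff : ∃ χ : Plane → ℝ, IsTest χ ∧ ∀ x, ‖x‖ < 1 → χ x = 1 := by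
  let b : ContDiffBump (0 : Plane) := ⟨1, 2, one_pos, one_lt_two⟩
  refine ⟨b, ⟨b.contDiff, b.hasCompactSupport⟩, fun x hx => b.one_of_mem_closedBall ?_⟩
  simpa using hx.le

theorem IsTest.exists_bound {φ : Plane → ℝ} (h : IsTest φ) : ∃ C, ∀ x, |φ x| ≤ C :=
  h.1.continuous.bounded_above_of_compact_support h.2

theorem partialD_partialD_mul {f g : Plane → ℝ} (hf : ContDiff ℝ ∞ f) (hg : ContDiff ℝ ∞ g)
    (i : Fin 2) :
    partialD i (partialD i (fun x => f x * g x)) = fun x =>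
      partialD i (partialD i f) x * g x + 2 * (partialD i f x * partialD i g x)
        + f x * partialD i (partialD i g) x := by
  have d : ∀ {h : Plane → ℝ}, ContDiff ℝ ∞ h → Differentiable ℝ h := fun h =>
    h.differentiable (by simp)
  rw [partialD_mul (d hf) (d hg), partialD_add
    (d ((contDiff_partialD hf i).mul hg)) (d (hf.mul (contDiff_partialD hg i))),
    partialD_mul (d (contDiff_partialD hf i)) (d hg),
    partialD_mul (d hf) (d (contDiff_partialD hg i))]
  ext x; ring

/-- By the Leibniz rule, each derivative that falls on the dilated cut-off brings a factor c =
1/(n+1) ≤ 1, so the integrands have a common integrable majorant. Pointwise they are eventually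
constant, since the cut-off is 1 near any given point once n is large. -/
theorem tendsto_integral_mul_cutoff (g : L2) (ψ : 𝓢(Plane, ℝ)) {χ : Plane → ℝ} (hχ : IsTest χ)
    (h1 : ∀ x, ‖x‖ < 1 → χ x = 1) :
    Tendsto (fun n : ℕ => ∫ x, g x *
      oneSubLaplace (fun y => χ (((n : ℝ) + 1)⁻¹ • y) * ψ y) x) atTop
      (𝓝 (∫ x, g x * oneSubLaplace ψ x)) := by
  obtain ⟨C0, hC0⟩ := hχ.exists_bound
  obtain ⟨A0, hA0⟩ := (hχ.partialD 0).exists_bound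
  obtain ⟨A1, hA1⟩ := (hχ.partialD 1).exists_bound
  obtain ⟨B0, hB0⟩ := ((hχ.partialD 0).partialD 0).exists_bound
  obtain ⟨B1, hB1⟩ := ((hχ.partialD 1).partialD 1).exists_bound
  have hψ : ContDiff ℝ ∞ ψ := ψ.smooth ⊤
  have hχn : ∀ c : ℝ, ContDiff ℝ ∞ (fun y : Plane => χ (c • y)) := fun c =>
    hχ.1.comp (contDiff_const_smul c)
  have formula : ∀ (c : ℝ) (x : Plane), oneSubLaplace (fun y => χ (c • y) * ψ y) x =
      χ (c • x) * oneSubLaplace ψ x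
      - (c * (c * partialD 0 (partialD 0 χ) (c • x)) * ψ x
        + 2 * (c * partialD 0 χ (c • x) * partialD 0 ψ x))
      - (c * (c * partialD 1 (partialD 1 χ) (c • x)) * ψ x
        + 2 * (c * partialD 1 χ (c • x) * partialD 1 ψ x)) := by
    intro c x
    have e : ∀ i, partialD i (partialD i fun y => χ (c • y)) =
        fun x => c * (c * partialD i (partialD i χ) (c • x)) := by
      intro i
      have hd : Differentiable ℝ (fun x => partialD i χ (c • x)) :=
        ((contDiff_partialD hχ.1 i).comp (contDiff_const_smul c)).differentiable (by simp)
      rw [partialD_dilate, partialD_const_mul hd, partialD_dilate (partialD i χ)]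
    simp only [oneSubLaplace, partialD_partialD_mul (hχn c) hψ, e]
    simp only [partialD_dilate χ]
    ring
  have hcont : ∀ n : ℕ, Continuous
      (oneSubLaplace (fun y => χ (((n : ℝ) + 1)⁻¹ • y) * ψ y)) := by
    intro n
    have hs := (hχn ((n : ℝ) + 1)⁻¹).mul hψ
    exact (hs.continuous.sub (contDiff_partialD (contDiff_partialD hs 0) 0).continuous).sub
      (contDiff_partialD (contDiff_partialD hs 1) 1).continuous
  have hint : ∀ θ : 𝓢(Plane, ℝ), Integrable (fun x => g x * θ x) volume := fun θ =>
    MemLp.integrable_mul (p := 2) (q := 2) (Lp.memLp g) (θ.memLp 2)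
  have hL : Integrable (fun x => g x * oneSubLaplace ψ x) := by
    have := ((hint ψ).sub (hint (schwartzD 0 (schwartzD 0 ψ)))).sub
      (hint (schwartzD 1 (schwartzD 1 ψ)))
    refine this.congr (Eventually.of_forall fun x => ?_)
    simp only [Pi.sub_apply, oneSubLaplace, coe_schwartzD]
    ring
  refine tendsto_integral_of_dominated_convergence
    (fun x => C0 * |g x * oneSubLaplace ψ x| + (B0 * |g x * ψ x| + 2 * (A0 *
      |g x * schwartzD 0 ψ x|)) + (B1 * |g x * ψ x| + 2 * (A1 * |g x * schwartzD 1 ψ x|)))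
    (fun n => (Lp.aestronglyMeasurable g).mul (hcont n).aestronglyMeasurable) ?_ ?_ ?_
  · exact ((hL.abs.const_mul _).add (((hint ψ).abs.const_mul _).add
      (((hint _).abs.const_mul _).const_mul _))).add (((hint ψ).abs.const_mul _).add
      (((hint _).abs.const_mul _).const_mul _))
  · intro n
    refine Eventually.of_forall fun x => ?_
    set c : ℝ := ((n : ℝ) + 1)⁻¹ with hc
    have c0 : 0 ≤ c := by positivity
    have c1 : c ≤ 1 := by
      rw [hc]; exact inv_le_one_of_one_le₀ (by linarith [(Nat.cast_nonneg n : (0 : ℝ) ≤ n)])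
    have key1 : ∀ {y A : ℝ}, |y| ≤ A → |c * y| ≤ A := by
      intro y A h
      rw [abs_mul, abs_of_nonneg c0]
      exact (mul_le_of_le_one_left (abs_nonneg _) c1).trans h
    have key2 : ∀ {y A z : ℝ}, |y| ≤ A → |y * z| ≤ A * |z| := by
      intro y A z h
      rw [abs_mul]
      exact mul_le_mul_of_nonneg_right h (abs_nonneg _)
    rw [formula, Real.norm_eq_abs]
    have e : g x * (χ (c • x) * oneSubLaplace ψ x
      - (c * (c * partialD 0 (partialD 0 χ) (c • x)) * ψ x
        + 2 * (c * partialD 0 χ (c • x) * partialD 0 ψ x))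
      - (c * (c * partialD 1 (partialD 1 χ) (c • x)) * ψ x
        + 2 * (c * partialD 1 χ (c • x) * partialD 1 ψ x))) =
      χ (c • x) * (g x * oneSubLaplace ψ x)
      - (c * (c * partialD 0 (partialD 0 χ) (c • x)) * (g x * ψ x)
        + 2 * (c * partialD 0 χ (c • x) * (g x * partialD 0 ψ x)))
      - (c * (c * partialD 1 (partialD 1 χ) (c • x)) * (g x * ψ x)
        + 2 * (c * partialD 1 χ (c • x) * (g x * partialD 1 ψ x))) := by ring
    rw [e]
    refine (abs_sub _ _).trans (add_le_add ((abs_sub _ _).trans (add_le_add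
      (key2 (hC0 _)) ?_)) ?_)
    · refine (abs_add_le _ _).trans (add_le_add (key2 (key1 (key1 (hB0 _)))) ?_)
      rw [abs_mul, abs_two]
      exact mul_le_mul_of_nonneg_left (key2 (key1 (hA0 _))) zero_le_two
    · refine (abs_add_le _ _).trans (add_le_add (key2 (key1 (key1 (hB1 _)))) ?_)
      rw [abs_mul, abs_two]
      exact mul_le_mul_of_nonneg_left (key2 (key1 (hA1 _))) zero_le_two
  · refine Eventually.of_forall fun x => ?_
    refine tendsto_const_nhds.congr' ?_
    obtain ⟨N, hN⟩ := exists_nat_gt ‖x‖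
    filter_upwards [eventually_ge_atTop N] with n hn
    congr 1
    have hnn : ‖x‖ < (n : ℝ) + 1 := by
      have : (N : ℝ) ≤ n := by exact_mod_cast hn
      linarith
    have ev : (fun y => χ (((n : ℝ) + 1)⁻¹ • y) * ψ y) =ᶠ[𝓝 x] ψ := by
      have : ∀ᶠ y in 𝓝 x, ‖y‖ < (n : ℝ) + 1 :=
        continuous_norm.continuousAt.eventually_lt continuousAt_const hnn
      filter_upwards [this] with y hy
      rw [h1, one_mul]
      rw [norm_smul, norm_inv, Real.norm_of_nonneg (by positivity), inv_mul_lt_iff₀ (by positivity),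
        mul_one]
      exact hy
    have evD : ∀ {f h : Plane → ℝ} (i : Fin 2), f =ᶠ[𝓝 x] h →
        partialD i f =ᶠ[𝓝 x] partialD i h := by
      intro f h i hfh
      filter_upwards [hfh.fderiv (𝕜 := ℝ)] with y hy
      simp only [partialD, hy]
    simp only [oneSubLaplace]
    rw [ev.eq_of_nhds, (evD 0 (evD 0 ev)).eq_of_nhds, (evD 1 (evD 1 ev)).eq_of_nhds]

/-- The squared Bessel weight `1 + 4π²|ξ|²`. -/
def weightSq (ξ : Plane) : ℝ := 1 + (2 * Real.pi * ξ 0) ^ 2 + (2 * Real.pi * ξ 1) ^ 2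

theorem one_le_weightSq (ξ : Plane) : 1 ≤ weightSq ξ := by
  unfold weightSq; nlinarith [sq_nonneg (2 * Real.pi * ξ 0), sq_nonneg (2 * Real.pi * ξ 1)]

theorem continuous_weightSq : Continuous weightSq := by unfold weightSq; fun_prop

theorem weightSq_neg (ξ : Plane) : weightSq (-ξ) = weightSq ξ := by simp [weightSq]

/-- The Schwartz function `ψ - Δψ`. -/
def schwartzOneSub (ψ : 𝓢(Plane, ℝ)) : 𝓢(Plane, ℝ) :=
  ψ - schwartzD 0 (schwartzD 0 ψ) - schwartzD 1 (schwartzD 1 ψ)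

theorem coe_schwartzOneSub (ψ : 𝓢(Plane, ℝ)) : ⇑(schwartzOneSub ψ) = oneSubLaplace ψ := rfl

/-- Second derivatives involve two reflections, which cancel; 1 - Δ is therefore an honest
multiplication on the Hartley side. -/
theorem hartleyFun_schwartzOneSub (ψ : 𝓢(Plane, ℝ)) (ξ : Plane) :
    hartleyFun (schwartzOneSub ψ) ξ = weightSq ξ * hartleyFun ψ ξ := by
  rw [schwartzOneSub, map_sub, map_sub]
  simp only [sub_apply, hartleyFun_schwartzD, neg_neg, weightSq]
  simp
  ring

/-- The functions `φ - Δφ`, `φ` a test function, are dense in `L²`. -/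
theorem eq_zero_of_forall_integral_oneSubLaplace (g : L2)
    (h : ∀ φ, IsTest φ → ∫ x, g x * oneSubLaplace φ x = 0) : g = 0 := by
  -- The orthogonality extends to Schwartz functions, a class which, unlike the test functions, is
  -- preserved by the Hartley transform.
  have hS : ∀ ψ : 𝓢(Plane, ℝ), ∫ x, g x * oneSubLaplace ψ x = 0 := by
    intro ψ
    obtain ⟨χ, hχ, h1⟩ := exists_cutoff
    refine tendsto_nhds_unique (tendsto_integral_mul_cutoff g ψ hχ h1)
      (tendsto_const_nhds.congr fun n => (h _ ⟨?_, ?_⟩).symm)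
    · exact (hχ.1.comp (contDiff_const_smul _)).mul (ψ.smooth ⊤)
    · exact (hχ.2.comp_smul (by positivity)).mul_right
  -- For ψ the Hartley transform of η, that of ψ - Δψ is η times the weight, so orthogonality moves
  -- to the frequency side, with η an arbitrary test function.
  have hV : ∀ η : Plane → ℝ, ContDiff ℝ ∞ η → HasCompactSupport η →
      ∫ x, η x • (weightSq x * hartley g x) = 0 := by
    intro η h1 h2
    have hη : IsTest η := ⟨h1, h2⟩
    have h3 := hS (hartleyFun hη.toSchwartz)
    rw [← coe_schwartzOneSub] at h3
    have h4 : inner ℝ g ((schwartzOneSub (hartleyFun hη.toSchwartz)).toLp 2 : L2) = 0 := by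
      rw [inner_L2, ← h3]
      refine integral_congr_ae ?_
      filter_upwards [(schwartzOneSub (hartleyFun hη.toSchwartz)).coeFn_toLp 2 volume] with x hx
      rw [hx]
    rw [← hartley.inner_map_map, hartley_toLp, inner_L2] at h4
    rw [← h4]
    refine integral_congr_ae ?_
    filter_upwards [(hartleyFun (schwartzOneSub (hartleyFun hη.toSchwartz))).coeFn_toLp 2 volume]
      with x hx
    rw [hx, hartleyFun_schwartzOneSub, hartleyFun_involutive]
    simp; ring
  -- The weight is unbounded and the product need not be in L², but local integrability is enough
  -- for the fundamental lemma of the calculus of variations.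
  have hloc : LocallyIntegrable (fun x => weightSq x * hartley g x) := by
    have := ((Lp.memLp (hartley g)).locallyIntegrable (by norm_num)).continuous_mul
      continuous_weightSq
    exact this
  have hz := ae_eq_zero_of_integral_contDiff_smul_eq_zero hloc hV
  have : hartley g = 0 := by
    refine Lp.ext ?_
    filter_upwards [hz, Lp.coeFn_zero ℝ 2 (volume : Measure Plane)] with x hx h0
    rw [h0, Pi.zero_apply]
    exact (mul_eq_zero.mp hx).resolve_left (by linarith [one_le_weightSq x])
  exact (LinearIsometryEquiv.map_eq_zero_iff hartley).mp this

end DampedWave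

/-! ### Bessel potentials and the operators D^α (1 - Δ)^{-k/2}. -/

namespace DampedWave

open SchwartzMap Filter Topology
open scoped BoundedContinuousFunction

/-- The Bessel weight `⟨ξ⟩ = (1 + 4π²|ξ|²)^{1/2}`. -/
def weight (ξ : Plane) : ℝ := √(weightSq ξ)

theorem weight_sq (ξ : Plane) : weight ξ ^ 2 = weightSq ξ :=
  Real.sq_sqrt (by linarith [one_le_weightSq ξ])

theorem one_le_weight (ξ : Plane) : 1 ≤ weight ξ := Real.one_le_sqrt.mpr (one_le_weightSq ξ)

theorem weight_pos (ξ : Plane) : 0 < weight ξ := one_pos.trans_le (one_le_weight ξ)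

theorem continuous_weight : Continuous weight := continuous_weightSq.sqrt

theorem weight_neg (ξ : Plane) : weight (-ξ) = weight ξ := by rw [weight, weightSq_neg, weight]

/-- The Hartley symbol of `D^α`, up to a reflection. -/
def symbolD (α : ℕ × ℕ) (ξ : Plane) : ℝ :=
  (-1) ^ (∑ i ∈ Finset.range (α.1 + α.2 + 1), i) *
    ((2 * Real.pi * ξ 0) ^ α.1 * (2 * Real.pi * ξ 1) ^ α.2)

theorem symbolD_neg (α : ℕ × ℕ) (ξ : Plane) :
    symbolD α (-ξ) = (-1) ^ (α.1 + α.2) * symbolD α ξ := by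
  have h : ∀ (i : Fin 2), 2 * Real.pi * (-ξ) i = (-1) * (2 * Real.pi * ξ i) := by
    intro i; simp
  rw [symbolD, symbolD, h, h]
  generalize 2 * Real.pi * ξ 0 = A
  generalize 2 * Real.pi * ξ 1 = B
  rw [mul_pow, mul_pow, pow_add]
  ring

theorem abs_symbolD_le (α : ℕ × ℕ) (ξ : Plane) : |symbolD α ξ| ≤ weight ξ ^ (α.1 + α.2) := by
  have h : ∀ y : ℝ, y ^ 2 ≤ weightSq ξ → |y| ≤ weight ξ := fun y hy => by
    rw [← Real.sqrt_sq_eq_abs]; exact Real.sqrt_le_sqrt hy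
  rw [symbolD, abs_mul, abs_pow, abs_neg, abs_one, one_pow, one_mul, abs_mul, abs_pow, abs_pow,
    pow_add]
  refine mul_le_mul (pow_le_pow_left₀ (abs_nonneg _) (h _ ?_) _)
    (pow_le_pow_left₀ (abs_nonneg _) (h _ ?_) _) (by positivity)
    (pow_nonneg (weight_pos ξ).le _)
  · unfold weightSq; nlinarith [sq_nonneg (2 * Real.pi * ξ 1)]
  · unfold weightSq; nlinarith [sq_nonneg (2 * Real.pi * ξ 0)]

theorem continuous_symbolD (α : ℕ × ℕ) : Continuous (symbolD α) := by
  unfold symbolD; fun_prop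

/-- The bounded symbol `D^α (1 - Δ)^{-k/2}`. -/
def riesz (k : ℕ) (α : MultiIndex k) : Plane →ᵇ ℝ :=
  BoundedContinuousFunction.ofNormedAddCommGroup (fun ξ => symbolD α.1 ξ / weight ξ ^ k)
    ((continuous_symbolD _).div (continuous_weight.pow _)
      fun ξ => pow_ne_zero _ (weight_pos ξ).ne') 1
    (fun ξ => by
      rw [Real.norm_eq_abs, abs_div, abs_of_pos (pow_pos (weight_pos ξ) k),
        div_le_one (pow_pos (weight_pos ξ) k)]
      exact (abs_symbolD_le _ _).trans (pow_le_pow_right₀ (one_le_weight ξ) α.2))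

theorem riesz_apply (k : ℕ) (α : MultiIndex k) (ξ : Plane) :
    riesz k α ξ = symbolD α.1 ξ / weight ξ ^ k := rfl

/-- The symbol `⟨ξ⟩⁻¹`. -/
def besselSymbol : Plane →ᵇ ℝ :=
  BoundedContinuousFunction.ofNormedAddCommGroup (fun ξ => (weight ξ)⁻¹)
    (continuous_weight.inv₀ fun ξ => (weight_pos ξ).ne') 1
    (fun ξ => by
      rw [Real.norm_eq_abs, abs_inv, abs_of_pos (weight_pos ξ)]
      exact inv_le_one_of_one_le₀ (one_le_weight ξ))

theorem besselSymbol_apply (ξ : Plane) : besselSymbol ξ = (weight ξ)⁻¹ := rfl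

theorem besselSymbol_pos (ξ : Plane) : 0 < besselSymbol ξ := inv_pos.mpr (weight_pos ξ)

theorem abs_besselSymbol_le (ξ : Plane) : |besselSymbol ξ| ≤ 1 := by
  rw [abs_of_pos (besselSymbol_pos ξ)]
  exact inv_le_one_of_one_le₀ (one_le_weight ξ)

/-- `(1 - Δ)^{-1/2}`. -/
abbrev bessel (f : L2) : L2 := mult besselSymbol f

theorem norm_bessel_le (f : L2) : ‖bessel f‖ ≤ ‖f‖ :=
  (norm_mult_le _ _ abs_besselSymbol_le).trans_eq (one_mul _)

theorem inner_bessel_left (f g : L2) : inner ℝ (bessel f) g = inner ℝ f (bessel g) :=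
  inner_mult_left _ _ _

/-- The reflection iterated `n` times. -/
def reflectPow (n : ℕ) : L2 →L[ℝ] L2 := reflect.toContinuousLinearMap ^ n

theorem reflectPow_zero (f : L2) : reflectPow 0 f = f := rfl

theorem reflectPow_succ (n : ℕ) (f : L2) : reflectPow (n + 1) f = reflect (reflectPow n f) := by
  rw [reflectPow, pow_succ']; rfl

theorem inner_reflectPow_left (n : ℕ) (f g : L2) :
    inner ℝ (reflectPow n f) g = inner ℝ f (reflectPow n g) := by
  induction n generalizing f g with
  | zero => rfl
  | succ n ih =>
    rw [reflectPow_succ, inner_reflect_left, ih, reflectPow, reflectPow, pow_succ]; rfl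

theorem norm_reflectPow (n : ℕ) (f : L2) : ‖reflectPow n f‖ = ‖f‖ := by
  induction n with
  | zero => rfl
  | succ n ih => rw [reflectPow_succ, LinearIsometry.norm_map, ih]

theorem reflectPow_mulOp_even (n : ℕ) (m : Plane →ᵇ ℝ) (h : ∀ x, m (-x) = m x) (f : L2) :
    reflectPow n (mulOp m f) = mulOp m (reflectPow n f) := by
  induction n with
  | zero => rfl
  | succ n ih => rw [reflectPow_succ, reflectPow_succ, ih, reflect_mulOp m m h]

/-- An even symbol commutes with reflections. For odd n the symbol is odd and each of the n
reflections it passes contributes a sign. -/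
theorem reflectPow_mulOp_parity (n : ℕ) (m : Plane →ᵇ ℝ)
    (h : ∀ x, m (-x) = (-1) ^ n * m x) (f : L2) :
    reflectPow n (mulOp m f) = (-1 : ℝ) ^ n • mulOp m (reflectPow n f) := by
  rcases Nat.even_or_odd n with hn | hn
  · rw [hn.neg_one_pow, one_smul]
    refine reflectPow_mulOp_even n m (fun x => ?_) f
    rw [h, hn.neg_one_pow, one_mul]
  · have key : ∀ (j : ℕ), reflectPow j (mulOp m f) = (-1 : ℝ) ^ j • mulOp m (reflectPow j f) := by
      intro j
      induction j with
      | zero => simp [reflectPow_zero]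
      | succ j ih =>
        rw [reflectPow_succ, reflectPow_succ, ih, map_smul,
          reflect_mulOp m ((-1 : ℝ) • m) (fun x => by rw [h, hn.neg_one_pow]; rfl),
          mulOp_smul, smul_smul, pow_succ]
    exact key n

/-- The operator `D^α (1 - Δ)^{-k/2}`, bounded on `L²` for `|α| ≤ k`. -/
def rieszOp (k : ℕ) (α : MultiIndex k) : L2 →L[ℝ] L2 :=
  (hartley.toContinuousLinearEquiv : L2 →L[ℝ] L2) ∘L mulOp (riesz k α) ∘L
    reflectPow (α.1.1 + α.1.2) ∘L (hartley.toContinuousLinearEquiv : L2 →L[ℝ] L2)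

theorem rieszOp_apply (k : ℕ) (α : MultiIndex k) (f : L2) :
    rieszOp k α f = hartley (mulOp (riesz k α) (reflectPow (α.1.1 + α.1.2) (hartley f))) := rfl

theorem riesz_neg (k : ℕ) (α : MultiIndex k) (ξ : Plane) :
    riesz k α (-ξ) = (-1) ^ (α.1.1 + α.1.2) * riesz k α ξ := by
  rw [riesz_apply, riesz_apply, symbolD_neg, weight_neg, mul_div_assoc]

/-- Integration by parts: the adjoint reverses the order of multiplication and reflections, and
restoring it costs the parity of the symbol. -/
theorem inner_rieszOp_left (k : ℕ) (α : MultiIndex k) (f g : L2) :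
    inner ℝ (rieszOp k α f) g = (-1) ^ (α.1.1 + α.1.2) * inner ℝ f (rieszOp k α g) := by
  have h := reflectPow_mulOp_parity (α.1.1 + α.1.2) (riesz k α) (riesz_neg k α) (hartley g)
  rw [rieszOp_apply, rieszOp_apply, inner_hartley_left, inner_mulOp_left, inner_reflectPow_left,
    inner_hartley_left, ← inner_smul_right, ← map_smul hartley, h]

theorem norm_rieszOp_le (k : ℕ) (α : MultiIndex k) (f : L2) : ‖rieszOp k α f‖ ≤ ‖f‖ := by
  rw [rieszOp_apply, LinearIsometryEquiv.norm_map]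
  refine (norm_mulOp_le _ _ (C := 1) fun x => ?_).trans_eq ?_
  · rw [riesz_apply, abs_div, abs_of_pos (pow_pos (weight_pos x) k),
      div_le_one (pow_pos (weight_pos x) k)]
    exact (abs_symbolD_le _ _).trans (pow_le_pow_right₀ (one_le_weight x) α.2)
  · rw [one_mul, norm_reflectPow, LinearIsometryEquiv.norm_map]

/-- The Bessel symbol is even, so it passes the reflections and merges into the denominator of the
Riesz symbol. -/
theorem rieszOp_bessel (k : ℕ) (α : MultiIndex k) (f : L2) :
    rieszOp k α (bessel f) = rieszOp (k + 1) ⟨α.1, α.2.trans (Nat.le_succ k)⟩ f := by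
  rw [rieszOp_apply, rieszOp_apply, hartley_mult, reflectPow_mulOp_even _ _
    (fun x => by rw [besselSymbol_apply, besselSymbol_apply, weight_neg]), ← mulOp_mul]
  congr 2
  have h : riesz k α * besselSymbol = riesz (k + 1) ⟨α.1, α.2.trans (Nat.le_succ k)⟩ := by
    ext x
    have := (weight_pos x).ne'
    simp only [BoundedContinuousFunction.coe_mul, Pi.mul_apply, riesz_apply, besselSymbol_apply]
    rw [pow_succ]
    field_simp
  rw [h]

theorem rieszOp_zero (f : L2) : rieszOp 0 (MultiIndex.zero 0) f = f := by
  rw [rieszOp_apply]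
  have h : riesz 0 (MultiIndex.zero 0) = 1 := by
    ext x
    simp [riesz_apply, symbolD, MultiIndex.zero]
  rw [h, mulOp_one]
  exact hartley_hartley f

theorem rieszOp_one_zero (f : L2) : rieszOp 1 (MultiIndex.zero 1) f = bessel f := by
  rw [← rieszOp_zero (bessel f), rieszOp_bessel]; rfl

theorem rieszOp_two_zero (f : L2) : rieszOp 2 (MultiIndex.zero 2) f = bessel (bessel f) := by
  rw [← rieszOp_one_zero (bessel f), rieszOp_bessel]; rfl

/-- The `L²` class of a test function. -/
def IsTest.toL2 {φ : Plane → ℝ} (h : IsTest φ) : L2 := h.toSchwartz.toLp 2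

theorem IsTest.coeFn_toL2 {φ : Plane → ℝ} (h : IsTest φ) : h.toL2 =ᵐ[volume] φ :=
  h.toSchwartz.coeFn_toLp 2 volume

theorem IsTest.inner_toL2 {φ : Plane → ℝ} (h : IsTest φ) (f : L2) :
    inner ℝ f h.toL2 = ∫ x, f x * φ x := by
  rw [inner_L2]
  refine integral_congr_ae ?_
  filter_upwards [h.coeFn_toL2] with x hx
  rw [hx]

theorem IsTest.hartley_toL2 {φ : Plane → ℝ} (h : IsTest φ) :
    hartley h.toL2 =ᵐ[volume] hartleyFun h.toSchwartz := by
  rw [IsTest.toL2, hartley_toLp]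
  exact coeFn_toLp _ 2 volume

/-- Each derivative brings a minus sign and reflects the symbol of order n = a + b already present,
which has parity (-1)^n. The sign thus changes by (-1)^{n+1}, which accounts for the
triangular-number exponent in `symbolD`. -/
theorem symbolD_succ_fst (a b : ℕ) (ξ : Plane) :
    symbolD (a + 1, b) ξ = -(2 * Real.pi * ξ 0) * symbolD (a, b) (-ξ) := by
  rw [symbolD_neg]
  simp only [symbolD]
  rw [show a + 1 + b + 1 = (a + b + 1) + 1 by ring, Finset.sum_range_succ, pow_add]
  ring

theorem symbolD_succ_snd (b : ℕ) (ξ : Plane) :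
    symbolD (0, b + 1) ξ = -(2 * Real.pi * ξ 1) * symbolD (0, b) (-ξ) := by
  rw [symbolD_neg]
  simp only [symbolD]
  rw [show 0 + (b + 1) + 1 = (0 + b + 1) + 1 by ring, Finset.sum_range_succ, pow_add]
  ring

theorem IsTest.hartleyFun_partialD {φ : Plane → ℝ} (h : IsTest φ) (i : Fin 2) (ξ : Plane) :
    hartleyFun (h.partialD i).toSchwartz ξ =
      -(2 * Real.pi * ξ i) * hartleyFun h.toSchwartz (-ξ) :=
  hartleyFun_schwartzD i h.toSchwartz ξ

theorem multiD_succ_fst (a b : ℕ) (φ : Plane → ℝ) :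
    multiD (a + 1, b) φ = partialD 0 (multiD (a, b) φ) := by
  simp only [multiD, Function.iterate_succ_apply']

theorem multiD_succ_snd (b : ℕ) (φ : Plane → ℝ) :
    multiD (0, b + 1) φ = partialD 1 (multiD (0, b) φ) := by
  simp only [multiD, Function.iterate_succ_apply', Function.iterate_zero, id]

theorem toSchwartz_congr {φ ψ : Plane → ℝ} (h : IsTest φ) (h' : IsTest ψ) (e : φ = ψ) :
    h.toSchwartz = h'.toSchwartz := by subst e; rfl

theorem IsTest.hartleyFun_multiD {φ : Plane → ℝ} (h : IsTest φ) (a b : ℕ) (ξ : Plane) :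
    hartleyFun (h.multiD (a, b)).toSchwartz ξ =
      symbolD (a, b) ξ * hartleyFun h.toSchwartz ((-1 : ℝ) ^ (a + b) • ξ) := by
  induction a generalizing ξ with
  | zero =>
    induction b generalizing ξ with
    | zero =>
      rw [toSchwartz_congr (h.multiD (0, 0)) h rfl]
      simp [symbolD]
    | succ b ih =>
      rw [toSchwartz_congr (h.multiD (0, b + 1)) ((h.multiD (0, b)).partialD 1)
        (multiD_succ_snd b φ), (h.multiD (0, b)).hartleyFun_partialD, ih, symbolD_succ_snd]
      rw [show 0 + (b + 1) = (0 + b) + 1 by ring, pow_succ]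
      simp
      ring
  | succ a ih =>
    rw [toSchwartz_congr (h.multiD (a + 1, b)) ((h.multiD (a, b)).partialD 0)
      (multiD_succ_fst a b φ), (h.multiD (a, b)).hartleyFun_partialD, ih, symbolD_succ_fst]
    rw [show a + 1 + b = (a + b) + 1 by ring, pow_succ]
    simp
    ring

theorem coeFn_reflectPow (n : ℕ) (f : L2) :
    reflectPow n f =ᵐ[volume] fun x => f ((-1 : ℝ) ^ n • x) := by
  induction n with
  | zero => simp [reflectPow_zero]
  | succ n ih =>
    rw [reflectPow_succ]
    filter_upwards [coeFn_reflect (reflectPow n f),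
      measurePreserving_neg_plane.quasiMeasurePreserving.ae ih] with x h1 h2
    rw [h1, h2, pow_succ]
    simp

theorem measurePreserving_neg_pow (n : ℕ) :
    MeasurePreserving (fun x : Plane => (-1 : ℝ) ^ n • x) volume volume := by
  rcases Nat.even_or_odd n with hn | hn
  · simp only [hn.neg_one_pow, one_smul]
    exact MeasurePreserving.id volume
  · simpa [hn.neg_one_pow] using measurePreserving_neg_plane

theorem IsTest.reflectPow_hartley {φ : Plane → ℝ} (h : IsTest φ) (n : ℕ) :
    reflectPow n (hartley h.toL2) =ᵐ[volume]
      fun x => hartleyFun h.toSchwartz ((-1 : ℝ) ^ n • x) := by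
  filter_upwards [coeFn_reflectPow n (hartley h.toL2),
    (measurePreserving_neg_pow n).quasiMeasurePreserving.ae h.hartley_toL2] with x h1 h2
  rw [h1, h2]

/-- For a test function `φ`, `D^α φ` is obtained from `φ - Δφ` by a bounded operator. -/
theorem IsTest.rieszOp_oneSub {φ : Plane → ℝ} (h : IsTest φ) (α : MultiIndex 2) :
    rieszOp 2 α h.oneSubLaplace.toL2 = (h.multiD α.1).toL2 := by
  rw [rieszOp_apply, ← hartley_hartley (h.multiD α.1).toL2]
  congr 1
  refine Lp.ext ?_
  filter_upwards [coeFn_mulOp (riesz 2 α)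
    (reflectPow (α.1.1 + α.1.2) (hartley h.oneSubLaplace.toL2)),
    h.oneSubLaplace.reflectPow_hartley (α.1.1 + α.1.2), (h.multiD α.1).hartley_toL2]
    with x h1 h2 h3
  rw [h1, h2, h3, show α.1 = (α.1.1, α.1.2) from rfl, h.hartleyFun_multiD]
  have e : h.oneSubLaplace.toSchwartz = schwartzOneSub h.toSchwartz := rfl
  rw [e, hartleyFun_schwartzOneSub, riesz_apply, weight_sq]
  have hw : weightSq ((-1 : ℝ) ^ (α.1.1 + α.1.2) • x) = weightSq x := by
    rcases Nat.even_or_odd (α.1.1 + α.1.2) with hn | hn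
    · rw [hn.neg_one_pow, one_smul]
    · rw [hn.neg_one_pow, neg_one_smul, weightSq_neg]
  have := (lt_of_lt_of_le one_pos (one_le_weightSq x)).ne'
  rw [hw]
  field_simp

theorem IsTest.bessel_bessel_oneSub {φ : Plane → ℝ} (h : IsTest φ) :
    bessel (bessel h.oneSubLaplace.toL2) = h.toL2 := by
  rw [← rieszOp_two_zero, h.rieszOp_oneSub]; rfl

/-- The functions `φ - Δφ`, `φ` a test function, are dense in `L²`. -/
theorem exists_seq_test_oneSub (f : L2) : ∃ (φ : ℕ → Plane → ℝ) (h : ∀ n, IsTest (φ n)),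
    Tendsto (fun n => (h n).oneSubLaplace.toL2) atTop (𝓝 f) := by
  let K : Submodule ℝ L2 :=
    { carrier := {g | ∃ (φ : Plane → ℝ) (h : IsTest φ), h.oneSubLaplace.toL2 = g}
      add_mem' := by
        rintro _ _ ⟨φ, h, rfl⟩ ⟨ψ, h', rfl⟩
        refine ⟨fun x => φ x + ψ x, ⟨h.1.add h'.1, h.2.add h'.2⟩, ?_⟩
        change (schwartzOneSub (h.toSchwartz + h'.toSchwartz)).toLp 2 volume =
          (schwartzOneSub h.toSchwartz).toLp 2 volume +
          (schwartzOneSub h'.toSchwartz).toLp 2 volume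
        have e2 : schwartzOneSub (h.toSchwartz + h'.toSchwartz) =
            schwartzOneSub h.toSchwartz + schwartzOneSub h'.toSchwartz := by
          simp only [schwartzOneSub, schwartzD, map_add]; abel
        rw [e2]; rfl
      zero_mem' := by
        refine ⟨fun _ => 0, ⟨contDiff_const, HasCompactSupport.zero⟩, ?_⟩
        refine Lp.ext ?_
        filter_upwards [IsTest.coeFn_toL2 (IsTest.oneSubLaplace (φ := fun _ => (0 : ℝ))
          ⟨contDiff_const, HasCompactSupport.zero⟩),
          Lp.coeFn_zero ℝ 2 (volume : Measure Plane)] with x h1 h2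
        rw [h1, h2]
        have e : ∀ i, partialD i (fun _ : Plane => (0 : ℝ)) = fun _ => 0 := by
          intro i; ext y; simp [partialD]
        simp [DampedWave.oneSubLaplace, e]
      smul_mem' := by
        rintro c _ ⟨φ, h, rfl⟩
        refine ⟨fun x => c * φ x, ⟨contDiff_const.mul h.1, h.2.mul_left⟩, ?_⟩
        change (schwartzOneSub (c • h.toSchwartz)).toLp 2 volume =
          c • (schwartzOneSub h.toSchwartz).toLp 2 volume
        have e2 : schwartzOneSub (c • h.toSchwartz) = c • schwartzOneSub h.toSchwartz := by
          simp only [schwartzOneSub, schwartzD, map_smul, smul_sub]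
        rw [e2]; rfl }
  -- A subspace of a Hilbert space is dense if its orthogonal complement is trivial.
  have hK : K.topologicalClosure = ⊤ := by
    rw [Submodule.topologicalClosure_eq_top_iff, Submodule.eq_bot_iff]
    intro g hg
    refine eq_zero_of_forall_integral_oneSubLaplace g fun φ hφ => ?_
    rw [← hφ.oneSubLaplace.inner_toL2, real_inner_comm]
    exact (Submodule.mem_orthogonal _ _).mp hg _ ⟨φ, hφ, rfl⟩
  have hf : f ∈ closure (K : Set L2) := by
    rw [← Submodule.topologicalClosure_coe, hK]; trivial
  obtain ⟨s, hs, hs'⟩ := mem_closure_iff_seq_limit.mp hf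
  choose φ h hφ using hs
  exact ⟨φ, h, by simpa only [hφ] using hs'⟩

end DampedWave

/-! ### Identification of H¹ and H² with L². -/

namespace DampedWave

open SchwartzMap Filter Topology
open scoped BoundedContinuousFunction

theorem isWeakD_iff_inner {α : ℕ × ℕ} {f g : L2} : IsWeakD α f g ↔ ∀ φ (h : IsTest φ),
    inner ℝ f (h.multiD α).toL2 = (-1) ^ (α.1 + α.2) * inner ℝ g h.toL2 := by
  refine forall₂_congr fun φ h => ?_
  rw [IsTest.inner_toL2, IsTest.inner_toL2]

/-- On the Hartley side the symbol of D^α sits on the test function; moving it to the other factor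
crosses the reflections, and its parity is the sign in the definition of a weak derivative. -/
theorem isWeakD_rieszOp (k : ℕ) (α : MultiIndex k) (f : L2) :
    IsWeakD α.1 (rieszOp k (MultiIndex.zero k) f) (rieszOp k α f) := by
  rw [isWeakD_iff_inner]
  intro φ h
  set n := α.1.1 + α.1.2 with hn
  have e1 : inner ℝ (rieszOp k (MultiIndex.zero k) f) (h.multiD α.1).toL2 =
      inner ℝ (mulOp (riesz k α) (hartley f)) (reflectPow n (hartley h.toL2)) := by
    rw [rieszOp_apply, inner_hartley_left, inner_L2, inner_L2]
    refine integral_congr_ae ?_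
    filter_upwards [coeFn_mulOp (riesz k α) (hartley f),
      coeFn_mulOp (riesz k (MultiIndex.zero k)) (hartley f), h.reflectPow_hartley n,
      (h.multiD α.1).hartley_toL2] with x h1 h2 h3 h4
    rw [h1, h3, h4, show α.1 = (α.1.1, α.1.2) from rfl, h.hartleyFun_multiD]
    have h2' : (mulOp (riesz k (MultiIndex.zero k))
      (reflectPow ((MultiIndex.zero k).1.1 + (MultiIndex.zero k).1.2) (hartley f))) x =
      riesz k (MultiIndex.zero k) x * hartley f x := h2
    rw [h2', riesz_apply, riesz_apply]
    simp only [MultiIndex.zero, symbolD]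
    simp
    ring
  rw [e1, ← inner_reflectPow_left, reflectPow_mulOp_parity _ _ (riesz_neg k α), inner_smul_left,
    rieszOp_apply, inner_hartley_left]
  rfl

/-- The isomorphism `(1 - Δ)^{-k/2} : L² → H^k`. -/
def besselEmb (k : ℕ) : L2 →L[ℝ] Sobolev k :=
  (((PiLp.continuousLinearEquiv 2 ℝ (fun _ : MultiIndex k => L2)).symm :
      (∀ _ : MultiIndex k, L2) →L[ℝ] PiLp 2 fun _ : MultiIndex k => L2) ∘L
    ContinuousLinearMap.pi (rieszOp k)).codRestrict (Sobolev k)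
    (fun f α => isWeakD_rieszOp k α f)

theorem weakD_besselEmb (k : ℕ) (f : L2) (α : MultiIndex k) :
    weakD (besselEmb k f) α = rieszOp k α f := rfl

theorem incl_besselEmb (f : L2) : incl one_le_two (besselEmb 2 f) = besselEmb 1 (bessel f) := by
  refine Subtype.ext ?_
  ext1 α
  exact (rieszOp_bessel 1 α f).symm

theorem toL2_besselEmb_two (f : L2) : toL2 (besselEmb 2 f) = bessel (bessel f) :=
  rieszOp_two_zero f

theorem toL2_besselEmb_one (f : L2) : toL2 (besselEmb 1 f) = bessel f := rieszOp_one_zero f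

/-- Evaluation of a component of an element of `H^k`. -/
def weakDL (k : ℕ) (α : MultiIndex k) : Sobolev k →L[ℝ] L2 :=
  (PiLp.proj 2 (fun _ : MultiIndex k => L2) α) ∘L (Sobolev k).subtypeL

@[simp] theorem weakDL_apply (k : ℕ) (α : MultiIndex k) (f : Sobolev k) :
    weakDL k α f = weakD f α := rfl

/-- The multi-index of order one in direction `i`. -/
def unitIndex (k : ℕ) (i : Fin 2) (hk : 1 ≤ k) : MultiIndex k :=
  ⟨if i = 0 then (1, 0) else (0, 1), by split <;> simpa using hk⟩

theorem multiD_unitIndex (k : ℕ) (i : Fin 2) (hk : 1 ≤ k) (φ : Plane → ℝ) :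
    multiD (unitIndex k i hk).1 φ = partialD i φ := by
  fin_cases i <;> rfl

theorem order_unitIndex (k : ℕ) (i : Fin 2) (hk : 1 ≤ k) :
    (unitIndex k i hk).1.1 + (unitIndex k i hk).1.2 = 1 := by
  fin_cases i <;> rfl

/-- `f ↦ (1 - Δ) f` on `H²`. -/
def oneSubLap : Sobolev 2 →L[ℝ] L2 :=
  weakDL 2 (MultiIndex.zero 2) - weakDL 2 ⟨(2, 0), le_rfl⟩ - weakDL 2 ⟨(0, 2), le_rfl⟩

theorem oneSubLap_apply (f : Sobolev 2) : oneSubLap f = toL2 f - laplacian f := by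
  rw [laplacian, ← sub_sub]; rfl

/-- `(1 - Δ)^{-1/2} (f - ∂₀ g₀ - ∂₁ g₁)`. -/
def halfInv (f : L2) (g : Fin 2 → L2) : L2 :=
  bessel f - ∑ i, rieszOp 1 (unitIndex 1 i le_rfl) (g i)

/-- `f ↦ (1 - Δ)^{1/2} f` on `H¹`. -/
def halfLap : Sobolev 1 →L[ℝ] L2 :=
  multL besselSymbol ∘L weakDL 1 (MultiIndex.zero 1) -
    ∑ i, rieszOp 1 (unitIndex 1 i le_rfl) ∘L weakDL 1 (unitIndex 1 i le_rfl)

theorem halfLap_apply (f : Sobolev 1) :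
    halfLap f = halfInv (toL2 f) fun i => weakD f (unitIndex 1 i le_rfl) := by
  simp [halfLap, halfInv, toL2]

theorem eq_of_forall_inner_oneSub {f g : L2} (h : ∀ φ (hφ : IsTest φ),
    inner ℝ f hφ.oneSubLaplace.toL2 = inner ℝ g hφ.oneSubLaplace.toL2) : f = g := by
  rw [← sub_eq_zero]
  refine eq_zero_of_forall_integral_oneSubLaplace _ fun φ hφ => ?_
  rw [← hφ.oneSubLaplace.inner_toL2, inner_sub_left, h φ hφ, sub_self]

theorem IsTest.toL2_oneSub {φ : Plane → ℝ} (h : IsTest φ) :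
    h.oneSubLaplace.toL2 = h.toL2 - (h.multiD (2, 0)).toL2 - (h.multiD (0, 2)).toL2 := rfl

/-- Only test functions of the form φ - Δφ need to be considered, and on those ⟨D⟩⁻² just returns φ;
what remains is the definition of the second weak derivatives. -/
theorem bessel_bessel_oneSubLap (f : Sobolev 2) : bessel (bessel (oneSubLap f)) = toL2 f := by
  refine eq_of_forall_inner_oneSub fun φ hφ => ?_
  rw [inner_bessel_left, inner_bessel_left, hφ.bessel_bessel_oneSub, hφ.toL2_oneSub]
  have h1 := isWeakD_iff_inner.mp (f.2 ⟨(2, 0), le_rfl⟩) φ hφ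
  have h2 := isWeakD_iff_inner.mp (f.2 ⟨(0, 2), le_rfl⟩) φ hφ
  simp only [inner_sub_right]
  change inner ℝ (toL2 f) _ = _ at h1
  change inner ℝ (toL2 f) _ = _ at h2
  rw [h1, h2]
  change inner ℝ (toL2 f - weakD f ⟨(2, 0), le_rfl⟩ - weakD f ⟨(0, 2), le_rfl⟩) _ = _
  rw [inner_sub_left, inner_sub_left]
  simp [weakD]

/-- `halfInv` is ⟨D⟩⁻¹(1 - Δ) with one derivative already carried out. Paired with φ - Δφ, each
Riesz term is turned by skew-adjointness and by the weak derivative into ⟨f, ∂ᵢ²φ⟩. This places f in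
H¹ knowing only its gradient, which is what the nonlinearity needs. -/
theorem bessel_halfInv {f : L2} {g : Fin 2 → L2}
    (h : ∀ i, IsWeakD (unitIndex 1 i le_rfl).1 f (g i)) : bessel (halfInv f g) = f := by
  refine eq_of_forall_inner_oneSub fun φ hφ => ?_
  rw [inner_bessel_left, halfInv, inner_sub_left, inner_bessel_left, hφ.bessel_bessel_oneSub,
    sum_inner]
  have key : ∀ i, inner ℝ (rieszOp 1 (unitIndex 1 i le_rfl) (g i))
      (bessel hφ.oneSubLaplace.toL2) = inner ℝ f ((hφ.partialD i).partialD i).toL2 := by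
    intro i
    rw [inner_rieszOp_left, order_unitIndex, rieszOp_bessel]
    have e1 : rieszOp (1 + 1) ⟨(unitIndex 1 i le_rfl).1,
        (unitIndex 1 i le_rfl).2.trans (Nat.le_succ 1)⟩ hφ.oneSubLaplace.toL2 =
        (hφ.partialD i).toL2 := by
      refine (hφ.rieszOp_oneSub _).trans ?_
      fin_cases i <;> rfl
    rw [e1]
    have e2 := isWeakD_iff_inner.mp (h i) _ (hφ.partialD i)
    rw [order_unitIndex] at e2
    rw [← e2]
    fin_cases i <;> rfl
  rw [Finset.sum_congr rfl fun i _ => key i, Fin.sum_univ_two, hφ.toL2_oneSub, inner_sub_right,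
    inner_sub_right, ← sub_sub]
  rfl

theorem bessel_halfLap (f : Sobolev 1) : bessel (halfLap f) = toL2 f := by
  rw [halfLap_apply]
  exact bessel_halfInv fun i => f.2 _

theorem bessel_injective : Function.Injective bessel := by
  intro f g h
  have h0 : hartley (bessel (f - g)) = 0 := by
    rw [show bessel (f - g) = bessel f - bessel g from mult_sub_right _ _ _, h, sub_self, map_zero]
  rw [hartley_mult] at h0
  have : hartley (f - g) = 0 := by
    refine Lp.ext ?_
    have h1 := coeFn_mulOp besselSymbol (hartley (f - g))
    rw [h0] at h1
    filter_upwards [h1, Lp.coeFn_zero ℝ 2 (volume : Measure Plane)] with x h1 h2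
    rw [h2, Pi.zero_apply] at h1 ⊢
    exact (mul_eq_zero.mp h1.symm).resolve_left (besselSymbol_pos x).ne'
  rwa [LinearIsometryEquiv.map_eq_zero_iff, sub_eq_zero] at this

theorem halfLap_besselEmb (f : L2) : halfLap (besselEmb 1 f) = f :=
  bessel_injective (by rw [bessel_halfLap, toL2_besselEmb_one])

theorem oneSubLap_besselEmb (f : L2) : oneSubLap (besselEmb 2 f) = f :=
  bessel_injective (bessel_injective (by rw [bessel_bessel_oneSubLap, toL2_besselEmb_two]))

theorem laplacian_besselEmb (f : L2) : laplacian (besselEmb 2 f) = bessel (bessel f) - f := by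
  have h := oneSubLap_apply (besselEmb 2 f)
  rw [oneSubLap_besselEmb, toL2_besselEmb_two] at h
  rw [eq_sub_iff_add_eq] at h ⊢
  rw [add_comm, h]

/-- Testing against φ - Δφ is enough, by density. -/
theorem IsWeakD.unique {α : ℕ × ℕ} {f g g' : L2} (h : IsWeakD α f g) (h' : IsWeakD α f g') :
    g = g' := by
  refine eq_of_forall_inner_oneSub fun φ hφ => ?_
  have h1 := isWeakD_iff_inner.mp h _ hφ.oneSubLaplace
  have h2 := isWeakD_iff_inner.mp h' _ hφ.oneSubLaplace
  rw [h1] at h2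
  exact mul_left_cancel₀ (pow_ne_zero _ (by norm_num)) h2

theorem Sobolev.ext_toL2 {k : ℕ} {f g : Sobolev k} (h : toL2 f = toL2 g) : f = g := by
  refine Subtype.ext ?_
  ext1 α
  refine IsWeakD.unique (f.2 α) ?_
  change IsWeakD _ (toL2 f) _
  rw [h]
  exact g.2 α

/-- Together with `oneSubLap_besselEmb` this makes 1 - Δ a bijection from H² to L², so that curves
in H² can be replaced by curves in L². -/
theorem besselEmb_oneSubLap (f : Sobolev 2) : besselEmb 2 (oneSubLap f) = f :=
  Sobolev.ext_toL2 (by rw [toL2_besselEmb_two, bessel_bessel_oneSubLap])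

/-- `‖f‖² + ‖∇f‖² = ‖(1 - Δ)^{1/2} f‖²`. -/
theorem norm_sq_rieszOp_one (f : L2) :
    ‖bessel f‖ ^ 2 + ∑ i, ‖rieszOp 1 (unitIndex 1 i le_rfl) f‖ ^ 2 = ‖f‖ ^ 2 := by
  have h := congrArg (inner ℝ f) (halfLap_besselEmb f)
  rw [halfLap_apply, halfInv, inner_sub_right, inner_sum, real_inner_self_eq_norm_sq,
    toL2_besselEmb_one, ← inner_bessel_left, real_inner_self_eq_norm_sq] at h
  rw [← h, sub_eq_add_neg, ← Finset.sum_neg_distrib]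
  congr 1
  refine Finset.sum_congr rfl fun i _ => ?_
  rw [weakD_besselEmb, ← real_inner_self_eq_norm_sq]
  have h2 := inner_rieszOp_left 1 (unitIndex 1 i le_rfl) f (rieszOp 1 (unitIndex 1 i le_rfl) f)
  rw [order_unitIndex, pow_one] at h2
  rw [h2]; ring

end DampedWave

/-! ### Gagliardo-Nirenberg inequalities in the plane. -/

namespace DampedWave

open SchwartzMap Filter Topology
open scoped BoundedContinuousFunction

theorem norm_sq_L2 (f : L2) : ‖f‖ ^ 2 = ∫ x, f x ^ 2 := by
  rw [← real_inner_self_eq_norm_sq, inner_L2]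
  simp only [sq]

theorem norm_sq_toLp {f : Plane → ℝ} (hf : MemLp f 2 volume) :
    ‖(hf.toLp f : L2)‖ ^ 2 = ∫ x, f x ^ 2 := by
  rw [norm_sq_L2]
  refine integral_congr_ae ?_
  filter_upwards [hf.coeFn_toLp] with x hx
  rw [hx]

/-- The Cauchy–Schwarz inequality. -/
theorem integral_abs_mul_le {f g : Plane → ℝ} (hf : MemLp f 2 volume) (hg : MemLp g 2 volume) :
    ∫ x, |f x| * |g x| ≤ √(∫ x, f x ^ 2) * √(∫ x, g x ^ 2) := by
  have hf' : MemLp (fun x => |f x|) 2 volume := hf.abs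
  have hg' : MemLp (fun x => |g x|) 2 volume := hg.abs
  have h := real_inner_le_norm (hf'.toLp _ : L2) (hg'.toLp _)
  have e : inner ℝ (hf'.toLp _ : L2) (hg'.toLp _) = ∫ x, |f x| * |g x| := by
    rw [inner_L2]
    refine integral_congr_ae ?_
    filter_upwards [hf'.coeFn_toLp, hg'.coeFn_toLp] with x h1 h2
    rw [h1, h2]
  have n1 : ‖(hf'.toLp _ : L2)‖ = √(∫ x, f x ^ 2) := by
    rw [← Real.sqrt_sq (norm_nonneg _), norm_sq_toLp]
    simp only [sq_abs]
  have n2 : ‖(hg'.toLp _ : L2)‖ = √(∫ x, g x ^ 2) := by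
    rw [← Real.sqrt_sq (norm_nonneg _), norm_sq_toLp]
    simp only [sq_abs]
  rwa [e, n1, n2] at h

theorem IsTest.memLp {φ : Plane → ℝ} (h : IsTest φ) : MemLp φ 2 volume :=
  h.1.continuous.memLp_of_hasCompactSupport h.2

theorem IsTest.norm_sq_toL2 {φ : Plane → ℝ} (h : IsTest φ) : ‖h.toL2‖ ^ 2 = ∫ x, φ x ^ 2 :=
  norm_sq_toLp h.memLp

theorem norm_fderiv_le (φ : Plane → ℝ) (x : Plane) :
    ‖fderiv ℝ φ x‖ ≤ √(∑ i, partialD i φ x ^ 2) := by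
  refine ContinuousLinearMap.opNorm_le_bound _ (Real.sqrt_nonneg _) fun v => ?_
  have hv : v = ∑ i, v i • EuclideanSpace.single i (1 : ℝ) := by
    ext j
    fin_cases j <;> simp [Fin.sum_univ_two]
  have e : fderiv ℝ φ x v = ∑ i, partialD i φ x * v i := by
    conv_lhs => rw [hv, map_sum]
    refine Finset.sum_congr rfl fun i _ => ?_
    rw [map_smul, smul_eq_mul, mul_comm]; rfl
  rw [e, EuclideanSpace.norm_eq, Real.norm_eq_abs]
  simp only [Real.norm_eq_abs, sq_abs]
  rw [← Real.sqrt_mul (Finset.sum_nonneg fun _ _ => sq_nonneg _)]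
  exact Real.abs_le_sqrt (Finset.sum_mul_sq_le_sq_mul_sq _ _ _)

theorem IsTest.pow {φ : Plane → ℝ} (h : IsTest φ) (n : ℕ) (hn : n ≠ 0) :
    IsTest (fun x => φ x ^ n) :=
  ⟨h.1.pow n, h.2.comp_left (g := fun y => y ^ n) (zero_pow hn)⟩

/-- The Dirichlet integral of a test function. -/
def dirichlet (φ : Plane → ℝ) : ℝ := ∫ x, ∑ i, partialD i φ x ^ 2

theorem IsTest.integrable {φ : Plane → ℝ} (h : IsTest φ) : Integrable φ :=
  h.1.continuous.integrable_of_hasCompactSupport h.2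

/-- This is the embedding of W^{1,1} in L^{n/(n-1)}, and n/(n-1) = 2 in the plane. -/
theorem exists_sobolev_const : ∃ C : ℝ, 0 ≤ C ∧ ∀ φ, IsTest φ →
    ∫ x, φ x ^ 2 ≤ C * (∫ x, ‖fderiv ℝ φ x‖) ^ 2 := by
  refine ⟨(eLpNormLESNormFDerivOneConst (volume : Measure Plane) 2 : ℝ) ^ 2, by positivity,
    fun φ h => ?_⟩
  have h1 := eLpNorm_le_eLpNorm_fderiv_one (volume : Measure Plane)
    (h.1.of_le (by simp)) h.2 (p := 2) (by
      rw [finrank_euclideanSpace_fin]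
      exact ⟨by norm_num, by norm_num, by norm_num⟩)
  have h2 : Integrable (fderiv ℝ φ) volume :=
    (h.1.continuous_fderiv (by simp)).integrable_of_hasCompactSupport (h.2.fderiv ℝ)
  have e1 : ‖h.toL2‖ = (eLpNorm φ 2 volume).toReal := norm_toLp
  have h3 : ‖h.toL2‖ ≤ (eLpNormLESNormFDerivOneConst (volume : Measure Plane) 2 : ℝ) *
      ∫ x, ‖fderiv ℝ φ x‖ := by
    rw [e1]
    refine (ENNReal.toReal_mono ?_ h1).trans_eq ?_
    · exact ENNReal.mul_ne_top ENNReal.coe_ne_top (memLp_one_iff_integrable.mpr h2).eLpNorm_ne_top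
    · rw [ENNReal.toReal_mul, ENNReal.coe_toReal, eLpNorm_one_eq_lintegral_enorm,
        ← integral_norm_eq_lintegral_enorm h2.1]
      simp
  rw [← h.norm_sq_toL2, ← mul_pow]
  exact pow_le_pow_left₀ (norm_nonneg _) h3 2

/-- The W^{1,1} inequality is applied to φ^{m+1}, whose gradient is (m+1) φ^m ∇φ, and Cauchy-Schwarz
separates φ^m from ∇φ. -/
theorem exists_gagliardo_step : ∃ C : ℝ, 0 ≤ C ∧ ∀ φ, IsTest φ → ∀ m : ℕ, 1 ≤ m →
    ∫ x, φ x ^ (2 * (m + 1)) ≤ C * (m + 1) ^ 2 * ((∫ x, φ x ^ (2 * m)) * dirichlet φ) := by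
  obtain ⟨C, hC, hS⟩ := exists_sobolev_const
  refine ⟨C, hC, fun φ h m hm => ?_⟩
  have h1 := hS _ (h.pow (m + 1) (by omega))
  simp only [← pow_mul, mul_comm (m + 1) 2] at h1
  refine h1.trans ?_
  rw [mul_assoc]
  refine mul_le_mul_of_nonneg_left ?_ hC
  have hg : MemLp (fun x => √(∑ i, partialD i φ x ^ 2)) 2 volume := by
    refine Continuous.memLp_of_hasCompactSupport ?_ ?_
    · exact (continuous_finsetSum _ fun i _ => (h.partialD i).1.continuous.pow 2).sqrt
    · refine (h.2.fderiv ℝ).mono' ?_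
      intro x hx
      by_contra hn
      have h0 : fderiv ℝ φ x = 0 := image_eq_zero_of_notMem_tsupport hn
      apply hx
      simp [DampedWave.partialD, h0]
  have hcs := integral_abs_mul_le (h.pow m (by omega)).memLp hg
  have e1 : ∀ x, ‖fderiv ℝ (fun x => φ x ^ (m + 1)) x‖ ≤
      (m + 1) * (|φ x ^ m| * |√(∑ i, partialD i φ x ^ 2)|) := by
    intro x
    rw [((h.1.differentiable (by simp) x).hasFDerivAt.pow (m + 1)).fderiv, norm_smul,
      abs_of_nonneg (Real.sqrt_nonneg _)]
    simp only [Nat.add_sub_cancel, nsmul_eq_mul, norm_mul, Real.norm_eq_abs]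
    push_cast
    rw [abs_of_nonneg (by positivity : (0 : ℝ) ≤ (m : ℝ) + 1), mul_assoc]
    exact mul_le_mul_of_nonneg_left (mul_le_mul_of_nonneg_left (norm_fderiv_le φ x)
      (abs_nonneg _)) (by positivity)
  have h2 : Integrable (fun x => |φ x ^ m| * |√(∑ i, partialD i φ x ^ 2)|) volume :=
    MemLp.integrable_mul (p := 2) (q := 2) (h.pow m (by omega)).memLp.abs hg.abs
  have h3 : ∫ x, ‖fderiv ℝ (fun x => φ x ^ (m + 1)) x‖ ≤
      (m + 1) * (√(∫ x, (φ x ^ m) ^ 2) * √(∫ x, √(∑ i, partialD i φ x ^ 2) ^ 2)) := by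
    refine (integral_mono_of_nonneg (Eventually.of_forall fun _ => norm_nonneg _)
      (h2.const_mul _) (Eventually.of_forall e1)).trans ?_
    rw [integral_const_mul]
    exact mul_le_mul_of_nonneg_left hcs (by positivity)
  have hD : ∫ x, √(∑ i, partialD i φ x ^ 2) ^ 2 = dirichlet φ := by
    refine integral_congr_ae (Eventually.of_forall fun x => ?_)
    exact Real.sq_sqrt (Finset.sum_nonneg fun _ _ => sq_nonneg _)
  have hI : ∫ x, (φ x ^ m) ^ 2 = ∫ x, φ x ^ (2 * m) := by
    simp only [← pow_mul, mul_comm m 2]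
  have hD0 : 0 ≤ dirichlet φ := integral_nonneg fun x =>
    Finset.sum_nonneg fun _ _ => sq_nonneg _
  have hI0 : 0 ≤ ∫ x, φ x ^ (2 * m) := integral_nonneg fun x => by
    rw [pow_mul]; positivity
  rw [hD, hI] at h3
  refine (pow_le_pow_left₀ (integral_nonneg fun _ => norm_nonneg _) h3 2).trans_eq ?_
  rw [mul_pow, mul_pow, Real.sq_sqrt hI0, Real.sq_sqrt hD0]

/-- Iteration: two more powers of φ for each further Dirichlet integral. -/
theorem exists_gagliardo_test (m : ℕ) : ∃ C : ℝ, 0 ≤ C ∧ ∀ φ, IsTest φ →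
    ∫ x, φ x ^ (2 * (m + 1)) ≤ C * ((∫ x, φ x ^ 2) * dirichlet φ ^ m) := by
  obtain ⟨C, hC, hS⟩ := exists_gagliardo_step
  induction m with
  | zero => exact ⟨1, zero_le_one, fun φ _ => by simp⟩
  | succ m ih =>
    obtain ⟨C', hC', h'⟩ := ih
    refine ⟨C * ((m + 1 : ℕ) + 1) ^ 2 * C', by positivity, fun φ h => ?_⟩
    have hD0 : 0 ≤ dirichlet φ := integral_nonneg fun x =>
      Finset.sum_nonneg fun _ _ => sq_nonneg _
    refine (hS φ h (m + 1) (by omega)).trans ?_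
    rw [mul_assoc _ C']
    refine mul_le_mul_of_nonneg_left ?_ (by positivity)
    refine (mul_le_mul_of_nonneg_right (h' φ h) hD0).trans_eq ?_
    ring

theorem IsTest.bessel_oneSub {φ : Plane → ℝ} (h : IsTest φ) (i : Fin 2) :
    rieszOp 1 (unitIndex 1 i le_rfl) (bessel h.oneSubLaplace.toL2) = (h.partialD i).toL2 := by
  rw [rieszOp_bessel]
  refine (h.rieszOp_oneSub _).trans ?_
  fin_cases i <;> rfl

theorem IsTest.dirichlet_eq {φ : Plane → ℝ} (h : IsTest φ) :
    dirichlet φ = ∑ i, ‖(h.partialD i).toL2‖ ^ 2 := by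
  rw [dirichlet, integral_finsetSum]
  · exact Finset.sum_congr rfl fun i _ => ((h.partialD i).norm_sq_toL2).symm
  · exact fun i _ => ((h.partialD i).pow 2 two_ne_zero).integrable

/-- Test functions are dense in `H¹`. -/
theorem exists_seq_test_bessel (f : L2) : ∃ (φ : ℕ → Plane → ℝ) (h : ∀ n, IsTest (φ n)),
    Tendsto (fun n => bessel (h n).oneSubLaplace.toL2) atTop (𝓝 f) := by
  have hr : DenseRange (multL besselSymbol) := by
    have : ((multL besselSymbol).range).topologicalClosure = ⊤ := by
      rw [Submodule.topologicalClosure_eq_top_iff, Submodule.eq_bot_iff]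
      intro g hg
      refine bessel_injective ?_
      rw [show bessel (0 : L2) = 0 from mult_zero_right _]
      refine (inner_self_eq_zero (𝕜 := ℝ)).mp ?_
      rw [inner_bessel_left, real_inner_comm]
      exact (Submodule.mem_orthogonal _ _).mp hg _ ⟨bessel g, rfl⟩
    intro x
    have hx : x ∈ ((multL besselSymbol).range).topologicalClosure := by rw [this]; trivial
    exact hx
  have hd : Dense {g : L2 | ∃ (φ : Plane → ℝ) (h : IsTest φ), h.oneSubLaplace.toL2 = g} := by
    intro g
    obtain ⟨φ, h, hφ⟩ := exists_seq_test_oneSub g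
    exact mem_closure_of_tendsto hφ (Eventually.of_forall fun n => ⟨φ n, h n, rfl⟩)
  obtain ⟨s, hs, hs'⟩ := mem_closure_iff_seq_limit.mp
    (hr.dense_image (multL besselSymbol).continuous hd f)
  choose y hy hy' using hs
  choose φ h hφ using hy
  refine ⟨φ, h, ?_⟩
  convert hs' with n
  rw [← hy' n, ← hφ n]; rfl

theorem exists_subseq_ae {f : ℕ → L2} {g : L2} (h : Tendsto f atTop (𝓝 g)) :
    ∃ ns : ℕ → ℕ, StrictMono ns ∧ ∀ᵐ x, Tendsto (fun n => f (ns n) x) atTop (𝓝 (g x)) :=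
  (tendstoInMeasure_of_tendsto_Lp h).exists_seq_tendsto_ae

/-- Test functions approximate ⟨D⟩⁻¹b in H¹, where ‖b‖² - ‖bessel b‖² is the Dirichlet integral.
Fatou's lemma passes to the limit, and the lower integral is used because finiteness is part of the
claim. -/
theorem exists_gagliardo_lintegral (m : ℕ) : ∃ C : ℝ, 0 ≤ C ∧ ∀ b : L2,
    ∫⁻ x, ENNReal.ofReal (bessel b x ^ (2 * (m + 1))) ≤
      ENNReal.ofReal (C * (‖bessel b‖ ^ 2 * (‖b‖ ^ 2 - ‖bessel b‖ ^ 2) ^ m)) := by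
  obtain ⟨C, hC, hS⟩ := exists_gagliardo_test m
  refine ⟨C, hC, fun b => ?_⟩
  obtain ⟨φ, h, hφ⟩ := exists_seq_test_bessel b
  have l1 : Tendsto (fun n => (h n).toL2) atTop (𝓝 (bessel b)) := by
    have := ((multL besselSymbol).continuous.tendsto b).comp hφ
    refine this.congr fun n => ?_
    exact (h n).bessel_bessel_oneSub
  have l2 : ∀ i, Tendsto (fun n => ((h n).partialD i).toL2) atTop
      (𝓝 (rieszOp 1 (unitIndex 1 i le_rfl) b)) := by
    intro i
    have := ((rieszOp 1 (unitIndex 1 i le_rfl)).continuous.tendsto b).comp hφ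
    refine this.congr fun n => ?_
    exact (h n).bessel_oneSub i
  have l3 : Tendsto (fun n => C * ((∫ x, φ n x ^ 2) * dirichlet (φ n) ^ m)) atTop
      (𝓝 (C * (‖bessel b‖ ^ 2 * (‖b‖ ^ 2 - ‖bessel b‖ ^ 2) ^ m))) := by
    rw [← norm_sq_rieszOp_one b, add_sub_cancel_left]
    simp only [← (h _).norm_sq_toL2, (h _).dirichlet_eq]
    exact tendsto_const_nhds.mul ((l1.norm.pow 2).mul
      ((tendsto_finsetSum _ fun i _ => (l2 i).norm.pow 2).pow m))
  obtain ⟨ns, hns, hae⟩ := exists_subseq_ae l1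
  have hae' : ∀ᵐ x, Tendsto (fun n => φ (ns n) x) atTop (𝓝 (bessel b x)) := by
    have : ∀ᵐ x, ∀ n, (h (ns n)).toL2 x = φ (ns n) x :=
      ae_all_iff.mpr fun n => (h (ns n)).coeFn_toL2
    filter_upwards [hae, this] with x h1 h2
    exact h1.congr h2
  have fatou : ∫⁻ x, ENNReal.ofReal (bessel b x ^ (2 * (m + 1))) ≤
      liminf (fun n => ∫⁻ x, ENNReal.ofReal (φ (ns n) x ^ (2 * (m + 1)))) atTop := by
    refine le_trans (lintegral_mono_ae ?_) (lintegral_liminf_le fun n =>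
      (((h (ns n)).1.continuous.pow _).measurable.ennreal_ofReal))
    filter_upwards [hae'] with x hx
    exact ((ENNReal.continuous_ofReal.tendsto _).comp (hx.pow _)).liminf_eq.ge
  refine fatou.trans ?_
  have l4 : Tendsto (fun n => ENNReal.ofReal (C * ((∫ x, φ (ns n) x ^ 2) *
      dirichlet (φ (ns n)) ^ m))) atTop
      (𝓝 (ENNReal.ofReal (C * (‖bessel b‖ ^ 2 * (‖b‖ ^ 2 - ‖bessel b‖ ^ 2) ^ m)))) :=
    (ENNReal.continuous_ofReal.tendsto _).comp (l3.comp hns.tendsto_atTop)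
  rw [← l4.liminf_eq]
  refine liminf_le_liminf (Eventually.of_forall fun n => ?_)
  rw [← ofReal_integral_eq_lintegral_ofReal ((h (ns n)).pow _ (by omega)).integrable
    (Eventually.of_forall fun x => by simp only [Pi.zero_apply]; rw [pow_mul]; positivity)]
  exact ENNReal.ofReal_le_ofReal (hS _ (h (ns n)))

/-- The Gagliardo–Nirenberg inequality in the plane, for functions `(1 - Δ)^{-1/2} b` of `H¹`. -/
theorem exists_gagliardo (r : ℝ) (hr : 2 ≤ r) : ∃ C : ℝ, 0 < C ∧ ∀ (b : L2) (M : ℝ), 0 < M →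
    ‖b‖ ^ 2 - ‖bessel b‖ ^ 2 ≤ M ^ 2 → Integrable (fun x => |bessel b x| ^ r) ∧
      ∫ x, |bessel b x| ^ r ≤ C * (‖bessel b‖ ^ 2 * M ^ (r - 2)) := by
  obtain ⟨m, hm⟩ := exists_nat_ge r
  obtain ⟨C, hC, hS⟩ := exists_gagliardo_lintegral m
  refine ⟨1 + C, by positivity, fun b M hM hb => ?_⟩
  set u := bessel b with hu
  set k := 2 * (m + 1) with hk
  have hrk : r ≤ k := by
    rw [hk]; push_cast; nlinarith [(Nat.cast_nonneg m : (0 : ℝ) ≤ m)]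
  have hnn : ∀ x, 0 ≤ u x ^ k := fun x => by rw [hk, pow_mul]; positivity
  have hd0 : 0 ≤ ‖b‖ ^ 2 - ‖u‖ ^ 2 := by
    rw [← norm_sq_rieszOp_one b, add_sub_cancel_left]; positivity
  have hfin : ∫⁻ x, ENNReal.ofReal (u x ^ k) < ⊤ := (hS b).trans_lt ENNReal.ofReal_lt_top
  have hint : Integrable (fun x => u x ^ k) := by
    refine ⟨(Lp.aestronglyMeasurable u).pow k, ?_⟩
    rw [hasFiniteIntegral_iff_ofReal (Eventually.of_forall hnn)]
    exact hfin
  have hle : ∫ x, u x ^ k ≤ C * (‖u‖ ^ 2 * M ^ (2 * m)) := by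
    have h1 : ∫ x, u x ^ k ≤ C * (‖u‖ ^ 2 * (‖b‖ ^ 2 - ‖u‖ ^ 2) ^ m) := by
      rw [integral_eq_lintegral_of_nonneg_ae (Eventually.of_forall hnn) hint.1]
      exact ENNReal.toReal_le_of_le_ofReal (by positivity) (hS b)
    refine h1.trans ?_
    rw [pow_mul]
    gcongr
  have hint2 : Integrable (fun x => u x ^ 2) := (Lp.memLp u).integrable_sq
  -- Interpolation without Hölder: where |u| ≤ M the power r is compared with 2, and where |u| ≥ M
  -- with the even integer k ≥ r.
  have hpt : ∀ x, |u x| ^ r ≤ M ^ (r - 2) * u x ^ 2 + M ^ (r - k) * u x ^ k := by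
    intro x
    have e2 : u x ^ 2 = |u x| ^ (2 : ℝ) := by rw [Real.rpow_two, sq_abs]
    have ek : u x ^ k = |u x| ^ (k : ℝ) := by
      rw [Real.rpow_natCast, hk, pow_mul, pow_mul, sq_abs]
    rcases (abs_nonneg (u x)).eq_or_lt with h0 | h0
    · rw [← h0, Real.zero_rpow (by linarith)]
      exact add_nonneg (by positivity) (mul_nonneg (by positivity) (hnn x))
    rcases le_total |u x| M with h | h
    · have : |u x| ^ r ≤ M ^ (r - 2) * u x ^ 2 := by
        rw [e2, show |u x| ^ r = |u x| ^ (r - 2) * |u x| ^ (2 : ℝ) by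
          rw [← Real.rpow_add h0]; congr 1; ring]
        exact mul_le_mul_of_nonneg_right (Real.rpow_le_rpow h0.le h (by linarith))
          (by positivity)
      exact this.trans (le_add_of_nonneg_right (mul_nonneg (by positivity) (hnn x)))
    · have : |u x| ^ r ≤ M ^ (r - k) * u x ^ k := by
        rw [ek, show |u x| ^ r = |u x| ^ (r - k) * |u x| ^ (k : ℝ) by
          rw [← Real.rpow_add h0]; congr 1; ring]
        exact mul_le_mul_of_nonneg_right
          (Real.rpow_le_rpow_of_nonpos hM h (by linarith)) (by positivity)
      exact this.trans (le_add_of_nonneg_left (by positivity))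
  have hmaj : Integrable (fun x => M ^ (r - 2) * u x ^ 2 + M ^ (r - k) * u x ^ k) :=
    (hint2.const_mul _).add (hint.const_mul _)
  have hi : Integrable (fun x => |u x| ^ r) := by
    refine hmaj.mono' ?_ (Eventually.of_forall fun x => ?_)
    · exact ((Lp.aestronglyMeasurable u).aemeasurable.abs.pow_const r).aestronglyMeasurable
    · rw [Real.norm_of_nonneg (by positivity)]; exact hpt x
  refine ⟨hi, (integral_mono hi hmaj hpt).trans ?_⟩
  rw [integral_add (hint2.const_mul _) (hint.const_mul _), integral_const_mul, integral_const_mul,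
    ← norm_sq_L2]
  have e3 : M ^ (r - k) * M ^ (2 * m) = M ^ (r - 2) := by
    rw [← Real.rpow_natCast, ← Real.rpow_add hM]
    congr 1
    rw [hk]; push_cast; ring
  calc M ^ (r - 2) * ‖u‖ ^ 2 + M ^ (r - k) * ∫ x, u x ^ k
      ≤ M ^ (r - 2) * ‖u‖ ^ 2 + M ^ (r - k) * (C * (‖u‖ ^ 2 * M ^ (2 * m))) := by gcongr
    _ = M ^ (r - 2) * ‖u‖ ^ 2 + C * ‖u‖ ^ 2 * (M ^ (r - k) * M ^ (2 * m)) := by ring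
    _ = (1 + C) * (‖u‖ ^ 2 * M ^ (r - 2)) := by rw [e3]; ring

/-! ### The embedding `H² ⊆ L^∞` -/

/-- The square decays like |ξ|⁻⁴, and 4 exceeds the dimension. -/
theorem memLp_inv_weightSq : MemLp (fun ξ => (weightSq ξ)⁻¹) 2 volume := by
  have hc : Continuous fun ξ => (weightSq ξ)⁻¹ := continuous_weightSq.inv₀ fun ξ =>
    (lt_of_lt_of_le one_pos (one_le_weightSq ξ)).ne'
  rw [memLp_two_iff_integrable_sq hc.aestronglyMeasurable]
  have h := integrable_rpow_neg_one_add_norm_sq (E := Plane) (μ := volume) (r := 4)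
    (by rw [finrank_euclideanSpace_fin]; norm_num)
  refine h.mono' (hc.pow 2).aestronglyMeasurable (Eventually.of_forall fun ξ => ?_)
  have h1 : 1 + ‖ξ‖ ^ 2 ≤ weightSq ξ := by
    rw [EuclideanSpace.norm_sq_eq]
    simp only [Fin.sum_univ_two, Real.norm_eq_abs, sq_abs, weightSq]
    have hp : 1 ≤ (2 * Real.pi) ^ 2 := by nlinarith [Real.pi_gt_three]
    nlinarith [sq_nonneg (ξ 0), sq_nonneg (ξ 1), mul_le_mul_of_nonneg_right hp (sq_nonneg (ξ 0)),
      mul_le_mul_of_nonneg_right hp (sq_nonneg (ξ 1))]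
  rw [show (-(4 : ℝ) / 2) = -((2 : ℕ) : ℝ) by norm_num, Real.rpow_neg (by positivity),
    Real.rpow_natCast, Real.norm_of_nonneg (by positivity), inv_pow]
  gcongr

theorem exists_sup_test : ∃ C : ℝ, 0 < C ∧ ∀ φ (h : IsTest φ) (x : Plane),
    |φ x| ≤ C * ‖h.oneSubLaplace.toL2‖ := by
  -- The sup norm is at most the L¹ norm of the transform, the 2 coming from real and imaginary
  -- parts; Cauchy-Schwarz against the inverse weight does the rest. The added 1 only makes the
  -- constant positive.
  refine ⟨2 * √(∫ ξ, (weightSq ξ)⁻¹ ^ 2) + 1, by positivity, fun φ h x => ?_⟩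
  set θ := hartleyFun h.toSchwartz with hθ
  have e1 : φ x = hartleyFun θ x := by rw [hθ, hartleyFun_involutive]; rfl
  have h1 : |hartleyFun θ x| ≤ 2 * ∫ ξ, |θ ξ| := by
    have h2 := norm_fourier_apply_le_toLp_one (complexify θ) x
    rw [norm_toLp_one] at h2
    have e : ∀ ξ, ‖complexify θ ξ‖ = |θ ξ| := fun ξ => by simp
    simp only [e] at h2
    rw [hartleyFun_apply]
    refine (abs_sub _ _).trans ?_
    have := Complex.abs_re_le_norm (FourierTransform.fourier (complexify θ) x)
    have := Complex.abs_im_le_norm (FourierTransform.fourier (complexify θ) x)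
    linarith
  have e2 : ∀ ξ, |θ ξ| = |(weightSq ξ)⁻¹| * |hartleyFun h.oneSubLaplace.toSchwartz ξ| := by
    intro ξ
    have : hartleyFun h.oneSubLaplace.toSchwartz ξ = weightSq ξ * θ ξ :=
      hartleyFun_schwartzOneSub h.toSchwartz ξ
    rw [this, ← abs_mul, inv_mul_cancel_left₀ (lt_of_lt_of_le one_pos (one_le_weightSq ξ)).ne']
  have h3 := integral_abs_mul_le memLp_inv_weightSq
    ((hartleyFun h.oneSubLaplace.toSchwartz).memLp 2)
  simp only [← e2] at h3
  have e3 : √(∫ ξ, hartleyFun h.oneSubLaplace.toSchwartz ξ ^ 2) = ‖h.oneSubLaplace.toL2‖ := by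
    rw [← hartley.norm_map, IsTest.toL2, hartley_toLp, ← Real.sqrt_sq (norm_nonneg _)]
    congr 1
    exact (norm_sq_toLp ((hartleyFun h.oneSubLaplace.toSchwartz).memLp 2)).symm
  rw [e3] at h3
  rw [e1]
  nlinarith [norm_nonneg h.oneSubLaplace.toL2]

/-- The estimate for test functions survives the limit along an almost everywhere convergent
subsequence. -/
theorem exists_sup_bound : ∃ C : ℝ, 0 < C ∧ ∀ a : L2, ∀ᵐ x, |bessel (bessel a) x| ≤ C * ‖a‖ := by
  obtain ⟨C, hC, hS⟩ := exists_sup_test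
  refine ⟨C, hC, fun a => ?_⟩
  obtain ⟨φ, h, hφ⟩ := exists_seq_test_oneSub a
  have l1 : Tendsto (fun n => (h n).toL2) atTop (𝓝 (bessel (bessel a))) := by
    have := ((multL besselSymbol ∘L multL besselSymbol).continuous.tendsto a).comp hφ
    refine this.congr fun n => ?_
    exact (h n).bessel_bessel_oneSub
  obtain ⟨ns, hns, hae⟩ := exists_subseq_ae l1
  have : ∀ᵐ x, ∀ n, (h (ns n)).toL2 x = φ (ns n) x :=
    ae_all_iff.mpr fun n => (h (ns n)).coeFn_toL2
  filter_upwards [hae, this] with x h1 h2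
  refine le_of_tendsto_of_tendsto h1.abs ((hφ.comp hns.tendsto_atTop).norm.const_mul C)
    (Eventually.of_forall fun n => ?_)
  simp only [Function.comp]
  rw [h2]
  exact hS _ (h (ns n)) x

end DampedWave

/-! ### The nonlinearity |u|^p on H². -/

namespace DampedWave

open SchwartzMap Filter Topology
open scoped BoundedContinuousFunction

theorem abs_rpow_sub_le {p : ℝ} (hp : 1 < p) {s t M : ℝ} (hs : |s| ≤ M) (ht : |t| ≤ M) :
    |(|s| ^ p - |t| ^ p)| ≤ p * M ^ (p - 1) * |s - t| := by
  have hM : 0 ≤ M := (abs_nonneg _).trans hs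
  have h := (convex_Icc (-M) M).norm_image_sub_le_of_norm_hasDerivWithin_le
    (f := fun x : ℝ => |x| ^ p) (f' := fun x => p * |x| ^ (p - 2) * x) (C := p * M ^ (p - 1))
    (fun x _ => (hasDerivAt_abs_rpow x hp).hasDerivWithinAt) (fun x hx => ?_)
    (abs_le.mp ht) (abs_le.mp hs)
  · exact h
  · have hx' : |x| ≤ M := abs_le.mpr hx
    have e : |x| ^ (p - 2) * |x| = |x| ^ (p - 1) := by
      rcases (abs_nonneg x).eq_or_lt with h0 | h0
      · rw [← h0, mul_zero, Real.zero_rpow (by linarith)]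
      · rw [← Real.rpow_add_one h0.ne']; congr 1; ring
    rw [Real.norm_eq_abs, abs_mul, abs_mul, abs_of_pos (by linarith : 0 < p), mul_assoc,
      abs_of_nonneg (by positivity : 0 ≤ |x| ^ (p - 2)), e]
    exact mul_le_mul_of_nonneg_left (Real.rpow_le_rpow (abs_nonneg _) hx' (by linarith))
      (by linarith)

theorem abs_rpow_mul_self {q : ℝ} (hq : 0 < q) (s : ℝ) : |(|s| ^ q * s)| = |s| ^ (q + 1) := by
  rw [abs_mul, abs_of_nonneg (by positivity : 0 ≤ |s| ^ q)]
  rcases (abs_nonneg s).eq_or_lt with h0 | h0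
  · rw [← h0, mul_zero, Real.zero_rpow (by linarith)]
  · rw [← Real.rpow_add_one h0.ne']

/-- For equal signs this is the Lipschitz bound for |·|^{q+1}; for opposite signs both sides are
sums, estimated term by term. -/
theorem abs_rpow_mul_self_sub_le {q : ℝ} (hq : 0 < q) {s t M : ℝ} (hs : |s| ≤ M)
    (ht : |t| ≤ M) : |(|s| ^ q * s - |t| ^ q * t)| ≤ (q + 1) * M ^ q * |s - t| := by
  have key : ∀ {s t : ℝ}, |s| ≤ M → |t| ≤ M → 0 ≤ s → 0 ≤ t →
      |(|s| ^ q * s - |t| ^ q * t)| ≤ (q + 1) * M ^ q * |s - t| := by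
    intro s t hs ht h1 h2
    have h := abs_rpow_sub_le (p := q + 1) (by linarith) hs ht
    rw [← abs_rpow_mul_self hq s, ← abs_rpow_mul_self hq t, add_sub_cancel_right,
      abs_of_nonneg (by positivity : 0 ≤ |s| ^ q * s),
      abs_of_nonneg (by positivity : 0 ≤ |t| ^ q * t)] at h
    exact h
  have opp : ∀ {s t : ℝ}, |s| ≤ M → |t| ≤ M → 0 ≤ s → t ≤ 0 →
      |(|s| ^ q * s - |t| ^ q * t)| ≤ (q + 1) * M ^ q * |s - t| := by
    intro s t hs ht h1 h2
    have hM : 0 ≤ M := (abs_nonneg _).trans hs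
    have e1 : |s| ^ q ≤ M ^ q := Real.rpow_le_rpow (abs_nonneg _) hs hq.le
    have e2 : |t| ^ q ≤ M ^ q := Real.rpow_le_rpow (abs_nonneg _) ht hq.le
    have n1 : 0 ≤ |s| ^ q := by positivity
    have n2 : 0 ≤ |t| ^ q := by positivity
    have nM : 0 ≤ M ^ q := by positivity
    rw [abs_of_nonneg (by nlinarith : 0 ≤ |s| ^ q * s - |t| ^ q * t),
      abs_of_nonneg (by linarith : 0 ≤ s - t)]
    nlinarith [mul_le_mul_of_nonneg_right e1 h1, mul_le_mul_of_nonneg_right e2 (neg_nonneg.mpr h2),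
      mul_nonneg hq.le (mul_nonneg nM (by linarith : 0 ≤ s - t))]
  rcases le_total 0 s with h1 | h1 <;> rcases le_total 0 t with h2 | h2
  · exact key hs ht h1 h2
  · exact opp hs ht h1 h2
  · rw [abs_sub_comm, abs_sub_comm s]; exact opp ht hs h2 h1
  · have h := key (s := -s) (t := -t) (by rwa [abs_neg]) (by rwa [abs_neg]) (by linarith)
      (by linarith)
    simp only [abs_neg, mul_neg] at h
    rw [abs_sub_comm, abs_sub_comm s]
    convert h using 2 <;> ring_nf

theorem norm_le_of_ae_le_add {f d e : L2} {c₁ c₂ : ℝ} (h1 : 0 ≤ c₁) (h2 : 0 ≤ c₂)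
    (h : ∀ᵐ x, |f x| ≤ c₁ * |d x| + c₂ * |e x|) : ‖f‖ ≤ c₁ * ‖d‖ + c₂ * ‖e‖ := by
  have key : ‖f‖ ≤ ‖c₁ • |d| + c₂ • |e|‖ := by
    refine Lp.norm_le_norm_of_ae_le ?_
    filter_upwards [h, Lp.coeFn_add (c₁ • |d|) (c₂ • |e|), Lp.coeFn_smul c₁ |d|,
      Lp.coeFn_smul c₂ |e|, Lp.coeFn_abs d, Lp.coeFn_abs e] with x hx e1 e2 e3 e4 e5
    rw [e1, Pi.add_apply, e2, e3, Pi.smul_apply, Pi.smul_apply, e4, e5]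
    exact hx.trans (le_abs_self _)
  refine key.trans ((norm_add_le _ _).trans_eq ?_)
  rw [norm_smul, norm_smul, norm_abs_eq_norm, norm_abs_eq_norm, Real.norm_of_nonneg h1,
    Real.norm_of_nonneg h2]

/-- The element `|f|^p` of `L²`, if it is one. -/
def powL2 (p : ℝ) (f : L2) : L2 := by
  classical
  exact if h : MemLp (fun x => |f x| ^ p) 2 volume then h.toLp _ else 0

/-- The element `p |f|^{p-2} f g` of `L²`, if it is one. -/
def powDerivL2 (p : ℝ) (f g : L2) : L2 := by
  classical
  exact if h : MemLp (fun x => p * (|f x| ^ (p - 2) * f x) * g x) 2 volume then h.toLp _ else 0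

theorem aestronglyMeasurable_abs_rpow (p : ℝ) (f : L2) :
    AEStronglyMeasurable (fun x => |f x| ^ p) volume :=
  ((Lp.aestronglyMeasurable f).aemeasurable.abs.pow_const p).aestronglyMeasurable

theorem memLp_abs_rpow {p R : ℝ} (hp : 1 < p) {f : L2} (h : ∀ᵐ x, |f x| ≤ R) :
    MemLp (fun x => |f x| ^ p) 2 volume := by
  refine MemLp.of_le_mul (c := p * R ^ (p - 1)) (Lp.memLp f) (aestronglyMeasurable_abs_rpow p f) ?_
  filter_upwards [h] with x hx
  have h2 := abs_rpow_sub_le hp hx (t := 0) (by simpa using (abs_nonneg _).trans hx)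
  rwa [abs_zero, Real.zero_rpow (by linarith), sub_zero, sub_zero] at h2

theorem coeFn_powL2 {p R : ℝ} (hp : 1 < p) {f : L2} (h : ∀ᵐ x, |f x| ≤ R) :
    powL2 p f =ᵐ[volume] fun x => |f x| ^ p := by
  have hm := memLp_abs_rpow hp h
  rw [powL2, dif_pos hm]
  exact hm.coeFn_toLp

theorem abs_powDeriv_le {p : ℝ} (hp : 2 < p) {s R : ℝ} (hs : |s| ≤ R) :
    |p * (|s| ^ (p - 2) * s)| ≤ p * R ^ (p - 1) := by
  rw [abs_mul, abs_rpow_mul_self (by linarith), abs_of_pos (by linarith : 0 < p)]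
  rw [show p - 2 + 1 = p - 1 by ring]
  exact mul_le_mul_of_nonneg_left (Real.rpow_le_rpow (abs_nonneg _) hs (by linarith))
    (by linarith)

theorem coeFn_powDerivL2 {p R : ℝ} (hp : 2 < p) {f : L2} (h : ∀ᵐ x, |f x| ≤ R) (g : L2) :
    powDerivL2 p f g =ᵐ[volume] fun x => p * (|f x| ^ (p - 2) * f x) * g x := by
  have hm : MemLp (fun x => p * (|f x| ^ (p - 2) * f x) * g x) 2 volume := by
    refine MemLp.of_le_mul (c := p * R ^ (p - 1)) (Lp.memLp g)
      ((((aestronglyMeasurable_abs_rpow _ f).mul (Lp.aestronglyMeasurable f)).const_mul p).mul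
        (Lp.aestronglyMeasurable g)) ?_
    filter_upwards [h] with x hx
    rw [norm_mul]
    exact mul_le_mul_of_nonneg_right (abs_powDeriv_le hp hx) (norm_nonneg _)
  rw [powDerivL2, dif_pos hm]
  exact hm.coeFn_toLp

theorem norm_powL2_sub_le {p R : ℝ} (hp : 1 < p) {f g : L2}
    (hf : ∀ᵐ x, |f x| ≤ R) (hg : ∀ᵐ x, |g x| ≤ R) :
    ‖powL2 p f - powL2 p g‖ ≤ p * R ^ (p - 1) * ‖f - g‖ := by
  refine Lp.norm_le_mul_norm_of_ae_le_mul ?_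
  filter_upwards [hf, hg, coeFn_powL2 hp hf, coeFn_powL2 hp hg, Lp.coeFn_sub f g,
    Lp.coeFn_sub (powL2 p f) (powL2 p g)] with x h1 h2 h3 h4 h5 h6
  rw [h5, h6, Pi.sub_apply, Pi.sub_apply, h3, h4]
  exact abs_rpow_sub_le hp h1 h2

/-- The difference is split into (h(f) - h(g)) d and h(g) (d - e) with h(s) = p|s|^{p-2}s, which is
locally Lipschitz since p > 2. -/
theorem norm_powDerivL2_sub_le {p R δ : ℝ} (hp : 2 < p) (hR : 0 ≤ R) (hδ : 0 ≤ δ)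
    {f g d e : L2} (hf : ∀ᵐ x, |f x| ≤ R) (hg : ∀ᵐ x, |g x| ≤ R)
    (hfg : ∀ᵐ x, |(f - g) x| ≤ δ) :
    ‖powDerivL2 p f d - powDerivL2 p g e‖ ≤
      (p * ((p - 1) * R ^ (p - 2) * δ)) * ‖d‖ + (p * R ^ (p - 1)) * ‖d - e‖ := by
  have p0 : 0 < p := by linarith
  have p1 : 0 < p - 1 := by linarith
  refine norm_le_of_ae_le_add (by positivity) (by positivity) ?_
  filter_upwards [hf, hg, hfg, coeFn_powDerivL2 hp hf d, coeFn_powDerivL2 hp hg e,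
    Lp.coeFn_sub f g, Lp.coeFn_sub d e, Lp.coeFn_sub (powDerivL2 p f d) (powDerivL2 p g e)]
    with x h1 h2 h3 h4 h5 h6 h7 h8
  rw [h8, Pi.sub_apply, h4, h5, h7, Pi.sub_apply]
  rw [h6, Pi.sub_apply] at h3
  have e1 : p * (|f x| ^ (p - 2) * f x) * d x - p * (|g x| ^ (p - 2) * g x) * e x =
    p * ((|f x| ^ (p - 2) * f x) - (|g x| ^ (p - 2) * g x)) * d x
    + p * (|g x| ^ (p - 2) * g x) * (d x - e x) := by ring
  rw [e1]
  refine (abs_add_le _ _).trans (add_le_add ?_ ?_)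
  · rw [abs_mul, abs_mul, abs_of_pos p0]
    refine mul_le_mul_of_nonneg_right (mul_le_mul_of_nonneg_left ?_ p0.le) (abs_nonneg _)
    refine (abs_rpow_mul_self_sub_le (by linarith) h1 h2).trans ?_
    rw [show p - 2 + 1 = p - 1 by ring]
    exact mul_le_mul_of_nonneg_left h3 (by positivity)
  · rw [abs_mul]
    exact mul_le_mul_of_nonneg_right (abs_powDeriv_le hp h2) (abs_nonneg _)

/-- The operator `∂ᵢ (1 - Δ)⁻¹`. -/
abbrev partialOp (i : Fin 2) (a : L2) : L2 := rieszOp 2 (unitIndex 2 i one_le_two) a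

/-- The nonlinearity `|u|^p`, as a function of `a = (1 - Δ) u`. -/
def nonlin (p : ℝ) (a : L2) : L2 := powL2 p (bessel (bessel a))

/-- The gradient `p |u|^{p-2} u ∂ᵢ u` of `|u|^p`, as a function of `a = (1 - Δ) u`. -/
def nonlinGrad (p : ℝ) (i : Fin 2) (a : L2) : L2 :=
  powDerivL2 p (bessel (bessel a)) (partialOp i a)

/-- `(1 - Δ)^{1/2} |u|^p`, as a function of `a = (1 - Δ) u`. -/
def nonlinHalf (p : ℝ) (a : L2) : L2 := halfInv (nonlin p a) fun i => nonlinGrad p i a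

theorem bessel_bessel_sub (a b : L2) :
    bessel (bessel (a - b)) = bessel (bessel a) - bessel (bessel b) := by
  rw [bessel, bessel, mult_sub_right, mult_sub_right]

/-- The sup bound for H² makes |u|^p effectively Lipschitz on balls. The first estimate uses the L²
norm of the difference of the functions u themselves: uniqueness is proved in the energy norm and
cannot afford the difference of a and b. -/
theorem exists_nonlin_lipschitz {p : ℝ} (hp : 2 < p) (ρ : ℝ) (hρ : 0 ≤ ρ) : ∃ K : ℝ, 0 ≤ K ∧
    ∀ a b : L2, ‖a‖ ≤ ρ → ‖b‖ ≤ ρ →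
      ‖nonlin p a - nonlin p b‖ ≤ K * ‖bessel (bessel a) - bessel (bessel b)‖ ∧
      ∀ i, ‖nonlinGrad p i a - nonlinGrad p i b‖ ≤ K * ‖a - b‖ := by
  obtain ⟨C, hC, hsup⟩ := exists_sup_bound
  have p0 : 0 < p := by linarith
  have p1 : 0 < p - 1 := by linarith
  set R := C * ρ with hR
  have R0 : 0 ≤ R := by positivity
  refine ⟨p * R ^ (p - 1) + p * ((p - 1) * R ^ (p - 2) * C) * ρ, by positivity,
    fun a b ha hb => ?_⟩
  have sa : ∀ᵐ x, |bessel (bessel a) x| ≤ R := by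
    filter_upwards [hsup a] with x hx using hx.trans (mul_le_mul_of_nonneg_left ha hC.le)
  have sb : ∀ᵐ x, |bessel (bessel b) x| ≤ R := by
    filter_upwards [hsup b] with x hx using hx.trans (mul_le_mul_of_nonneg_left hb hC.le)
  have sab : ∀ᵐ x, |(bessel (bessel a) - bessel (bessel b)) x| ≤ C * ‖a - b‖ := by
    rw [← bessel_bessel_sub]; exact hsup _
  refine ⟨(norm_powL2_sub_le (by linarith) sa sb).trans ?_, fun i => ?_⟩
  · exact mul_le_mul_of_nonneg_right (le_add_of_nonneg_right (by positivity)) (norm_nonneg _)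
  · refine (norm_powDerivL2_sub_le hp R0 (by positivity) sa sb sab).trans ?_
    rw [← map_sub]
    have h1 : ‖partialOp i a‖ ≤ ρ := (norm_rieszOp_le _ _ _).trans ha
    have h2 : ‖partialOp i (a - b)‖ ≤ ‖a - b‖ := norm_rieszOp_le _ _ _
    calc p * ((p - 1) * R ^ (p - 2) * (C * ‖a - b‖)) * ‖partialOp i a‖
        + p * R ^ (p - 1) * ‖partialOp i (a - b)‖
        ≤ p * ((p - 1) * R ^ (p - 2) * (C * ‖a - b‖)) * ρ + p * R ^ (p - 1) * ‖a - b‖ := by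
          gcongr
      _ = _ := by ring

theorem continuous_of_lipschitz_on_balls {E F : Type*} [NormedAddCommGroup E]
    [NormedAddCommGroup F] {f : E → F}
    (h : ∀ ρ : ℝ, 0 ≤ ρ → ∃ K : ℝ, 0 ≤ K ∧ ∀ a b, ‖a‖ ≤ ρ → ‖b‖ ≤ ρ →
      ‖f a - f b‖ ≤ K * ‖a - b‖) : Continuous f := by
  rw [continuous_iff_continuousAt]
  intro x
  obtain ⟨K, hK, hf⟩ := h (‖x‖ + 1) (by positivity)
  have hl : LipschitzOnWith K.toNNReal f (Metric.ball 0 (‖x‖ + 1)) := by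
    refine LipschitzOnWith.of_dist_le_mul fun a ha b hb => ?_
    rw [dist_eq_norm, dist_eq_norm, Real.coe_toNNReal K hK]
    exact hf a b (by simpa using (mem_ball_zero_iff.mp ha).le)
      (by simpa using (mem_ball_zero_iff.mp hb).le)
  exact hl.continuousOn.continuousAt (Metric.isOpen_ball.mem_nhds (by simp))

theorem continuous_nonlin {p : ℝ} (hp : 2 < p) : Continuous (nonlin p) := by
  refine continuous_of_lipschitz_on_balls fun ρ hρ => ?_
  obtain ⟨K, hK, h⟩ := exists_nonlin_lipschitz hp ρ hρ
  refine ⟨K, hK, fun a b ha hb => ((h a b ha hb).1).trans (mul_le_mul_of_nonneg_left ?_ hK)⟩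
  rw [← bessel_bessel_sub]
  exact (norm_bessel_le _).trans (norm_bessel_le _)

theorem continuous_nonlinGrad {p : ℝ} (hp : 2 < p) (i : Fin 2) : Continuous (nonlinGrad p i) := by
  refine continuous_of_lipschitz_on_balls fun ρ hρ => ?_
  obtain ⟨K, hK, h⟩ := exists_nonlin_lipschitz hp ρ hρ
  exact ⟨K, hK, fun a b ha hb => (h a b ha hb).2 i⟩

theorem norm_halfInv_le (f : L2) (g : Fin 2 → L2) : ‖halfInv f g‖ ≤ ‖f‖ + ∑ i, ‖g i‖ := by
  refine (norm_sub_le _ _).trans (add_le_add (norm_bessel_le _) ?_)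
  exact (norm_sum_le _ _).trans (Finset.sum_le_sum fun i _ => norm_rieszOp_le _ _ _)

theorem exists_nonlinHalf_lipschitz {p : ℝ} (hp : 2 < p) (ρ : ℝ) (hρ : 0 ≤ ρ) :
    ∃ K : ℝ, 0 ≤ K ∧ ∀ a b : L2, ‖a‖ ≤ ρ → ‖b‖ ≤ ρ →
      ‖nonlinHalf p a - nonlinHalf p b‖ ≤ K * ‖a - b‖ := by
  obtain ⟨K, hK, h⟩ := exists_nonlin_lipschitz hp ρ hρ
  refine ⟨3 * K, by positivity, fun a b ha hb => ?_⟩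
  have e : nonlinHalf p a - nonlinHalf p b = halfInv (nonlin p a - nonlin p b)
      fun i => nonlinGrad p i a - nonlinGrad p i b := by
    simp only [nonlinHalf, halfInv, map_sub, Finset.sum_sub_distrib, bessel, mult_sub_right]
    abel
  obtain ⟨h1, h2⟩ := h a b ha hb
  have h3 : ‖bessel (bessel a) - bessel (bessel b)‖ ≤ ‖a - b‖ := by
    rw [← bessel_bessel_sub]
    exact (norm_bessel_le _).trans (norm_bessel_le _)
  rw [e]
  refine (norm_halfInv_le _ _).trans ?_
  rw [Fin.sum_univ_two]
  have := h2 0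
  have := h2 1
  nlinarith [mul_le_mul_of_nonneg_left h3 hK]

theorem IsTest.partialOp_oneSub {φ : Plane → ℝ} (h : IsTest φ) (i : Fin 2) :
    partialOp i h.oneSubLaplace.toL2 = (h.partialD i).toL2 := by
  refine (h.rieszOp_oneSub _).trans ?_
  fin_cases i <;> rfl

theorem integral_abs_rpow_mul_partialD {p : ℝ} (hp : 2 < p) {φ ψ : Plane → ℝ} (hφ : IsTest φ)
    (hψ : IsTest ψ) (i : Fin 2) :
    ∫ x, |φ x| ^ p * partialD i ψ x =
      - ∫ x, p * (|φ x| ^ (p - 2) * φ x) * partialD i φ x * ψ x := by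
  have hc : Continuous fun x => |φ x| ^ p :=
    hφ.1.continuous.abs.rpow_const fun _ => Or.inr (by linarith)
  have hc2 : Continuous fun x => p * (|φ x| ^ (p - 2) * φ x) * partialD i φ x :=
    (continuous_const.mul ((hφ.1.continuous.abs.rpow_const
      fun _ => Or.inr (by linarith)).mul hφ.1.continuous)).mul (hφ.partialD i).1.continuous
  have hd : ∀ x, HasFDerivAt (fun y => |φ y| ^ p)
      ((p * |φ x| ^ (p - 2) * φ x) • fderiv ℝ φ x) x := fun x =>
    (hasDerivAt_abs_rpow (φ x) (by linarith)).comp_hasFDerivAt x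
      (hφ.1.differentiable (by simp) x).hasFDerivAt
  have e : ∀ x, fderiv ℝ (fun y => |φ y| ^ p) x (EuclideanSpace.single i 1) =
      p * (|φ x| ^ (p - 2) * φ x) * partialD i φ x := by
    intro x
    rw [(hd x).fderiv]
    change p * |φ x| ^ (p - 2) * φ x * partialD i φ x = _
    ring
  have h := integral_mul_fderiv_eq_neg_fderiv_mul_of_integrable (μ := (volume : Measure Plane))
    (f := fun y => |φ y| ^ p) (g := ψ) (v := EuclideanSpace.single i 1) ?_ ?_ ?_
    (fun x _ => (hd x).differentiableAt) (fun x _ => hψ.1.differentiable (by simp) x)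
  · simp only [e] at h
    exact h
  · simp only [e]
    exact (hc2.mul hψ.1.continuous).integrable_of_hasCompactSupport hψ.2.mul_left
  · exact (hc.mul (hψ.partialD i).1.continuous).integrable_of_hasCompactSupport
      (hψ.partialD i).2.mul_left
  · exact (hc.mul hψ.1.continuous).integrable_of_hasCompactSupport hψ.2.mul_left

/-- The chain rule for `|u|^p`, `u ∈ H²`. -/
theorem isWeakD_nonlin {p : ℝ} (hp : 2 < p) (a : L2) (i : Fin 2) :
    IsWeakD (unitIndex 1 i le_rfl).1 (nonlin p a) (nonlinGrad p i a) := by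
  rw [isWeakD_iff_inner]
  intro ψ hψ
  -- Both sides are continuous in a, so the classical chain rule for test functions is enough.
  obtain ⟨φ, h, hφ⟩ := exists_seq_test_oneSub a
  have l1 := (((continuous_nonlin hp).tendsto a).comp hφ).inner
    (tendsto_const_nhds (x := (hψ.multiD (unitIndex 1 i le_rfl).1).toL2)) (𝕜 := ℝ)
  have l2 := ((((continuous_nonlinGrad hp i).tendsto a).comp hφ).inner
    (tendsto_const_nhds (x := hψ.toL2)) (𝕜 := ℝ)).const_mul
      ((-1) ^ ((unitIndex 1 i le_rfl).1.1 + (unitIndex 1 i le_rfl).1.2))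
  refine tendsto_nhds_unique l1 (l2.congr fun n => ?_)
  obtain ⟨R, hR⟩ := (h n).exists_bound
  have hb : ∀ᵐ x, |bessel (bessel (h n).oneSubLaplace.toL2) x| ≤ R := by
    rw [(h n).bessel_bessel_oneSub]
    filter_upwards [(h n).coeFn_toL2] with x hx
    rw [hx]; exact hR x
  have hb' : ∀ᵐ x, |(h n).toL2 x| ≤ R := by rwa [← (h n).bessel_bessel_oneSub]
  simp only [Function.comp]
  rw [order_unitIndex, pow_one, IsTest.inner_toL2, IsTest.inner_toL2, multiD_unitIndex, neg_one_mul]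
  have e1 : ∫ x, nonlin p (h n).oneSubLaplace.toL2 x * partialD i ψ x =
      ∫ x, |φ n x| ^ p * partialD i ψ x := by
    refine integral_congr_ae ?_
    rw [nonlin, (h n).bessel_bessel_oneSub]
    filter_upwards [coeFn_powL2 (by linarith : 1 < p) hb', (h n).coeFn_toL2] with x h1 h2
    rw [h1, h2]
  have e2 : ∫ x, nonlinGrad p i (h n).oneSubLaplace.toL2 x * ψ x =
      ∫ x, p * (|φ n x| ^ (p - 2) * φ n x) * partialD i (φ n) x * ψ x := by
    refine integral_congr_ae ?_
    rw [nonlinGrad, (h n).bessel_bessel_oneSub, (h n).partialOp_oneSub]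
    filter_upwards [coeFn_powDerivL2 hp hb' ((h n).partialD i).toL2, (h n).coeFn_toL2,
      ((h n).partialD i).coeFn_toL2] with x h1 h2 h3
    rw [h1, h2, h3]
  rw [e1, e2, integral_abs_rpow_mul_partialD hp (h n) hψ]

theorem bessel_nonlinHalf {p : ℝ} (hp : 2 < p) (a : L2) :
    bessel (nonlinHalf p a) = nonlin p a :=
  bessel_halfInv fun i => isWeakD_nonlin hp a i

theorem coeFn_nonlin {p : ℝ} (hp : 1 < p) (a : L2) :
    nonlin p a =ᵐ[volume] fun x => |bessel (bessel a) x| ^ p := by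
  obtain ⟨C, hC, hsup⟩ := exists_sup_bound
  exact coeFn_powL2 hp (hsup a)

theorem norm_nonlin_sq {p : ℝ} (hp : 1 < p) (a : L2) :
    ‖nonlin p a‖ ^ 2 = ∫ x, |bessel (bessel a) x| ^ (2 * p) := by
  rw [norm_sq_L2]
  refine integral_congr_ae ?_
  filter_upwards [coeFn_nonlin hp a] with x hx
  rw [hx, ← Real.rpow_natCast, ← Real.rpow_mul (abs_nonneg _)]
  congr 1
  push_cast; ring

theorem bessel_rieszOp (k : ℕ) (α : MultiIndex k) (f : L2) :
    bessel (rieszOp k α f) = rieszOp k α (bessel f) := by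
  rw [rieszOp_apply, rieszOp_apply, hartley_mult, reflectPow_mulOp_even _ _
    (fun x => by rw [besselSymbol_apply, besselSymbol_apply, weight_neg]), ← mulOp_mul, bessel,
    mult, hartley_hartley, ← mulOp_mul, mul_comm]

theorem partialOp_eq (i : Fin 2) (a : L2) :
    partialOp i a = bessel (rieszOp 1 (unitIndex 1 i le_rfl) a) := by
  rw [bessel_rieszOp, rieszOp_bessel]; rfl

theorem add_mul_le_sq_mul {A B s : ℝ} (hA : 0 ≤ A) (hB : 0 ≤ B) (hs : 1 ≤ s) :
    A + B * s ≤ (A + B + 1) ^ 2 * s := by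
  have h1 : A ≤ A * s := le_mul_of_one_le_right hA hs
  have h2 : A + B ≤ (A + B + 1) ^ 2 := by nlinarith [sq_nonneg (A + B)]
  have h3 := mul_le_mul_of_nonneg_right h2 (by linarith : 0 ≤ s)
  linarith

/-- A bound of `|u|^p` in `H¹` which is linear in the `H²` norm of `u`. -/
theorem exists_nonlinHalf_bound {p : ℝ} (hp : 2 < p) (m : ℝ) : ∃ K : ℝ, 0 ≤ K ∧
    ∀ a : L2, ‖bessel a‖ ≤ m → ‖nonlinHalf p a‖ ≤ K * (1 + ‖a‖) := by
  obtain ⟨C₁, hC₁, h₁⟩ := exists_gagliardo (2 * p) (by linarith)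
  obtain ⟨C₂, hC₂, h₂⟩ := exists_gagliardo (4 * (p - 1)) (by linarith)
  obtain ⟨C₃, hC₃, h₃⟩ := exists_gagliardo 4 (by linarith)
  obtain ⟨C, hC, hsup⟩ := exists_sup_bound
  set M := |m| + 1 with hM
  have M0 : 0 < M := by positivity
  set A₁ := C₁ * (M ^ 2 * M ^ (2 * p - 2)) with hA₁
  set A₂ := C₂ * (M ^ 2 * M ^ (4 * (p - 1) - 2)) with hA₂
  have A₁0 : 0 ≤ A₁ := by positivity
  have A₂0 : 0 ≤ A₂ := by positivity
  refine ⟨(A₁ + 1) + 2 * (p * (A₂ + C₃ * M ^ 2 + 1)), by positivity, fun a ha => ?_⟩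
  have haM : ‖bessel a‖ ≤ M := by
    have := le_abs_self m
    linarith
  have hu : ‖bessel (bessel a)‖ ≤ M := (norm_bessel_le _).trans haM
  have hgrad : ‖bessel a‖ ^ 2 - ‖bessel (bessel a)‖ ^ 2 ≤ M ^ 2 := by
    nlinarith [sq_nonneg ‖bessel (bessel a)‖, pow_le_pow_left₀ (norm_nonneg _) haM 2]
  have hu2 : ‖bessel (bessel a)‖ ^ 2 ≤ M ^ 2 := pow_le_pow_left₀ (norm_nonneg _) hu 2
  have b1 : ‖nonlin p a‖ ≤ A₁ + 1 := by
    have : ‖nonlin p a‖ ^ 2 ≤ A₁ := by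
      rw [norm_nonlin_sq (by linarith)]
      refine (h₁ (bessel a) M M0 hgrad).2.trans ?_
      rw [hA₁]
      gcongr
    nlinarith [sq_nonneg (‖nonlin p a‖ - 1)]
  have b2 : ∀ i, ‖nonlinGrad p i a‖ ≤ p * (A₂ + C₃ * M ^ 2 + 1) * (1 + ‖a‖) := by
    intro i
    set d := partialOp i a with hd
    obtain ⟨i₂, j₂⟩ := h₂ (bessel a) M M0 hgrad
    have hd1 : ‖d‖ ≤ M := by
      rw [hd, partialOp_eq, bessel_rieszOp]
      exact (norm_rieszOp_le _ _ _).trans haM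
    have hra : ‖rieszOp 1 (unitIndex 1 i le_rfl) a‖ ≤ ‖a‖ := norm_rieszOp_le _ _ _
    -- Gagliardo-Nirenberg in L⁴ for ∂ᵢu: its L² norm is controlled by M and its gradient by ‖a‖.
    -- This is why ∇|u|^p grows only linearly in ‖a‖.
    obtain ⟨i₃, j₃⟩ := h₃ (rieszOp 1 (unitIndex 1 i le_rfl) a) (1 + ‖a‖) (by positivity) (by
      nlinarith [sq_nonneg ‖bessel (rieszOp 1 (unitIndex 1 i le_rfl) a)‖,
        pow_le_pow_left₀ (norm_nonneg _) hra 2, norm_nonneg a])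
    rw [← partialOp_eq, ← hd] at i₃ j₃
    -- Pointwise, |u|^{2(p-1)}|∂ᵢu|² ≤ |u|^{4(p-1)} + |∂ᵢu|⁴; only the second term sees ‖a‖.
    have hsq : ‖nonlinGrad p i a‖ ^ 2 ≤ p ^ 2 * (A₂ + C₃ * M ^ 2 * (1 + ‖a‖) ^ 2) := by
      have e : ∀ᵐ x, nonlinGrad p i a x ^ 2 ≤
          p ^ 2 * (|bessel (bessel a) x| ^ (4 * (p - 1)) + |d x| ^ (4 : ℝ)) := by
        filter_upwards [coeFn_powDerivL2 hp (hsup a) d] with x hx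
        have hx' : nonlinGrad p i a x =
          p * (|bessel (bessel a) x| ^ (p - 2) * bessel (bessel a) x) * d x := hx
        rw [hx', ← sq_abs, abs_mul, abs_mul, abs_rpow_mul_self (by linarith),
          abs_of_pos (by linarith : 0 < p), show p - 2 + 1 = p - 1 by ring]
        have e1 : |bessel (bessel a) x| ^ (4 * (p - 1)) =
            ((|bessel (bessel a) x| ^ (p - 1)) ^ 2) ^ 2 := by
          rw [← pow_mul, ← Real.rpow_natCast, ← Real.rpow_mul (abs_nonneg _)]
          congr 1; push_cast; ring
        have e2 : |d x| ^ (4 : ℝ) = (|d x| ^ 2) ^ 2 := by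
          rw [← pow_mul]; exact_mod_cast Real.rpow_natCast |d x| 4
        rw [e1, e2]
        set y := |bessel (bessel a) x| ^ (p - 1)
        rw [show (p * y * |d x|) ^ 2 = p ^ 2 * (y ^ 2 * |d x| ^ 2) by ring]
        refine mul_le_mul_of_nonneg_left ?_ (by positivity)
        nlinarith [sq_nonneg (y ^ 2 - |d x| ^ 2), sq_nonneg (y ^ 2), sq_nonneg (|d x| ^ 2)]
      have hI : Integrable (fun x => p ^ 2 * (|bessel (bessel a) x| ^ (4 * (p - 1))
          + |d x| ^ (4 : ℝ))) := Integrable.const_mul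
        (f := fun x => |bessel (bessel a) x| ^ (4 * (p - 1)) + |d x| ^ (4 : ℝ)) (i₂.add i₃) _
      rw [norm_sq_L2]
      refine (integral_mono_of_nonneg (f := fun x => nonlinGrad p i a x ^ 2)
        (Eventually.of_forall fun x => sq_nonneg _) hI e).trans ?_
      rw [integral_const_mul, integral_add i₂ i₃]
      refine mul_le_mul_of_nonneg_left (add_le_add (j₂.trans ?_) (j₃.trans ?_)) (by positivity)
      · rw [hA₂]
        gcongr
      · rw [show (4 : ℝ) - 2 = ((2 : ℕ) : ℝ) by norm_num, Real.rpow_natCast, mul_assoc]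
        gcongr
    have p0 : 0 < p := by linarith
    refine (pow_le_pow_iff_left₀ (n := 2) (norm_nonneg _) ?_ two_ne_zero).mp ?_
    · positivity
    refine hsq.trans ?_
    rw [mul_pow, mul_pow, mul_assoc (p ^ 2)]
    refine mul_le_mul_of_nonneg_left ?_ (by positivity)
    exact add_mul_le_sq_mul A₂0 (by positivity) (by nlinarith [norm_nonneg a])
  refine (norm_halfInv_le _ _).trans ?_
  rw [Fin.sum_univ_two]
  have := b2 0
  have := b2 1
  nlinarith [norm_nonneg a]

end DampedWave

namespace DampedWave

open Filter Topology

/-! ### A continuation principle for ordinary differential equations -/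

/-- Continuous induction: a continuous function which cannot exceed the level `M` as long as it has
not done so before stays below it. -/
theorem le_of_continuous_induction {T M : ℝ} {g : ℝ → ℝ} (hg : ContinuousOn g (Icc 1 T))
    (h : ∀ t ∈ Icc 1 T, (∀ s ∈ Ico 1 t, g s ≤ M) → g t < M) : ∀ t ∈ Icc 1 T, g t < M := by
  have hclosed : ∀ t ∈ Icc 1 T, ∀ s ∈ Ico 1 t, g s ≤ M := by
    intro t ht
    by_contra hcon
    push Not at hcon
    obtain ⟨s, hs, hsM⟩ := hcon
    have hsT : s ∈ Icc 1 T := ⟨hs.1, hs.2.le.trans ht.2⟩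
    -- The infimum of A is the first time at which the level M is reached; before it the hypothesis
    -- applies and contradicts this.
    let A : Set ℝ := {r ∈ Icc 1 s | M ≤ g r}
    have hA : IsClosed A := by
      have : ContinuousOn g (Icc 1 s) := hg.mono (Icc_subset_Icc_right hsT.2)
      exact this.preimage_isClosed_of_isClosed isClosed_Icc isClosed_Ici
    have hne : A.Nonempty := ⟨s, ⟨hs.1, le_rfl⟩, hsM.le⟩
    have hbdd : BddBelow A := ⟨1, fun r hr => hr.1.1⟩
    have hmem := hA.csInf_mem hne hbdd
    set r := sInf A with hr
    have hrT : r ∈ Icc 1 T := ⟨hmem.1.1, hmem.1.2.trans hsT.2⟩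
    have := h r hrT fun q hq => by
      by_contra hq2
      push Not at hq2
      have : q ∈ A := ⟨⟨hq.1, hq.2.le.trans hmem.1.2⟩, hq2.le⟩
      exact absurd (csInf_le hbdd this) (not_le.mpr hq.2)
    exact absurd hmem.2 (not_le.mpr this)
  exact fun t ht => h t ht (hclosed t ht)

section

variable {E : Type*} [NormedAddCommGroup E] [NormedSpace ℝ E]

/-- The radial retraction onto the ball of radius `M`. -/
def retract (M : ℝ) (x : E) : E := (M / max M ‖x‖) • x

theorem retract_of_norm_le {M : ℝ} (hM : 0 < M) {x : E} (hx : ‖x‖ ≤ M) : retract M x = x := by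
  rw [retract, max_eq_left hx, div_self hM.ne', one_smul]

theorem norm_retract_le {M : ℝ} (hM : 0 < M) (x : E) : ‖retract M x‖ ≤ M := by
  have h : 0 < max M ‖x‖ := lt_max_of_lt_left hM
  rw [retract, norm_smul, Real.norm_of_nonneg (by positivity), div_mul_eq_mul_div,
    div_le_iff₀ h]
  exact mul_le_mul_of_nonneg_left (le_max_right _ _) hM.le

/-- One copy of ‖x - y‖ comes from the difference of the points and one from the difference of the
scaling factors. -/
theorem norm_retract_sub_le {M : ℝ} (hM : 0 < M) (x y : E) :
    ‖retract M x - retract M y‖ ≤ 2 * ‖x - y‖ := by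
  have hx : 0 < max M ‖x‖ := lt_max_of_lt_left hM
  have hy : 0 < max M ‖y‖ := lt_max_of_lt_left hM
  have e : retract M x - retract M y =
      (M / max M ‖x‖) • (x - y) + (M / max M ‖x‖ - M / max M ‖y‖) • y := by
    simp only [retract, smul_sub, sub_smul]; abel
  have h1 : M / max M ‖x‖ ≤ 1 := (div_le_one hx).mpr (le_max_left _ _)
  have h2 : |M / max M ‖x‖ - M / max M ‖y‖| * ‖y‖ ≤ ‖x - y‖ := by
    have e2 : M / max M ‖x‖ - M / max M ‖y‖ =
        (M / max M ‖x‖) * ((max M ‖y‖ - max M ‖x‖) / max M ‖y‖) := by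
      field_simp
    rw [e2, abs_mul, abs_of_pos (div_pos hM hx), abs_div, abs_of_pos hy]
    have h3 : |max M ‖y‖ - max M ‖x‖| ≤ ‖x - y‖ := by
      refine (abs_max_sub_max_le_max M ‖y‖ M ‖x‖).trans ?_
      rw [sub_self, abs_zero, max_eq_right (abs_nonneg _), abs_sub_comm]
      exact abs_norm_sub_norm_le x y
    have h4 : |max M ‖y‖ - max M ‖x‖| / max M ‖y‖ * ‖y‖ ≤ ‖x - y‖ := by
      rw [div_mul_eq_mul_div, div_le_iff₀ hy]
      exact mul_le_mul h3 (le_max_right _ _) (norm_nonneg _) (norm_nonneg _)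
    rw [mul_assoc]
    exact (mul_le_of_le_one_left (by positivity) h1).trans h4
  rw [e]
  refine (norm_add_le _ _).trans ?_
  rw [norm_smul, norm_smul, Real.norm_eq_abs, Real.norm_eq_abs, abs_of_pos (div_pos hM hx)]
  linarith [mul_le_of_le_one_left (norm_nonneg (x - y)) h1]

/-- An ordinary differential equation with locally Lipschitz right-hand side has a solution on
`[1, T]` if its solutions satisfy an a priori bound. -/
theorem exists_ode_of_apriori [CompleteSpace E] {Φ : ℝ → E → E} {w₀ : E} {T M : ℝ} (hT : 1 ≤ T)
    (lip : ∀ ρ : ℝ, 0 ≤ ρ → ∃ K : ℝ, 0 ≤ K ∧ ∀ t ∈ Icc 1 T, ∀ x y : E, ‖x‖ ≤ ρ → ‖y‖ ≤ ρ →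
      ‖Φ t x - Φ t y‖ ≤ K * ‖x - y‖)
    (cont : ∀ x, ContinuousOn (fun t => Φ t x) (Icc 1 T))
    (apriori : ∀ T' ∈ Icc 1 T, ∀ w : ℝ → E, w 1 = w₀ →
      (∀ t ∈ Icc 1 T', HasDerivWithinAt w (Φ t (w t)) (Icc 1 T') t) → ‖w T'‖ ≤ M) :
    ∃ w : ℝ → E, w 1 = w₀ ∧ ∀ t ∈ Icc 1 T, HasDerivWithinAt w (Φ t (w t)) (Icc 1 T) t := by
  set R := |M| + 1 with hR
  have R0 : 0 < R := by positivity
  obtain ⟨K, hK, hlip⟩ := lip R R0.le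
  obtain ⟨A, hA⟩ := isCompact_Icc.exists_bound_of_continuousOn (cont 0)
  have hbound : ∀ t ∈ Icc 1 T, ∀ x, ‖Φ t (retract R x)‖ ≤ K * R + |A| := by
    intro t ht x
    have h1 := hlip t ht (retract R x) 0 (norm_retract_le R0 x) (by simpa using R0.le)
    have h2 := norm_sub_norm_le (Φ t (retract R x)) (Φ t 0)
    have h3 := hA t ht
    have h4 : K * ‖retract R x - 0‖ ≤ K * R := by
      rw [sub_zero]; exact mul_le_mul_of_nonneg_left (norm_retract_le R0 x) hK
    linarith [le_abs_self A]
  have L0 : 0 ≤ K * R + |A| := by positivity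
  have hT0 : 0 ≤ T - 1 := by linarith
  -- Composed with the retraction, the right-hand side is bounded and globally Lipschitz, so
  -- Picard-Lindelöf reaches the whole interval in a ball of radius bound times length.
  have hPL : IsPicardLindelof (fun t x => Φ t (retract R x)) (⟨1, le_rfl, hT⟩ : Icc 1 T) w₀
      ((K * R + |A|) * (T - 1)).toNNReal 0 (K * R + |A|).toNNReal (K * 2).toNNReal := by
    refine ⟨fun t ht => LipschitzOnWith.of_dist_le_mul fun x _ y _ => ?_, fun x _ => cont _,
      fun t ht x _ => ?_, ?_⟩
    · rw [dist_eq_norm, dist_eq_norm, Real.coe_toNNReal _ (by positivity)]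
      refine (hlip t ht _ _ (norm_retract_le R0 x) (norm_retract_le R0 y)).trans ?_
      rw [mul_assoc]
      exact mul_le_mul_of_nonneg_left (norm_retract_sub_le R0 x y) hK
    · rw [Real.coe_toNNReal _ L0]; exact hbound t ht x
    · rw [Real.coe_toNNReal _ L0, Real.coe_toNNReal _ (by positivity)]
      simp [max_eq_left hT0]
  obtain ⟨w, hw1, hw⟩ := hPL.exists_eq_forall_mem_Icc_hasDerivWithinAt₀
  have hwc : ContinuousOn w (Icc 1 T) := fun t ht => (hw t ht).continuousWithinAt
  -- As long as w stays in the ball of radius R it solves the original equation, hence is bounded by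
  -- M < R: the truncation is never felt.
  have hlt : ∀ t ∈ Icc 1 T, ‖w t‖ < R := by
    refine le_of_continuous_induction hwc.norm fun t ht hs => ?_
    have hcl : ∀ s ∈ Icc 1 t, ‖w s‖ ≤ R ∨ s = t := fun s hs' => by
      rcases hs'.2.lt_or_eq with h | h
      · exact Or.inl (hs s ⟨hs'.1, h⟩)
      · exact Or.inr h
    -- The bound before time t extends to t by continuity. At t = 1 nothing precedes, but there the
    -- interval is a point and every derivative is admissible.
    have hwt : ‖w t‖ ≤ R ∨ t = 1 := by
      rcases ht.1.eq_or_lt with h | h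
      · exact Or.inr h.symm
      · left
        have hc : ContinuousWithinAt (fun s => ‖w s‖) (Ico 1 t) t :=
          (hwc.norm t ht).mono (Ico_subset_Icc_self.trans (Icc_subset_Icc_right ht.2))
        have : (𝓝[Ico 1 t] t).NeBot := by
          rw [← mem_closure_iff_nhdsWithin_neBot, closure_Ico h.ne]
          exact right_mem_Icc.mpr h.le
        exact le_of_tendsto hc (eventually_nhdsWithin_of_forall fun s hs' => hs s hs')
    have hres : ‖w t‖ ≤ M := by
      refine apriori t ht w hw1 fun s hs' => ?_
      have hd := (hw s ⟨hs'.1, hs'.2.trans ht.2⟩).mono (Icc_subset_Icc_right ht.2)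
      rcases hwt with h | h
      · have hsR : ‖w s‖ ≤ R := by
          rcases hcl s hs' with h' | h'
          · exact h'
          · rw [h']; exact h
        beta_reduce at hd
        rwa [retract_of_norm_le R0 hsR] at hd
      · subst h
        have hs1 : s = 1 := le_antisymm hs'.2 hs'.1
        subst hs1
        rw [Icc_self]
        exact HasFDerivWithinAt.of_subsingleton subsingleton_singleton
    exact hres.trans_lt (by rw [hR]; linarith [le_abs_self M])
  refine ⟨w, hw1, fun t ht => ?_⟩
  have := hw t ht
  beta_reduce at this
  rwa [retract_of_norm_le R0 (hlt t ht).le] at this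

end

end DampedWave

namespace DampedWave

open Filter Topology
open scoped BoundedContinuousFunction NNReal

/-! ### The Klein-Gordon group -/

theorem denseRange_bessel : DenseRange bessel := fun f => by
  obtain ⟨φ, h, hφ⟩ := exists_seq_test_bessel f
  exact mem_closure_of_tendsto hφ (Eventually.of_forall fun n => ⟨_, rfl⟩)

/-- The symbol `cos (t⟨ξ⟩)`. -/
def cosSymbol (t : ℝ) : Plane →ᵇ ℝ :=
  BoundedContinuousFunction.ofNormedAddCommGroup (fun ξ => Real.cos (t * weight ξ))
    (Real.continuous_cos.comp (continuous_const.mul continuous_weight)) 1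
    (fun _ => Real.abs_cos_le_one _)

/-- The symbol `sin (t⟨ξ⟩)`. -/
def sinSymbol (t : ℝ) : Plane →ᵇ ℝ :=
  BoundedContinuousFunction.ofNormedAddCommGroup (fun ξ => Real.sin (t * weight ξ))
    (Real.continuous_sin.comp (continuous_const.mul continuous_weight)) 1
    (fun _ => Real.abs_sin_le_one _)

theorem cosSymbol_apply (t : ℝ) (ξ : Plane) : cosSymbol t ξ = Real.cos (t * weight ξ) := rfl

theorem sinSymbol_apply (t : ℝ) (ξ : Plane) : sinSymbol t ξ = Real.sin (t * weight ξ) := rfl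

theorem cosSymbol_neg (t : ℝ) : cosSymbol (-t) = cosSymbol t := by
  ext ξ; rw [cosSymbol_apply, cosSymbol_apply, neg_mul, Real.cos_neg]

theorem sinSymbol_neg (t : ℝ) : sinSymbol (-t) = -sinSymbol t := by
  ext ξ
  rw [BoundedContinuousFunction.coe_neg, Pi.neg_apply, sinSymbol_apply, sinSymbol_apply, neg_mul,
    Real.sin_neg]

theorem cosSymbol_mul_add_sinSymbol_mul (t : ℝ) :
    cosSymbol t * cosSymbol t + sinSymbol t * sinSymbol t = 1 := by
  ext ξ
  simp only [BoundedContinuousFunction.coe_add, BoundedContinuousFunction.coe_mul, Pi.add_apply,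
    Pi.mul_apply, cosSymbol_apply, sinSymbol_apply, BoundedContinuousFunction.coe_one, Pi.one_apply]
  linarith [Real.cos_sq_add_sin_sq (t * weight ξ), sq (Real.cos (t * weight ξ)),
    sq (Real.sin (t * weight ξ))]

theorem abs_cos_sub_le (x y : ℝ) : |Real.cos x - Real.cos y| ≤ |x - y| := by
  have h := Convex.norm_image_sub_le_of_norm_hasDerivWithin_le (f := Real.cos)
    (f' := fun x => -Real.sin x) (C := 1) (s := univ) (x := y) (y := x)
    (fun x _ => (Real.hasDerivAt_cos x).hasDerivWithinAt)
    (fun x _ => by rw [norm_neg]; exact Real.abs_sin_le_one x) convex_univ trivial trivial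
  simpa using h

theorem abs_sin_sub_le (x y : ℝ) : |Real.sin x - Real.sin y| ≤ |x - y| := by
  have h := Convex.norm_image_sub_le_of_norm_hasDerivWithin_le (f := Real.sin)
    (f' := fun x => Real.cos x) (C := 1) (s := univ) (x := y) (y := x)
    (fun x _ => (Real.hasDerivAt_sin x).hasDerivWithinAt)
    (fun x _ => Real.abs_cos_le_one x) convex_univ trivial trivial
  simpa using h

/-- Mean value inequality for g minus its linear part at y, whose derivative is at most |x - y|
between y and x. -/
theorem abs_sub_sub_le_sq {g g' : ℝ → ℝ} (hg : ∀ x, HasDerivAt g (g' x) x)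
    (hg' : ∀ x y, |g' x - g' y| ≤ |x - y|) (x y : ℝ) :
    |g x - g y - (x - y) * g' y| ≤ (x - y) ^ 2 := by
  have h := Convex.norm_image_sub_le_of_norm_hasDerivWithin_le
    (f := fun z => g z - z * g' y) (f' := fun z => g' z - g' y) (C := |x - y|) (s := uIcc y x)
    (x := y) (y := x)
    (fun z _ => by
      have := ((hg z).sub ((hasDerivAt_id z).mul_const (g' y))).hasDerivWithinAt (s := uIcc y x)
      rw [one_mul] at this
      exact this)
    (fun z hz => by
      refine (hg' z y).trans ?_
      exact abs_sub_left_of_mem_uIcc hz)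
    (convex_uIcc _ _) left_mem_uIcc right_mem_uIcc
  rw [Real.norm_eq_abs, Real.norm_eq_abs, abs_mul_abs_self] at h
  calc _ = |g x - x * g' y - (g y - y * g' y)| := by congr 1; ring
    _ ≤ _ := h
    _ = _ := by ring

theorem abs_cos_taylor (x y : ℝ) :
    |Real.cos x - Real.cos y - (x - y) * -Real.sin y| ≤ (x - y) ^ 2 :=
  abs_sub_sub_le_sq (fun x => Real.hasDerivAt_cos x)
    (fun x y => by rw [neg_sub_neg, abs_sub_comm]; exact abs_sin_sub_le x y) x y

theorem abs_sin_taylor (x y : ℝ) :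
    |Real.sin x - Real.sin y - (x - y) * Real.cos y| ≤ (x - y) ^ 2 :=
  abs_sub_sub_le_sq (fun x => Real.hasDerivAt_sin x) abs_cos_sub_le x y

theorem mult_sub (m n : Plane →ᵇ ℝ) (f : L2) : mult (m - n) f = mult m f - mult n f := by
  have := mult_add (m - n) n f
  rw [sub_add_cancel] at this
  rw [this, add_sub_cancel_right]

theorem mult_neg (m : Plane →ᵇ ℝ) (f : L2) : mult (-m) f = -mult m f := by
  have e : (-1 : ℝ) • m = -m := by ext ξ; simp
  rw [← e, mult_smul, neg_one_smul]

/-- Multipliers depending on time whose symbols grow at most like `⟨ξ⟩` per unit of time are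
strongly continuous. -/
theorem continuous_mult_family {m : ℝ → Plane →ᵇ ℝ} (h1 : ∀ t ξ, |m t ξ| ≤ 1)
    (h2 : ∀ s t ξ, |m s ξ - m t ξ| ≤ |s - t| * weight ξ) :
    Continuous fun q : L2 × ℝ => mult (m q.2) q.1 := by
  -- On the dense range of ⟨D⟩⁻¹ the growth ⟨ξ⟩ is absorbed and the family is Lipschitz in time; the
  -- uniform contraction bound covers the remaining functions.
  refine continuous_prod_of_dense_continuous_lipschitzWith (fun q : L2 × ℝ => mult (m q.2) q.1) 1
    denseRange_bessel ?_ ?_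
  · rintro _ ⟨f, rfl⟩
    have : LipschitzWith ‖f‖₊ fun t => mult (m t) (bessel f) := by
      refine LipschitzWith.of_dist_le_mul fun s t => ?_
      rw [dist_eq_norm, dist_eq_norm, ← mult_sub, ← mult_mul, Real.norm_eq_abs, coe_nnnorm,
        mul_comm ‖f‖]
      refine norm_mult_le _ _ fun ξ => ?_
      rw [BoundedContinuousFunction.coe_mul, Pi.mul_apply, BoundedContinuousFunction.coe_sub,
        Pi.sub_apply, abs_mul, besselSymbol_apply, abs_inv, abs_of_pos (weight_pos ξ),
        ← div_eq_mul_inv, div_le_iff₀ (weight_pos ξ)]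
      exact h2 s t ξ
    exact this.continuous
  · intro t
    refine LipschitzWith.of_dist_le_mul fun f g => ?_
    rw [dist_eq_norm, dist_eq_norm, ← mult_sub_right]
    exact norm_mult_le _ _ (h1 t)

/-- Multipliers whose symbols are differentiable in time up to an error `⟨ξ⟩²`. -/
theorem hasDerivAt_mult_family {m : ℝ → Plane →ᵇ ℝ} {n : Plane →ᵇ ℝ} {t : ℝ}
    (h : ∀ s ξ, |m s ξ - m t ξ - (s - t) * (n ξ * weight ξ)| ≤ ((s - t) * weight ξ) ^ 2) :
    HasDerivAt (fun s => multL (m s * (besselSymbol * besselSymbol)))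
      (multL (n * besselSymbol)) t := by
  rw [hasDerivAt_iff_isLittleO]
  -- The two Bessel factors absorb the error ⟨ξ⟩², so the derivative exists even in operator norm,
  -- with remainder (s - t)².
  refine Asymptotics.IsBigO.trans_isLittleO (g := fun s => (s - t) ^ 2) ?_ ?_
  · refine Asymptotics.IsBigO.of_bound 1 (Eventually.of_forall fun s => ?_)
    rw [one_mul, Real.norm_of_nonneg (sq_nonneg _)]
    refine ContinuousLinearMap.opNorm_le_bound _ (sq_nonneg _) fun f => ?_
    have e : (multL (m s * (besselSymbol * besselSymbol)) - multL (m t * (besselSymbol *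
        besselSymbol)) - (s - t) • multL (n * besselSymbol)) f =
        mult (m s * (besselSymbol * besselSymbol) - m t * (besselSymbol * besselSymbol) -
          (s - t) • (n * besselSymbol)) f := by
      rw [mult_sub, mult_sub, mult_smul]; rfl
    rw [e]
    refine norm_mult_le _ _ fun ξ => ?_
    simp only [BoundedContinuousFunction.coe_sub, BoundedContinuousFunction.coe_mul,
      BoundedContinuousFunction.coe_smul, Pi.sub_apply, Pi.mul_apply, besselSymbol_apply,
      smul_eq_mul]
    have hw := weight_pos ξ
    have e2 : m s ξ * ((weight ξ)⁻¹ * (weight ξ)⁻¹) - m t ξ * ((weight ξ)⁻¹ * (weight ξ)⁻¹) -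
        (s - t) * (n ξ * (weight ξ)⁻¹) =
        (m s ξ - m t ξ - (s - t) * (n ξ * weight ξ)) / weight ξ ^ 2 := by
      field_simp
    rw [e2, abs_div, abs_of_pos (pow_pos hw 2), div_le_iff₀ (pow_pos hw 2), ← mul_pow]
    exact h s ξ
  · have h0 : (fun s : ℝ => (s - t) ^ 2) = fun s => (s - t) * (s - t) := by ext; ring
    rw [h0]
    have h1 : (fun s : ℝ => s - t) =o[𝓝 t] fun _ => (1 : ℝ) := by
      rw [Asymptotics.isLittleO_one_iff]
      have : Tendsto (fun s : ℝ => s - t) (𝓝 t) (𝓝 (t - t)) := tendsto_id.sub_const t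
      rwa [sub_self] at this
    simpa using h1.mul_isBigO (Asymptotics.isBigO_refl (fun s : ℝ => s - t) (𝓝 t))

theorem hasDerivAt_cosSymbol (t : ℝ) :
    HasDerivAt (fun s => multL (cosSymbol s * (besselSymbol * besselSymbol)))
      (multL (-sinSymbol t * besselSymbol)) t := by
  refine hasDerivAt_mult_family fun s ξ => ?_
  have := abs_cos_taylor (s * weight ξ) (t * weight ξ)
  rw [← sub_mul] at this
  refine le_of_eq_of_le ?_ this
  rw [BoundedContinuousFunction.coe_neg, Pi.neg_apply, cosSymbol_apply, cosSymbol_apply,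
    sinSymbol_apply]
  congr 1; ring

theorem hasDerivAt_sinSymbol (t : ℝ) :
    HasDerivAt (fun s => multL (sinSymbol s * (besselSymbol * besselSymbol)))
      (multL (cosSymbol t * besselSymbol)) t := by
  refine hasDerivAt_mult_family fun s ξ => ?_
  have := abs_sin_taylor (s * weight ξ) (t * weight ξ)
  rw [← sub_mul] at this
  refine le_of_eq_of_le ?_ this
  rw [cosSymbol_apply, sinSymbol_apply, sinSymbol_apply]
  congr 1; ring

theorem continuous_mult_cosSymbol : Continuous fun q : L2 × ℝ => mult (cosSymbol q.2) q.1 :=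
  continuous_mult_family (fun _ _ => Real.abs_cos_le_one _) fun s t ξ => by
    refine (abs_cos_sub_le _ _).trans_eq ?_
    rw [← sub_mul, abs_mul, abs_of_pos (weight_pos ξ)]

theorem continuous_mult_sinSymbol : Continuous fun q : L2 × ℝ => mult (sinSymbol q.2) q.1 :=
  continuous_mult_family (fun _ _ => Real.abs_sin_le_one _) fun s t ξ => by
    refine (abs_sin_sub_le _ _).trans_eq ?_
    rw [← sub_mul, abs_mul, abs_of_pos (weight_pos ξ)]

/-- The unitary group generated by `(a, b) ↦ (⟨D⟩ b, -⟨D⟩ a)`. -/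
def waveGroup (t : ℝ) (z : L2 × L2) : L2 × L2 :=
  (mult (cosSymbol t) z.1 + mult (sinSymbol t) z.2,
    mult (cosSymbol t) z.2 - mult (sinSymbol t) z.1)

theorem waveGroup_neg_right (t : ℝ) (z : L2 × L2) : waveGroup t (waveGroup (-t) z) = z := by
  have h : ∀ f : L2, mult (cosSymbol t) (mult (cosSymbol t) f) +
      mult (sinSymbol t) (mult (sinSymbol t) f) = f := fun f => by
    rw [← mult_mul, ← mult_mul, ← mult_add, cosSymbol_mul_add_sinSymbol_mul, mult_one]
  obtain ⟨a, b⟩ := z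
  simp only [waveGroup, cosSymbol_neg, sinSymbol_neg, mult_neg, mult_add_right, mult_sub_right,
    mult_neg_right]
  refine Prod.ext ?_ ?_
  · simp only
    conv_rhs => rw [← h a]
    rw [mult_comm (sinSymbol t) (cosSymbol t)]; abel
  · simp only
    conv_rhs => rw [← h b]
    rw [mult_comm (sinSymbol t) (cosSymbol t)]; abel

theorem waveGroup_sub (t : ℝ) (z y : L2 × L2) :
    waveGroup t (z - y) = waveGroup t z - waveGroup t y := by
  simp only [waveGroup, Prod.fst_sub, Prod.snd_sub, mult_sub_right, Prod.mk_sub_mk]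
  refine Prod.ext ?_ ?_ <;> simp only <;> abel

/-- The factor 2 is due to the maximum norm carried by the product. -/
theorem norm_waveGroup_le (t : ℝ) (z : L2 × L2) : ‖waveGroup t z‖ ≤ 2 * ‖z‖ := by
  have hc : ∀ f, ‖mult (cosSymbol t) f‖ ≤ ‖f‖ := fun f =>
    (norm_mult_le _ _ fun _ => Real.abs_cos_le_one _).trans_eq (one_mul _)
  have hs : ∀ f, ‖mult (sinSymbol t) f‖ ≤ ‖f‖ := fun f =>
    (norm_mult_le _ _ fun _ => Real.abs_sin_le_one _).trans_eq (one_mul _)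
  have h1 := norm_fst_le z
  have h2 := norm_snd_le z
  rw [Prod.norm_def]
  refine max_le ?_ ?_
  · refine (norm_add_le _ _).trans ?_
    linarith [hc z.1, hs z.2]
  · refine (norm_sub_le _ _).trans ?_
    linarith [hc z.2, hs z.1]

theorem continuous_mult_cosSymbol_comp {X : Type*} [TopologicalSpace X] {f : X → L2} {g : X → ℝ}
    (hf : Continuous f) (hg : Continuous g) : Continuous fun x => mult (cosSymbol (g x)) (f x) := by
  simpa only [Function.comp_def] using continuous_mult_cosSymbol.comp (hf.prodMk hg)

theorem continuous_mult_sinSymbol_comp {X : Type*} [TopologicalSpace X] {f : X → L2} {g : X → ℝ}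
    (hf : Continuous f) (hg : Continuous g) : Continuous fun x => mult (sinSymbol (g x)) (f x) := by
  simpa only [Function.comp_def] using continuous_mult_sinSymbol.comp (hf.prodMk hg)

theorem continuous_waveGroup_comp {X : Type*} [TopologicalSpace X] {z : X → L2 × L2} {g : X → ℝ}
    (hz : Continuous z) (hg : Continuous g) : Continuous fun x => waveGroup (g x) (z x) := by
  have h1 : Continuous fun x => (z x).1 := continuous_fst.comp hz
  have h2 : Continuous fun x => (z x).2 := continuous_snd.comp hz
  exact ((continuous_mult_cosSymbol_comp h1 hg).add (continuous_mult_sinSymbol_comp h2 hg)).prodMk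
    ((continuous_mult_cosSymbol_comp h2 hg).sub (continuous_mult_sinSymbol_comp h1 hg))

theorem hasDerivWithinAt_bessel_bessel_mult {m : ℝ → Plane →ᵇ ℝ} {n : Plane →ᵇ ℝ} {s : Set ℝ}
    {t : ℝ} (hm : HasDerivAt (fun s => multL (m s * (besselSymbol * besselSymbol)))
      (multL (n * besselSymbol)) t) {f : ℝ → L2} {g : L2} (hf : HasDerivWithinAt f g s t) :
    HasDerivWithinAt (fun r => bessel (bessel (mult (m r) (f r))))
      (bessel (mult n (f t)) + bessel (bessel (mult (m t) g))) s t := by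
  have e : ∀ (m : Plane →ᵇ ℝ) (f : L2), mult (m * (besselSymbol * besselSymbol)) f =
      bessel (bessel (mult m f)) := fun m f => by
    rw [mul_comm, mult_mul, mult_mul]
  have e' : ∀ (m : Plane →ᵇ ℝ) (f : L2), mult (m * besselSymbol) f = bessel (mult m f) :=
    fun m f => by rw [mul_comm, mult_mul]
  have := hm.hasDerivWithinAt (s := s) |>.clm_apply hf
  simp only [multL_apply, e, e'] at this
  exact this

/-- Variation of constants: if `w' = U(-t) (g, h)`, then `(a, b) = U(t) w` solves
`a' = ⟨D⟩ b + g`, `b' = -⟨D⟩ a + h`, expressed after application of `⟨D⟩⁻²`. -/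
theorem hasDerivWithinAt_waveGroup {w : ℝ → L2 × L2} {h : L2 × L2} {s : Set ℝ} {t : ℝ}
    (hw : HasDerivWithinAt w (waveGroup (-t) h) s t) :
    HasDerivWithinAt (fun r => bessel (bessel (waveGroup r (w r)).1))
      (bessel (waveGroup t (w t)).2 + bessel (bessel h.1)) s t ∧
    HasDerivWithinAt (fun r => bessel (bessel (waveGroup r (w r)).2))
      (-bessel (waveGroup t (w t)).1 + bessel (bessel h.2)) s t := by
  have hk := waveGroup_neg_right t h
  set k := waveGroup (-t) h
  have hw1 : HasDerivWithinAt (fun r => (w r).1) k.1 s t := hw.fst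
  have hw2 : HasDerivWithinAt (fun r => (w r).2) k.2 s t := hw.snd
  have dc1 := hasDerivWithinAt_bessel_bessel_mult (hasDerivAt_cosSymbol t) hw1
  have dc2 := hasDerivWithinAt_bessel_bessel_mult (hasDerivAt_cosSymbol t) hw2
  have ds1 := hasDerivWithinAt_bessel_bessel_mult (hasDerivAt_sinSymbol t) hw1
  have ds2 := hasDerivWithinAt_bessel_bessel_mult (hasDerivAt_sinSymbol t) hw2
  rw [← hk]
  simp only [waveGroup, mult_add_right, mult_sub_right, mult_neg] at *
  constructor
  · refine (dc1.add ds2).congr_deriv ?_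
    simp only [mult_neg_right]
    abel
  · refine (dc2.sub ds1).congr_deriv ?_
    simp only [mult_neg_right]
    abel

/-- A curve whose smoothing `⟨D⟩⁻¹ y` is differentiable with derivative `⟨D⟩⁻¹ g`, `g` continuous,
is itself differentiable. -/
theorem hasDerivWithinAt_of_bessel {y g : ℝ → L2} {T : ℝ}
    (hy : ContinuousOn y (Icc 1 T)) (hg : ContinuousOn g (Icc 1 T))
    (h : ∀ t ∈ Icc 1 T, HasDerivWithinAt (fun s => bessel (y s)) (bessel (g t)) (Icc 1 T) t) :
    ∀ t ∈ Icc 1 T, HasDerivWithinAt y (g t) (Icc 1 T) t := by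
  intro t ht
  have hT : 1 ≤ T := ht.1.trans ht.2
  have hint : ∀ r ∈ Icc 1 T, IntervalIntegrable g volume 1 r := fun r hr =>
    (hg.mono (by rw [uIcc_of_le hr.1]; exact Icc_subset_Icc_right hr.2)).intervalIntegrable
  -- The integral formula holds after ⟨D⟩⁻¹ by the fundamental theorem of calculus, and ⟨D⟩⁻¹ is
  -- injective.
  have key : ∀ r ∈ Icc 1 T, y r = y 1 + ∫ s in (1 : ℝ)..r, g s := by
    intro r hr
    refine bessel_injective ?_
    have h1 : bessel (y 1 + ∫ s in (1 : ℝ)..r, g s) =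
        bessel (y 1) + ∫ s in (1 : ℝ)..r, bessel (g s) := by
      rw [show bessel (y 1 + ∫ s in (1 : ℝ)..r, g s) =
        bessel (y 1) + bessel (∫ s in (1 : ℝ)..r, g s)
        from mult_add_right _ _ _]
      congr 1
      exact ((multL besselSymbol).intervalIntegral_comp_comm (hint r hr)).symm
    rw [h1]
    have h2 := intervalIntegral.integral_eq_sub_of_hasDeriv_right_of_le (f := fun s => bessel (y s))
      (f' := fun s => bessel (g s)) hr.1
      ((multL besselSymbol).continuous.comp_continuousOn
        (hy.mono (Icc_subset_Icc_right hr.2)))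
      (fun s hs => ?_)
      ((((multL besselSymbol).continuous.comp_continuousOn hg).mono
        (by rw [uIcc_of_le hr.1]; exact Icc_subset_Icc_right hr.2)).intervalIntegrable)
    · rw [h2]; abel
    · have hsT : s < T := hs.2.trans_le hr.2
      exact ((h s ⟨hs.1.le, hsT.le⟩).mono_of_mem_nhdsWithin
        (mem_of_superset (Ioo_mem_nhdsGT hsT) fun q hq => ⟨hs.1.le.trans hq.1.le, hq.2.le⟩))
  have hd : HasDerivWithinAt (fun r => ∫ s in (1 : ℝ)..r, g s) (g t) (Icc 1 T) t := by
    have : Fact (t ∈ Icc 1 T) := ⟨ht⟩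
    refine intervalIntegral.integral_hasDerivWithinAt_right (hint t ht) ?_ (hg t ht)
    exact ⟨Icc 1 T, self_mem_nhdsWithin, hg.aestronglyMeasurable measurableSet_Icc⟩
  exact (hd.const_add (y 1)).congr key (key t ht)

end DampedWave

namespace DampedWave

open Filter Topology

/-! ### Strong solutions -/

/-- `(a, b)` represents the `H² × H¹` solution `u = ⟨D⟩⁻² a`, `∂ₜ u = ⟨D⟩⁻¹ b` of the damped wave
equation on `[1, T]`. -/
structure IsStrong (μ p T : ℝ) (a b : ℝ → L2) : Prop where
  cont_fst : ContinuousOn a (Icc 1 T)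
  cont_snd : ContinuousOn b (Icc 1 T)
  deriv_fst : ∀ t ∈ Icc 1 T, HasDerivWithinAt (fun s => bessel (a s)) (b t) (Icc 1 T) t
  deriv_snd : ∀ t ∈ Icc 1 T, HasDerivWithinAt (fun s => bessel (b s))
    (-a t + bessel (bessel (a t)) - (μ / t) • bessel (b t) + nonlin p (a t)) (Icc 1 T) t

theorem IsStrong.mono {μ p T T' : ℝ} {a b : ℝ → L2} (h : IsStrong μ p T a b) (hT : T' ≤ T) :
    IsStrong μ p T' a b :=
  have hs : Icc 1 T' ⊆ Icc 1 T := Icc_subset_Icc_right hT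
  ⟨h.cont_fst.mono hs, h.cont_snd.mono hs, fun t ht => (h.deriv_fst t (hs ht)).mono hs,
    fun t ht => (h.deriv_snd t (hs ht)).mono hs⟩

theorem continuous_bessel : Continuous bessel := (multL besselSymbol).continuous

theorem continuousOn_bessel {f : ℝ → L2} {s : Set ℝ} (h : ContinuousOn f s) :
    ContinuousOn (fun t => bessel (f t)) s := by
  simpa only [Function.comp_def] using continuous_bessel.comp_continuousOn h

/-- The lower-order terms of the first-order system. -/
def force (μ p t : ℝ) (z : L2 × L2) : L2 :=
  bessel z.1 - (μ / t) • z.2 + nonlinHalf p z.1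

/-- The right-hand side of the system in the interaction picture. -/
def interaction (μ p t : ℝ) (w : L2 × L2) : L2 × L2 :=
  waveGroup (-t) (0, force μ p t (waveGroup t w))

theorem abs_div_le_abs {μ t : ℝ} (ht : 1 ≤ t) : |μ / t| ≤ |μ| := by
  rw [abs_div, abs_of_pos (one_pos.trans_le ht)]
  exact div_le_self (abs_nonneg _) ht

theorem continuous_nonlinHalf {p : ℝ} (hp : 2 < p) : Continuous (nonlinHalf p) :=
  continuous_of_lipschitz_on_balls (exists_nonlinHalf_lipschitz hp)

theorem norm_interaction_le (μ p t : ℝ) (w : L2 × L2) :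
    ‖interaction μ p t w‖ ≤ 2 * ‖force μ p t (waveGroup t w)‖ := by
  refine (norm_waveGroup_le _ _).trans_eq ?_
  rw [Prod.norm_mk, norm_zero, max_eq_right (norm_nonneg _)]

theorem exists_interaction_lipschitz (μ : ℝ) {p : ℝ} (hp : 2 < p) (ρ : ℝ) (hρ : 0 ≤ ρ) :
    ∃ K : ℝ, 0 ≤ K ∧ ∀ t, 1 ≤ t → ∀ x y : L2 × L2, ‖x‖ ≤ ρ → ‖y‖ ≤ ρ →
      ‖interaction μ p t x - interaction μ p t y‖ ≤ K * ‖x - y‖ := by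
  obtain ⟨K, hK, h⟩ := exists_nonlinHalf_lipschitz hp (2 * ρ) (by positivity)
  refine ⟨4 * (1 + |μ| + K), by positivity, fun t ht x y hx hy => ?_⟩
  have hz : ∀ x : L2 × L2, ‖x‖ ≤ ρ → ‖(waveGroup t x).1‖ ≤ 2 * ρ := fun x hx =>
    (norm_fst_le _).trans ((norm_waveGroup_le t x).trans (by linarith))
  have h1 := h _ _ (hz x hx) (hz y hy)
  have e : interaction μ p t x - interaction μ p t y =
      waveGroup (-t) (0, force μ p t (waveGroup t x) - force μ p t (waveGroup t y)) := by
    rw [interaction, interaction, ← waveGroup_sub, Prod.mk_sub_mk, sub_zero]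
  have h2 : ‖waveGroup t x - waveGroup t y‖ ≤ 2 * ‖x - y‖ := by
    rw [← waveGroup_sub]; exact norm_waveGroup_le _ _
  rw [e]
  refine (norm_waveGroup_le _ _).trans ?_
  rw [Prod.norm_mk, norm_zero, max_eq_right (norm_nonneg _)]
  generalize waveGroup t x = z at *
  generalize waveGroup t y = z' at *
  have e2 : force μ p t z - force μ p t z' = bessel (z.1 - z'.1) - (μ / t) • (z.2 - z'.2) +
      (nonlinHalf p z.1 - nonlinHalf p z'.1) := by
    simp only [force, mult_sub_right, smul_sub]; abel
  have f1 : ‖z.1 - z'.1‖ ≤ ‖z - z'‖ := norm_fst_le (z - z')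
  have f2 : ‖z.2 - z'.2‖ ≤ ‖z - z'‖ := norm_snd_le (z - z')
  have h3 : ‖force μ p t z - force μ p t z'‖ ≤ (1 + |μ| + K) * ‖z - z'‖ := by
    rw [e2]
    refine (norm_add_le _ _).trans ?_
    have g1 := norm_sub_le (bessel (z.1 - z'.1)) ((μ / t) • (z.2 - z'.2))
    have g2 := norm_bessel_le (z.1 - z'.1)
    rw [norm_smul, Real.norm_eq_abs] at g1
    have g3 : |μ / t| * ‖z.2 - z'.2‖ ≤ |μ| * ‖z - z'‖ :=
      mul_le_mul (abs_div_le_abs ht) f2 (norm_nonneg _) (abs_nonneg _)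
    have g4 := mul_le_mul_of_nonneg_left f1 hK
    linarith
  have h4 := mul_le_mul_of_nonneg_left h2 (show 0 ≤ 1 + |μ| + K by positivity)
  linarith

theorem continuousOn_interaction (μ : ℝ) {p : ℝ} (hp : 2 < p) {w : ℝ → L2 × L2} {s : Set ℝ}
    (hw : ContinuousOn w s) (hs : ∀ t ∈ s, 1 ≤ t) :
    ContinuousOn (fun t => interaction μ p t (w t)) s := by
  rw [continuousOn_iff_continuous_domRestrict] at hw ⊢
  have c0 : Continuous fun t : s => (t : ℝ) := continuous_subtype_val
  have c1 : Continuous fun t : s => waveGroup t (w t) := continuous_waveGroup_comp hw c0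
  have c2 : Continuous fun t : s => (waveGroup t (w t)).1 := continuous_fst.comp c1
  have c3 : Continuous fun t : s => (waveGroup t (w t)).2 := continuous_snd.comp c1
  have c4 : Continuous fun t : s => force μ p t (waveGroup t (w t)) :=
    ((continuous_bessel.comp c2).sub
      ((continuous_const.div c0 fun t => (one_pos.trans_le (hs t t.2)).ne').smul c3)).add
      ((continuous_nonlinHalf hp).comp c2)
  exact continuous_waveGroup_comp (continuous_const.prodMk c4) c0.neg

/-- The two equations of the system may be checked after applying `⟨D⟩⁻¹`. -/
theorem isStrong_of_bessel {μ p T : ℝ} (hp : 2 < p) {a b : ℝ → L2}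
    (ca : ContinuousOn a (Icc 1 T)) (cb : ContinuousOn b (Icc 1 T))
    (ha : ∀ t ∈ Icc 1 T, HasDerivWithinAt (fun s => bessel (bessel (a s))) (bessel (b t))
      (Icc 1 T) t)
    (hb : ∀ t ∈ Icc 1 T, HasDerivWithinAt (fun s => bessel (bessel (b s)))
      (bessel (-a t + bessel (bessel (a t)) - (μ / t) • bessel (b t) + nonlin p (a t)))
      (Icc 1 T) t) : IsStrong μ p T a b := by
  refine ⟨ca, cb, hasDerivWithinAt_of_bessel (continuousOn_bessel ca) cb ha,
    hasDerivWithinAt_of_bessel (continuousOn_bessel cb) ?_ hb⟩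
  have c1 : ContinuousOn (fun t => (μ / t) • bessel (b t)) (Icc 1 T) :=
    ContinuousOn.smul (continuousOn_const.div continuousOn_id fun t ht =>
      (one_pos.trans_le ht.1).ne') (continuousOn_bessel cb)
  have c2 : ContinuousOn (fun t => nonlin p (a t)) (Icc 1 T) := by
    simpa only [Function.comp_def] using (continuous_nonlin hp).comp_continuousOn ca
  exact ((ca.neg.add (continuousOn_bessel (continuousOn_bessel ca))).sub c1).add c2

theorem bessel_force (μ : ℝ) {p : ℝ} (hp : 2 < p) (t : ℝ) (z : L2 × L2) :
    bessel (force μ p t z) = bessel (bessel z.1) - (μ / t) • bessel z.2 + nonlin p z.1 := by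
  rw [← bessel_nonlinHalf hp, force, bessel, mult_add_right, mult_sub_right, mult_smul_right]

/-- Variation of constants gives the equations under ⟨D⟩⁻²; one factor ⟨D⟩⁻¹ can be removed because
both sides are continuous. -/
theorem isStrong_of_ode {μ p T : ℝ} (hp : 2 < p) {w : ℝ → L2 × L2}
    (hw : ∀ t ∈ Icc 1 T, HasDerivWithinAt w (interaction μ p t (w t)) (Icc 1 T) t) :
    IsStrong μ p T (fun t => (waveGroup t (w t)).1) (fun t => (waveGroup t (w t)).2) := by
  have hwc : ContinuousOn w (Icc 1 T) := fun t ht => (hw t ht).continuousWithinAt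
  have hc : ContinuousOn (fun t => waveGroup t (w t)) (Icc 1 T) := by
    rw [continuousOn_iff_continuous_domRestrict] at hwc ⊢
    exact continuous_waveGroup_comp hwc continuous_subtype_val
  refine isStrong_of_bessel hp hc.fst hc.snd (fun t ht => ?_) fun t ht => ?_
  · have := (hasDerivWithinAt_waveGroup (hw t ht)).1
    simpa only [mult_zero_right, add_zero] using this
  · refine (hasDerivWithinAt_waveGroup (hw t ht)).2.congr_deriv ?_
    rw [bessel_force μ hp, ← mult_neg_right, ← mult_add_right]
    congr 1
    abel

theorem hasDerivWithinAt_Ici_of_Icc {E : Type*} [NormedAddCommGroup E] [NormedSpace ℝ E]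
    {f : ℝ → E} {f' : E} {T t : ℝ} (h : HasDerivWithinAt f f' (Icc 1 T) t) (ht : t ∈ Ico 1 T) :
    HasDerivWithinAt f f' (Ici t) t :=
  h.mono_of_mem_nhdsWithin (Icc_mem_nhdsGE_of_mem ht)

/-- Existence on `[1, T]` for the nonlinear problem, given an a priori bound in `H¹`. -/
theorem exists_strong (μ : ℝ) {p T m : ℝ} (hp : 2 < p) (hT : 1 ≤ T) {a₀ b₀ : L2}
    (hap : ∀ T' ∈ Icc 1 T, ∀ a b, IsStrong μ p T' a b → a 1 = a₀ → b 1 = b₀ →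
      ‖bessel (a T')‖ ≤ m) :
    ∃ a b, IsStrong μ p T a b ∧ a 1 = a₀ ∧ b 1 = b₀ := by
  set w₀ := waveGroup (-1) (a₀, b₀) with hw₀
  have hinit : waveGroup 1 w₀ = (a₀, b₀) := waveGroup_neg_right _ _
  obtain ⟨K, hK, hN⟩ := exists_nonlinHalf_bound hp m
  -- Each of the two applications of the group contributes a factor 2.
  set L := 4 * (1 + |μ| + K) with hL
  have L0 : 0 ≤ L := by positivity
  obtain ⟨w, hw1, hw⟩ := exists_ode_of_apriori (Φ := interaction μ p) (w₀ := w₀) (T := T)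
    (M := gronwallBound ‖w₀‖ L (2 * K) (T - 1)) hT
    (fun ρ hρ => by
      obtain ⟨K, hK, h⟩ := exists_interaction_lipschitz μ hp ρ hρ
      exact ⟨K, hK, fun t ht => h t ht.1⟩)
    (fun x => continuousOn_interaction μ hp continuousOn_const fun t ht => ht.1)
    (fun T' hT' w hw1 hw => by
      have hbd : ∀ t ∈ Icc 1 T', ‖interaction μ p t (w t)‖ ≤ L * ‖w t‖ + 2 * K := by
        intro t ht
        have hst := (isStrong_of_ode hp hw).mono ht.2
        -- The H¹ bound enters here: it makes the nonlinearity of linear growth, so that Gronwall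
        -- bounds the full norm.
        have hb := hN _ (hap t ⟨ht.1, ht.2.trans hT'.2⟩ _ _ hst
          (by rw [hw1, hinit]) (by rw [hw1, hinit]))
        have h1 := norm_interaction_le μ p t (w t)
        have h2 := norm_waveGroup_le t (w t)
        generalize waveGroup t (w t) = z at *
        have f1 := norm_fst_le z
        have f2 := norm_snd_le z
        have h3 : ‖force μ p t z‖ ≤ ‖z.1‖ + |μ| * ‖z.2‖ + K * (1 + ‖z.1‖) := by
          refine (norm_add_le _ _).trans (add_le_add ((norm_sub_le _ _).trans ?_) hb)
          refine add_le_add (norm_bessel_le _) ?_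
          rw [norm_smul, Real.norm_eq_abs]
          exact mul_le_mul_of_nonneg_right (abs_div_le_abs ht.1) (norm_nonneg _)
        have h4 : ‖z.1‖ + |μ| * ‖z.2‖ + K * (1 + ‖z.1‖) ≤ (1 + |μ| + K) * ‖z‖ + K := by
          have := mul_le_mul_of_nonneg_left f2 (abs_nonneg μ)
          have := mul_le_mul_of_nonneg_left f1 hK
          linarith
        have h5 := mul_le_mul_of_nonneg_left h2 (show 0 ≤ 1 + |μ| + K by positivity)
        rw [hL]; linarith
      have := norm_le_gronwallBound_of_norm_deriv_right_le (f := w)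
        (f' := fun t => interaction μ p t (w t)) (δ := ‖w₀‖) (K := L) (ε := 2 * K)
        (a := 1) (b := T')
        (fun t ht => (hw t ht).continuousWithinAt)
        (fun t ht => hasDerivWithinAt_Ici_of_Icc (hw t (Ico_subset_Icc_self ht)) ht) (by rw [hw1])
        (fun t ht => hbd t (Ico_subset_Icc_self ht)) T' ⟨hT'.1, le_rfl⟩
      exact this.trans (gronwallBound_mono (norm_nonneg _) (by positivity) L0
        (sub_le_sub_right hT'.2 1)))
  exact ⟨_, _, isStrong_of_ode hp hw, by rw [hw1, hinit], by rw [hw1, hinit]⟩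

/-- Strong solutions are determined by their initial data. -/
theorem IsStrong.unique {μ p T : ℝ} (hp : 2 < p) {a b a' b' : ℝ → L2} (h : IsStrong μ p T a b)
    (h' : IsStrong μ p T a' b') (ha : a 1 = a' 1) (hb : b 1 = b' 1) :
    ∀ t ∈ Icc 1 T, a t = a' t ∧ b t = b' t := by
  obtain ⟨A, hA⟩ := isCompact_Icc.exists_bound_of_continuousOn h.cont_fst
  obtain ⟨A', hA'⟩ := isCompact_Icc.exists_bound_of_continuousOn h'.cont_fst
  obtain ⟨K, hK, hN⟩ := exists_nonlin_lipschitz hp (max |A| |A'|) (by positivity)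
  set da := fun t => bessel (a t) - bessel (a' t) with hda
  set db := fun t => bessel (b t) - bessel (b' t) with hdb
  -- The squared H¹ norm of the difference of the solutions plus the squared L² norm of the
  -- difference of the velocities.
  set e := fun t => ‖da t‖ ^ 2 + ‖db t‖ ^ 2 with he
  have hda' : ∀ t ∈ Icc 1 T, HasDerivWithinAt da (b t - b' t) (Icc 1 T) t := fun t ht =>
    (h.deriv_fst t ht).sub (h'.deriv_fst t ht)
  have hdb' : ∀ t ∈ Icc 1 T, HasDerivWithinAt db _ (Icc 1 T) t := fun t ht =>
    (h.deriv_snd t ht).sub (h'.deriv_snd t ht)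
  have he' : ∀ t ∈ Icc 1 T, HasDerivWithinAt e _ (Icc 1 T) t := fun t ht =>
    (hda' t ht).norm_sq.add (hdb' t ht).norm_sq
  have hbd : ∀ t ∈ Ico 1 T, ‖2 * inner ℝ (da t) (b t - b' t) + 2 * inner ℝ (db t)
      (-a t + bessel (bessel (a t)) - (μ / t) • bessel (b t) + nonlin p (a t) -
        (-a' t + bessel (bessel (a' t)) - (μ / t) • bessel (b' t) + nonlin p (a' t)))‖ ≤
      (1 + K + 2 * |μ|) * ‖e t‖ + 0 := by
    intro t ht
    have ht' := Ico_subset_Icc_self ht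
    have e1 : -a t + bessel (bessel (a t)) - (μ / t) • bessel (b t) + nonlin p (a t) -
        (-a' t + bessel (bessel (a' t)) - (μ / t) • bessel (b' t) + nonlin p (a' t)) =
        -(a t - a' t) + bessel (da t) - (μ / t) • db t + (nonlin p (a t) - nonlin p (a' t)) := by
      simp only [hda, hdb, mult_sub_right, smul_sub]; abel
    -- The terms with a - a' and b - b', not controlled by the energy, cancel because ⟨D⟩⁻¹ is
    -- self-adjoint.
    have e2 : inner ℝ (da t) (b t - b' t) = inner ℝ (db t) (a t - a' t) := by
      simp only [hda, hdb]
      rw [← mult_sub_right, ← mult_sub_right, inner_bessel_left, real_inner_comm]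
    have e3 : 2 * inner ℝ (da t) (b t - b' t) + 2 * inner ℝ (db t)
        (-(a t - a' t) + bessel (da t) - (μ / t) • db t + (nonlin p (a t) - nonlin p (a' t))) =
        2 * inner ℝ (db t) (bessel (da t)) - 2 * (μ / t) * ‖db t‖ ^ 2 +
          2 * inner ℝ (db t) (nonlin p (a t) - nonlin p (a' t)) := by
      rw [e2]
      generalize a t - a' t = q
      rw [inner_add_right, inner_sub_right, inner_add_right, inner_neg_right,
        inner_smul_right, real_inner_self_eq_norm_sq]
      ring
    have hN1 := (hN (a t) (a' t) ((hA t ht').trans ((le_abs_self _).trans (le_max_left _ _)))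
      ((hA' t ht').trans ((le_abs_self _).trans (le_max_right _ _)))).1
    rw [← mult_sub_right] at hN1
    have hN2 : ‖nonlin p (a t) - nonlin p (a' t)‖ ≤ K * ‖da t‖ :=
      hN1.trans (mul_le_mul_of_nonneg_left (norm_bessel_le _) hK)
    rw [e1, e3, add_zero, Real.norm_eq_abs, Real.norm_of_nonneg (by positivity)]
    have i1 : |inner ℝ (db t) (bessel (da t))| ≤ ‖db t‖ * ‖da t‖ :=
      (abs_real_inner_le_norm _ _).trans
        (mul_le_mul_of_nonneg_left (norm_bessel_le _) (norm_nonneg _))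
    have i2 : |inner ℝ (db t) (nonlin p (a t) - nonlin p (a' t))| ≤ K * (‖db t‖ * ‖da t‖) := by
      refine (abs_real_inner_le_norm _ _).trans
        ((mul_le_mul_of_nonneg_left hN2 (norm_nonneg _)).trans_eq (by ring))
    have i3 : |2 * (μ / t) * ‖db t‖ ^ 2| ≤ 2 * |μ| * ‖db t‖ ^ 2 := by
      rw [abs_mul, abs_mul, abs_of_nonneg (sq_nonneg ‖db t‖), abs_two]
      exact mul_le_mul_of_nonneg_right
        (mul_le_mul_of_nonneg_left (abs_div_le_abs ht.1) two_pos.le) (sq_nonneg _)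
    have i4 : 2 * (‖db t‖ * ‖da t‖) ≤ e t := by
      simp only [he]; nlinarith [sq_nonneg (‖db t‖ - ‖da t‖)]
    have i5 : ‖db t‖ ^ 2 ≤ e t := by simp only [he]; linarith [sq_nonneg ‖da t‖]
    have i6 := mul_le_mul_of_nonneg_left i4 hK
    have i7 := mul_le_mul_of_nonneg_left i5 (abs_nonneg μ)
    rw [abs_le] at i1 i2 i3 ⊢
    constructor <;> linarith [i1.1, i1.2, i2.1, i2.2, i3.1, i3.2]
  have hgr := norm_le_gronwallBound_of_norm_deriv_right_le (f := e) (δ := 0)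
    (K := 1 + K + 2 * |μ|) (ε := 0) (a := 1) (b := T)
    (fun t ht => (he' t ht).continuousWithinAt)
    (fun t ht => hasDerivWithinAt_Ici_of_Icc (he' t (Ico_subset_Icc_self ht)) ht)
    (by simp [he, hda, hdb, ha, hb]) hbd
  intro t ht
  have h0 := hgr t ht
  rw [gronwallBound_ε0, zero_mul, Real.norm_of_nonneg (by positivity)] at h0
  have h1 : ‖da t‖ = 0 := by
    have : ‖da t‖ ^ 2 ≤ 0 := by simp only [he] at h0; linarith [sq_nonneg ‖db t‖]
    exact pow_eq_zero_iff two_ne_zero |>.mp (le_antisymm this (sq_nonneg _))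
  have h2 : ‖db t‖ = 0 := by
    have : ‖db t‖ ^ 2 ≤ 0 := by simp only [he] at h0; linarith [sq_nonneg ‖da t‖]
    exact pow_eq_zero_iff two_ne_zero |>.mp (le_antisymm this (sq_nonneg _))
  exact ⟨bessel_injective (sub_eq_zero.mp (norm_eq_zero.mp h1)),
    bessel_injective (sub_eq_zero.mp (norm_eq_zero.mp h2))⟩

end DampedWave

namespace DampedWave

open Filter Topology
open scoped BoundedContinuousFunction

/-! ### Differential inequalities -/

/-- If `y' ≤ D t^{-1-η}`, then `y` grows by at most `D / η`. -/
theorem le_add_div_of_deriv_le {y y' : ℝ → ℝ} {T D η : ℝ} (hT : 1 ≤ T) (hD : 0 ≤ D) (hη : 0 < η)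
    (hy : ∀ t ∈ Icc 1 T, HasDerivWithinAt y (y' t) (Icc 1 T) t)
    (hle : ∀ t ∈ Ioo 1 T, y' t ≤ D * t ^ (-1 - η)) : y T ≤ y 1 + D / η := by
  -- The added term has derivative -D t^{-1-η}, so the sum is nonincreasing.
  have hd : ∀ t ∈ Icc 1 T, HasDerivWithinAt (fun t => y t + D / η * t ^ (-η))
      (y' t + D / η * (-η * t ^ (-η - 1))) (Icc 1 T) t := fun t ht =>
    (hy t ht).add ((Real.hasDerivAt_rpow_const (p := -η)
      (Or.inl (one_pos.trans_le ht.1).ne')).hasDerivWithinAt.const_mul (D / η))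
  have hanti : AntitoneOn (fun t => y t + D / η * t ^ (-η)) (Icc 1 T) := by
    refine antitoneOn_of_hasDerivWithinAt_nonpos (convex_Icc 1 T)
      (fun t ht => (hd t ht).continuousWithinAt)
      (fun t ht => (hd t (interior_subset ht)).mono interior_subset) fun t ht => ?_
    have h1 := hle t (interior_Icc (α := ℝ) ▸ ht)
    have e : D / η * (-η * t ^ (-η - 1)) = -(D * t ^ (-1 - η)) := by
      rw [show -η - 1 = -1 - η by ring]; field_simp
    rw [e]; linarith
  have h1 := hanti (left_mem_Icc.mpr hT) (right_mem_Icc.mpr hT) hT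
  simp only [Real.one_rpow, mul_one] at h1
  have h2 : 0 ≤ D / η * T ^ (-η) := by positivity
  linarith

/-- If `y' ≤ 2 A t^{-1-η} √y`, then `√y` grows by at most `A / η`. -/
theorem sqrt_le_add_div_of_deriv_le {y y' : ℝ → ℝ} {T A η : ℝ} (hT : 1 ≤ T) (hA : 0 ≤ A)
    (hη : 0 < η) (hy : ∀ t ∈ Icc 1 T, HasDerivWithinAt y (y' t) (Icc 1 T) t)
    (h0 : ∀ t ∈ Icc 1 T, 0 ≤ y t)
    (hle : ∀ t ∈ Ioo 1 T, y' t ≤ 2 * (A * t ^ (-1 - η)) * √(y t)) :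
    √(y T) ≤ √(y 1) + A / η := by
  -- The square root is not differentiable where y vanishes, so y + d² is used and d is sent to 0.
  refine le_of_forall_pos_le_add fun d hd => ?_
  have hd2 : 0 < d ^ 2 := pow_pos hd 2
  have hpos : ∀ t ∈ Icc 1 T, 0 < y t + d ^ 2 := fun t ht => add_pos_of_nonneg_of_pos (h0 t ht) hd2
  have := le_add_div_of_deriv_le (y := fun t => √(y t + d ^ 2))
    (y' := fun t => y' t / (2 * √(y t + d ^ 2))) hT hA hη
    (fun t ht => ((hy t ht).add_const (d ^ 2)).sqrt (hpos t ht).ne') fun t ht => by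
      have hs : 0 < √(y t + d ^ 2) := Real.sqrt_pos.mpr (hpos t (Ioo_subset_Icc_self ht))
      rw [div_le_iff₀ (by positivity)]
      refine (hle t ht).trans ?_
      have h1 : √(y t) ≤ √(y t + d ^ 2) := Real.sqrt_le_sqrt (by linarith)
      have h2 : 0 ≤ A * t ^ (-1 - η) := mul_nonneg hA
        (Real.rpow_nonneg (zero_le_one.trans ht.1.le) _)
      nlinarith [mul_le_mul_of_nonneg_left h1 h2]
  have h1 : √(y T) ≤ √(y T + d ^ 2) := Real.sqrt_le_sqrt (by linarith)
  have h2 : √(y 1 + d ^ 2) ≤ √(y 1) + d := by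
    rw [Real.sqrt_le_left (by positivity)]
    nlinarith [Real.sq_sqrt (h0 1 (left_mem_Icc.mpr hT)), Real.sqrt_nonneg (y 1)]
  linarith

/-! ### The resolvent of the Laplacian -/

theorem sub_one_add_weightSq_pos {l : ℝ} (hl : 0 < l) (ξ : Plane) : 0 < l - 1 + weightSq ξ := by
  linarith [one_le_weightSq ξ]

/-- The symbol `(λ + 4π²|ξ|²)⁻¹` of `(λ - Δ)⁻¹`. -/
def greenSymbol (l : ℝ) (hl : 0 < l) : Plane →ᵇ ℝ :=
  BoundedContinuousFunction.ofNormedAddCommGroup (fun ξ => (l - 1 + weightSq ξ)⁻¹)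
    ((continuous_const.add continuous_weightSq).inv₀ fun ξ => (sub_one_add_weightSq_pos hl ξ).ne')
    l⁻¹ (fun ξ => by
      have := sub_one_add_weightSq_pos hl ξ
      rw [Real.norm_of_nonneg (inv_pos.mpr this).le]
      exact inv_anti₀ hl (by linarith [one_le_weightSq ξ]))

theorem greenSymbol_apply (l : ℝ) (hl : 0 < l) (ξ : Plane) :
    greenSymbol l hl ξ = (l - 1 + weightSq ξ)⁻¹ := rfl

theorem greenSymbol_pos (l : ℝ) (hl : 0 < l) (ξ : Plane) : 0 < greenSymbol l hl ξ :=
  inv_pos.mpr (sub_one_add_weightSq_pos hl ξ)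

/-- `(λ - Δ)⁻¹`. -/
abbrev green (l : ℝ) (hl : 0 < l) (f : L2) : L2 := mult (greenSymbol l hl) f

theorem inner_green_comm (l : ℝ) (hl : 0 < l) (f g : L2) :
    inner ℝ (green l hl f) g = inner ℝ (green l hl g) f := by
  rw [inner_mult_left, real_inner_comm]

theorem inner_green_nonneg (l : ℝ) (hl : 0 < l) (f : L2) : 0 ≤ inner ℝ (green l hl f) f := by
  exact inner_mult_self_nonneg _ _ fun ξ => (greenSymbol_pos l hl ξ).le

theorem inner_green_bessel (l : ℝ) (hl : 0 < l) (f g : L2) :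
    inner ℝ (green l hl (bessel f)) g = inner ℝ (green l hl f) (bessel g) := by
  rw [green, bessel, mult_comm, inner_mult_left]

/-- Cauchy-Schwarz for the form of `(λ - Δ)⁻¹`. -/
theorem inner_green_le (l : ℝ) (hl : 0 < l) (f g : L2) :
    inner ℝ (green l hl f) g ≤ √(inner ℝ (green l hl f) f) * √(inner ℝ (green l hl g) g) := by
  have hq : ∀ s : ℝ, 0 ≤ inner ℝ (green l hl g) g * (s * s) + 2 * inner ℝ (green l hl f) g * s +
      inner ℝ (green l hl f) f := fun s => by
    have := inner_green_nonneg l hl (f + s • g)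
    rw [green, mult_add_right, mult_smul_right, inner_add_left, inner_add_right, inner_add_right,
      inner_smul_left, inner_smul_left, inner_smul_right, inner_smul_right] at this
    rw [inner_green_comm l hl g f] at this
    simp only [conj_trivial] at this
    linarith
  have hd := discrim_le_zero hq
  rw [discrim] at hd
  rw [← Real.sqrt_mul (inner_green_nonneg l hl f)]
  refine Real.le_sqrt_of_sq_le ?_
  nlinarith

/-- `⟨(λ - Δ)⁻¹ f, f⟩ = λ ‖φ‖² + ‖∇φ‖²` for `φ = (λ - Δ)⁻¹ f`, which is in the range of `⟨D⟩⁻¹`. -/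
theorem exists_green_eq (l : ℝ) (hl : 0 < l) (f : L2) : ∃ b : L2, bessel b = green l hl f ∧
    inner ℝ (green l hl f) f = l * ‖bessel b‖ ^ 2 + (‖b‖ ^ 2 - ‖bessel b‖ ^ 2) := by
  have hle : ∀ ξ, weightSq ξ * (l - 1 + weightSq ξ)⁻¹ ≤ 1 + l⁻¹ := fun ξ => by
    have h1 := sub_one_add_weightSq_pos hl ξ
    rw [← div_eq_mul_inv, div_le_iff₀ h1]
    have h2 := one_le_weightSq ξ
    have h3 : l⁻¹ * l = 1 := inv_mul_cancel₀ hl.ne'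
    have h4 : 0 ≤ l⁻¹ * (weightSq ξ - 1) := mul_nonneg (inv_pos.mpr hl).le (by linarith)
    nlinarith
  -- The symbol of (1 - Δ)(λ - Δ)⁻¹ is bounded; applying ⟨D⟩⁻¹ once yields b = ⟨D⟩(λ - Δ)⁻¹f.
  let m : Plane →ᵇ ℝ := BoundedContinuousFunction.ofNormedAddCommGroup
    (fun ξ => weightSq ξ * (l - 1 + weightSq ξ)⁻¹)
    (continuous_weightSq.mul (greenSymbol l hl).continuous) (1 + l⁻¹)
    (fun ξ => by
      have h1 := (greenSymbol_pos l hl ξ).le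
      rw [greenSymbol_apply] at h1
      rw [Real.norm_of_nonneg (mul_nonneg (by linarith [one_le_weightSq ξ]) h1)]
      exact hle ξ)
  have hm : ∀ ξ, m ξ = weightSq ξ * (l - 1 + weightSq ξ)⁻¹ := fun ξ => rfl
  have e1 : besselSymbol * (besselSymbol * m) = greenSymbol l hl := by
    ext ξ
    simp only [BoundedContinuousFunction.coe_mul, Pi.mul_apply, hm, besselSymbol_apply,
      greenSymbol_apply, ← weight_sq]
    have := weight_pos ξ
    field_simp
  have e2 : (l - 1) • greenSymbol l hl + m = 1 := by
    ext ξ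
    simp only [BoundedContinuousFunction.coe_add, BoundedContinuousFunction.coe_smul, Pi.add_apply,
      hm, greenSymbol_apply, BoundedContinuousFunction.coe_one, Pi.one_apply, smul_eq_mul]
    rw [← add_mul]
    exact mul_inv_cancel₀ (sub_one_add_weightSq_pos hl ξ).ne'
  have hb : bessel (bessel (mult m f)) = green l hl f := by
    rw [green, ← e1, mult_mul, mult_mul]
  refine ⟨bessel (mult m f), hb, ?_⟩
  have hf : f = (l - 1) • green l hl f + mult m f := by
    conv_lhs => rw [← mult_one f, ← e2, mult_add, mult_smul]
  have h3 : inner ℝ (green l hl f) (mult m f) = ‖bessel (mult m f)‖ ^ 2 := by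
    rw [← hb, inner_bessel_left, real_inner_self_eq_norm_sq]
  rw [hb]
  nth_rewrite 2 [hf]
  rw [inner_add_right, inner_smul_right, h3, real_inner_self_eq_norm_sq]
  ring

theorem aestronglyMeasurable_abs (f : L2) : AEStronglyMeasurable (fun x => |f x|) volume :=
  (Lp.aestronglyMeasurable f).norm

/-- The dual Gagliardo-Nirenberg inequality. -/
theorem exists_green_bound (r : ℝ) (hr : 2 < r) : ∃ C : ℝ, 0 < C ∧
    ∀ (l : ℝ) (hl : 0 < l) (f : L2), Integrable (fun x => |f x| ^ (r / (r - 1))) →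
      √(inner ℝ (green l hl f) f) ≤
        C * l ^ (-1 / r) * (∫ x, |f x| ^ (r / (r - 1))) ^ (1 - 1 / r) := by
  obtain ⟨C, hC, hGN⟩ := exists_gagliardo r hr.le
  have r0 : 0 < r := by linarith
  have r1 : 0 < r - 1 := by linarith
  refine ⟨C ^ (1 / r), by positivity, fun l hl f hf => ?_⟩
  obtain ⟨b, hb, hX⟩ := exists_green_eq l hl f
  set X := inner ℝ (green l hl f) f with hXdef
  have hI : 0 ≤ ∫ x, |f x| ^ (r / (r - 1)) :=
    integral_nonneg fun x => Real.rpow_nonneg (abs_nonneg _) _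
  rcases (inner_green_nonneg l hl f).eq_or_lt with h0 | hpos
  · rw [hXdef, ← h0, Real.sqrt_zero]; positivity
  have hbb := norm_bessel_le b
  have hbb2 : ‖bessel b‖ ^ 2 ≤ ‖b‖ ^ 2 := pow_le_pow_left₀ (norm_nonneg _) hbb 2
  have hs0 : 0 < √X := Real.sqrt_pos.mpr hpos
  have hsq : √X ^ 2 = X := Real.sq_sqrt hpos.le
  -- For φ = (λ - Δ)⁻¹f both λ‖φ‖² and ‖∇φ‖² are at most X, so √X serves as gradient bound in
  -- Gagliardo-Nirenberg.
  obtain ⟨hint, hle⟩ := hGN b (√X) hs0 (by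
    rw [hsq, hX]; nlinarith [mul_nonneg hl.le (sq_nonneg ‖bessel b‖)])
  have hphi : ‖bessel b‖ ^ 2 ≤ l⁻¹ * √X ^ 2 := by
    rw [hsq, ← div_eq_inv_mul, le_div_iff₀ hl]; linarith
  have hbig : ∫ x, |bessel b x| ^ r ≤ C * l⁻¹ * √X ^ r := by
    refine hle.trans ?_
    calc C * (‖bessel b‖ ^ 2 * √X ^ (r - 2)) ≤ C * (l⁻¹ * √X ^ 2 * √X ^ (r - 2)) := by gcongr
      _ = C * l⁻¹ * √X ^ r := by
        have : √X ^ r = √X ^ 2 * √X ^ (r - 2) := by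
          rw [← Real.rpow_natCast, ← Real.rpow_add hs0]; norm_num
        rw [this]; ring
  have hconj : (r / (r - 1)).HolderConjugate r :=
    (Real.HolderConjugate.conjExponent (by linarith : 1 < r)).symm
  have hq0 : 0 < r / (r - 1) := by positivity
  have hmf : MemLp (fun x => |f x|) (ENNReal.ofReal (r / (r - 1))) volume := by
    rw [← integrable_norm_rpow_iff (aestronglyMeasurable_abs _)
      (by simpa using hq0) ENNReal.ofReal_ne_top, ENNReal.toReal_ofReal hq0.le]
    simpa using hf
  have hmp : MemLp (fun x => |bessel b x|) (ENNReal.ofReal r) volume := by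
    rw [← integrable_norm_rpow_iff (aestronglyMeasurable_abs _)
      (by simpa using r0) ENNReal.ofReal_ne_top, ENNReal.toReal_ofReal r0.le]
    simpa using hint
  have hH := integral_mul_le_Lp_mul_Lq_of_nonneg hconj
    (Eventually.of_forall fun x => abs_nonneg (f x))
    (Eventually.of_forall fun x => abs_nonneg (bessel b x)) hmf hmp
  have hXle : X ≤ ∫ x, |f x| * |bessel b x| := by
    rw [hXdef, ← hb, real_inner_comm, inner_L2]
    refine (le_abs_self _).trans ((abs_integral_le_integral_abs).trans_eq ?_)
    simp only [abs_mul]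
  have e1 : 1 / (r / (r - 1)) = 1 - 1 / r := by field_simp
  rw [e1] at hH
  have hrt : (∫ x, |bessel b x| ^ r) ^ (1 / r) ≤ C ^ (1 / r) * l ^ (-1 / r) * √X := by
    refine (Real.rpow_le_rpow (integral_nonneg fun x => Real.rpow_nonneg (abs_nonneg _) _) hbig
      (by positivity)).trans_eq ?_
    rw [Real.mul_rpow (by positivity) (by positivity), Real.mul_rpow hC.le (by positivity),
      ← Real.rpow_mul hs0.le, mul_one_div_cancel r0.ne', Real.rpow_one, ← Real.rpow_neg_one,
      ← Real.rpow_mul hl.le]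
    congr 3; ring
  -- By Hölder, X = ⟨φ, f⟩ is at most the dual norm of f times the L^r norm of φ, which is itself a
  -- multiple of √X; one factor √X is then divided out.
  have hfin : √X * √X ≤ (C ^ (1 / r) * l ^ (-1 / r) *
      (∫ x, |f x| ^ (r / (r - 1))) ^ (1 - 1 / r)) * √X := by
    rw [← sq, hsq]
    refine (hXle.trans hH).trans ?_
    refine (mul_le_mul_of_nonneg_left hrt (Real.rpow_nonneg hI _)).trans_eq (by ring)
  exact le_of_mul_le_mul_right hfin hs0

end DampedWave

namespace DampedWave

open Filter Topology
open scoped BoundedContinuousFunction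

/-! ### The energy weighted by the resolvent -/

theorem hasDerivWithinAt_mult (m : Plane →ᵇ ℝ) {f : ℝ → L2} {f' : L2} {s : Set ℝ} {t : ℝ}
    (h : HasDerivWithinAt f f' s t) :
    HasDerivWithinAt (fun r => mult m (f r)) (mult m f') s t := by
  simpa only [Function.comp_def, multL_apply] using
    (multL m).hasFDerivAt.comp_hasDerivWithinAt t h

/-- The energy controlling the `L²` norm. -/
def greenEnergy (μ l : ℝ) (hl : 0 < l) (a b : L2) (s : ℝ) : ℝ :=
  inner ℝ (green l hl (s • bessel b + bessel (bessel a))) (s • bessel b + bessel (bessel a)) +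
    (μ - 2) * inner ℝ (green l hl (bessel (bessel a))) (bessel (bessel a)) +
    s ^ 2 * (inner ℝ (green l hl (bessel a)) (bessel a) -
      inner ℝ (green l hl (bessel (bessel a))) (bessel (bessel a)))

/-- The point is that W = t∂ₜu + u satisfies W' = (2 - μ)∂ₜu + t(Δu + F). The (μ - 2) term of the
energy absorbs ⟨Gu, ∂ₜu⟩, and the s² term absorbs everything containing Δu. -/
theorem greenEnergy_deriv_eq (μ l : ℝ) (hl : 0 < l) {t : ℝ} (ht : t ≠ 0) {a b U V P W V' W' F : L2}
    (hU : U = bessel (bessel a)) (hV : V = bessel b) (hP : P = bessel a) (hW : W = t • V + U)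
    (hV' : V' = -a + U - (μ / t) • V + F) (hW' : W' = t • V' + (1 : ℝ) • V + V) :
    inner ℝ (green l hl W) W' + inner ℝ (green l hl W') W +
      (μ - 2) * (inner ℝ (green l hl U) V + inner ℝ (green l hl V) U) +
      (2 * t * (inner ℝ (green l hl P) P - inner ℝ (green l hl U) U) +
        t ^ 2 * (inner ℝ (green l hl P) b + inner ℝ (green l hl b) P -
          (inner ℝ (green l hl U) V + inner ℝ (green l hl V) U))) =
    2 * ((2 - μ) * t * inner ℝ (green l hl V) V + t * inner ℝ (green l hl W) F) := by
  have hW2 : W' = (2 - μ) • V + t • (-a + U + F) := by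
    rw [hW', hV', smul_add, smul_sub, smul_smul, mul_div_cancel₀ _ ht, smul_add t (-a + U) F]
    module
  have q1 : inner ℝ (green l hl P) b = inner ℝ (green l hl V) a := by
    rw [hP, hV, inner_green_bessel, inner_green_comm]
  have q2 : inner ℝ (green l hl U) a = inner ℝ (green l hl P) P := by
    rw [hU, ← hP, inner_green_bessel, ← hP]
  have hc := inner_green_comm l hl
  clear hU hV hP hV' hW'
  subst hW hW2
  simp only [green, mult_add_right, mult_smul_right, mult_neg_right, inner_add_left,
    inner_add_right, inner_smul_left, inner_smul_right, inner_neg_left, inner_neg_right,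
    conj_trivial] at *
  rw [hc b P, hc V U, hc F V, hc F U, hc a V, hc a U, q1, q2]
  ring

theorem IsStrong.hasDerivWithinAt_greenEnergy {μ p T : ℝ} {a b : ℝ → L2} (h : IsStrong μ p T a b)
    (l : ℝ) (hl : 0 < l) {t : ℝ} (ht : t ∈ Icc 1 T) :
    HasDerivWithinAt (fun s => greenEnergy μ l hl (a s) (b s) s)
      (2 * ((2 - μ) * t * inner ℝ (green l hl (bessel (b t))) (bessel (b t)) +
        t * inner ℝ (green l hl (t • bessel (b t) + bessel (bessel (a t)))) (nonlin p (a t))))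
      (Icc 1 T) t := by
  have hP := h.deriv_fst t ht
  have hU := hasDerivWithinAt_mult besselSymbol hP
  have hV := h.deriv_snd t ht
  have hW := ((hasDerivWithinAt_id t (Icc 1 T)).smul hV).add hU
  have hGP := (hasDerivWithinAt_mult (greenSymbol l hl) hP).inner ℝ hP
  have hGU := (hasDerivWithinAt_mult (greenSymbol l hl) hU).inner ℝ hU
  have hGW := (hasDerivWithinAt_mult (greenSymbol l hl) hW).inner ℝ hW
  have hy := (hGW.add (hGU.const_mul (μ - 2))).add
    (((hasDerivWithinAt_id t (Icc 1 T)).pow 2).mul (hGP.sub hGU))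
  have e := greenEnergy_deriv_eq μ l hl (one_pos.trans_le ht.1).ne' (a := a t) (b := b t)
    (F := nonlin p (a t)) rfl rfl rfl rfl rfl rfl
  rw [← e]
  refine hy.congr_deriv ?_
  simp only [id, Pi.add_apply, Pi.smul_apply', Nat.cast_ofNat, Nat.add_one_sub_one, pow_one,
    mul_one]
  rfl

/-- For u = ⟨D⟩⁻¹f the difference is ⟨(λ - Δ)⁻¹(-Δ)u, u⟩, whose symbol is nonnegative. -/
theorem inner_green_sub_nonneg (l : ℝ) (hl : 0 < l) (f : L2) :
    0 ≤ inner ℝ (green l hl f) f - inner ℝ (green l hl (bessel f)) (bessel f) := by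
  have e : inner ℝ (green l hl f) f - inner ℝ (green l hl (bessel f)) (bessel f) =
      inner ℝ (mult (greenSymbol l hl * (1 - besselSymbol * besselSymbol)) f) f := by
    rw [mult_mul, mult_sub, mult_one, mult_sub_right, inner_sub_left, mult_mul,
      ← inner_green_bessel l hl (bessel f) f]
  rw [e]
  refine inner_mult_self_nonneg _ _ fun ξ => ?_
  simp only [BoundedContinuousFunction.coe_mul, BoundedContinuousFunction.coe_sub,
    BoundedContinuousFunction.coe_one, Pi.mul_apply, Pi.sub_apply, Pi.one_apply]
  have h1 := (besselSymbol_pos ξ).le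
  have h2 : besselSymbol ξ ≤ 1 := (le_abs_self _).trans (abs_besselSymbol_le ξ)
  exact mul_nonneg (greenSymbol_pos l hl ξ).le (by nlinarith)

/-- The identity λG + G(-Δ) = 1 for G = (λ - Δ)⁻¹, applied to ⟨D⟩⁻¹f. -/
theorem inner_green_sub_eq (l : ℝ) (hl : 0 < l) (f : L2) :
    l * inner ℝ (green l hl (bessel f)) (bessel f) +
      (inner ℝ (green l hl f) f - inner ℝ (green l hl (bessel f)) (bessel f)) =
      ‖bessel f‖ ^ 2 := by
  have e0 : greenSymbol l hl * ((l - 1) • (besselSymbol * besselSymbol) + 1) =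
      besselSymbol * besselSymbol := by
    ext ξ
    simp only [BoundedContinuousFunction.coe_mul, BoundedContinuousFunction.coe_add,
      BoundedContinuousFunction.coe_smul, BoundedContinuousFunction.coe_one, Pi.mul_apply,
      Pi.add_apply, Pi.one_apply, smul_eq_mul, greenSymbol_apply, besselSymbol_apply]
    have h1 := sub_one_add_weightSq_pos hl ξ
    have h2 := weight_pos ξ
    rw [← weight_sq] at h1 ⊢
    field_simp
  have e : inner ℝ (mult (greenSymbol l hl * ((l - 1) • (besselSymbol * besselSymbol) + 1)) f) f =
      (l - 1) * inner ℝ (green l hl (bessel f)) (bessel f) + inner ℝ (green l hl f) f := by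
    rw [mult_mul, mult_add, mult_smul, mult_one, mult_add_right, mult_smul_right, inner_add_left,
      inner_smul_left, mult_mul, ← inner_green_bessel]
    rfl
  rw [e0, mult_mul, inner_bessel_left, real_inner_self_eq_norm_sq] at e
  rw [e]
  ring

theorem greenEnergy_nonneg {μ l : ℝ} (hμ : 2 < μ) (hl : 0 < l) (a b : L2) (s : ℝ) :
    inner ℝ (green l hl (s • bessel b + bessel (bessel a))) (s • bessel b + bessel (bessel a)) ≤
      greenEnergy μ l hl a b s := by
  have h1 := inner_green_sub_nonneg l hl (bessel a)
  have h2 := inner_green_nonneg l hl (bessel (bessel a))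
  have h3 := mul_nonneg (sq_nonneg s) h1
  have h4 := mul_nonneg (sub_nonneg.mpr hμ.le) h2
  rw [greenEnergy]
  linarith

/-- When λs² = μ - 2 the last two terms of the energy combine to s²(λ⟨Gu, u⟩ + ⟨G(-Δ)u, u⟩) =
s²‖u‖². -/
theorem sq_mul_norm_sq_le_greenEnergy {μ l s : ℝ} (hl : 0 < l) (hls : l * s ^ 2 = μ - 2)
    (a b : L2) : s ^ 2 * ‖bessel (bessel a)‖ ^ 2 ≤ greenEnergy μ l hl a b s := by
  have h1 := inner_green_sub_eq l hl (bessel a)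
  have h2 := inner_green_nonneg l hl (s • bessel b + bessel (bessel a))
  rw [greenEnergy, ← h1, ← hls]
  linarith

/-- The term with 2 - μ has a favourable sign, and Cauchy-Schwarz for the form of G bounds the
source by the square root of the energy. -/
theorem IsStrong.sqrt_greenEnergy_le {μ p T A η : ℝ} {a b : ℝ → L2} (h : IsStrong μ p T a b)
    (hμ : 2 < μ) (hT : 1 ≤ T) (l : ℝ) (hl : 0 < l) (hA : 0 ≤ A) (hη : 0 < η)
    (hf : ∀ t ∈ Ioo 1 T, t * √(inner ℝ (green l hl (nonlin p (a t))) (nonlin p (a t))) ≤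
      A * t ^ (-1 - η)) :
    √(greenEnergy μ l hl (a T) (b T) T) ≤ √(greenEnergy μ l hl (a 1) (b 1) 1) + A / η := by
  refine sqrt_le_add_div_of_deriv_le (y := fun s => greenEnergy μ l hl (a s) (b s) s) hT hA hη
    (fun t ht => h.hasDerivWithinAt_greenEnergy l hl ht)
    (fun t ht => (inner_green_nonneg _ _ _).trans (greenEnergy_nonneg hμ hl _ _ _))
    fun t ht => ?_
  have t0 : 0 < t := one_pos.trans ht.1
  have h1 := inner_green_le l hl (t • bessel (b t) + bessel (bessel (a t))) (nonlin p (a t))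
  have h2 : √(inner ℝ (green l hl (t • bessel (b t) + bessel (bessel (a t))))
      (t • bessel (b t) + bessel (bessel (a t)))) ≤ √(greenEnergy μ l hl (a t) (b t) t) :=
    Real.sqrt_le_sqrt (greenEnergy_nonneg hμ hl _ _ _)
  have h3 : (2 - μ) * t * inner ℝ (green l hl (bessel (b t))) (bessel (b t)) ≤ 0 :=
    mul_nonpos_of_nonpos_of_nonneg
      (mul_nonpos_of_nonpos_of_nonneg (by linarith) t0.le) (inner_green_nonneg _ _ _)
  have h4 := mul_le_mul_of_nonneg_right (hf t ht)
    (Real.sqrt_nonneg (greenEnergy μ l hl (a t) (b t) t))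
  have h5 := mul_le_mul_of_nonneg_left (h1.trans (mul_le_mul_of_nonneg_right h2
    (Real.sqrt_nonneg _))) t0.le
  linarith

end DampedWave

namespace DampedWave

open Filter Topology

/-! ### A priori bounds -/

theorem exists_norm_nonlin_bound {p : ℝ} (hp : 2 < p) : ∃ C : ℝ, 0 < C ∧ ∀ (a : L2) (X M : ℝ),
    0 ≤ X → 0 < M → ‖bessel (bessel a)‖ ≤ X → ‖bessel a‖ ^ 2 - ‖bessel (bessel a)‖ ^ 2 ≤ M ^ 2 →
      ‖nonlin p a‖ ≤ C * (X * M ^ (p - 1)) := by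
  obtain ⟨C, hC, h⟩ := exists_gagliardo (2 * p) (by linarith)
  refine ⟨√C, Real.sqrt_pos.mpr hC, fun a X M hX hM hU hG => ?_⟩
  have h1 := (h (bessel a) M hM hG).2
  rw [← norm_nonlin_sq (by linarith)] at h1
  refine (pow_le_pow_iff_left₀ (norm_nonneg _) (by positivity) two_ne_zero).mp (h1.trans ?_)
  rw [mul_pow, mul_pow, Real.sq_sqrt hC.le, ← Real.rpow_natCast (M ^ (p - 1)) 2,
    ← Real.rpow_mul hM.le]
  have e : (p - 1) * ((2 : ℕ) : ℝ) = 2 * p - 2 := by push_cast; ring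
  rw [e]
  gcongr

/-- Dual Gagliardo-Nirenberg with r = 2/δ and q = r/(r-1), so that 1/q = 1 - δ/2. The L^q norm of
|u|^p is the power 1/q of ∫|u|^{pq}, and Gagliardo-Nirenberg gives the exponents 2/q = 2 - δ and (pq
- 2)/q = p - 2 + δ. -/
theorem exists_green_nonlin_bound {p δ : ℝ} (hp : 2 < p) (hδ : 0 < δ) (hδ1 : δ ≤ 1 / 4) :
    ∃ C : ℝ, 0 < C ∧ ∀ (l : ℝ) (hl : 0 < l) (a : L2) (X M : ℝ), 0 ≤ X → 0 < M →
      ‖bessel (bessel a)‖ ≤ X → ‖bessel a‖ ^ 2 - ‖bessel (bessel a)‖ ^ 2 ≤ M ^ 2 →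
      √(inner ℝ (green l hl (nonlin p a)) (nonlin p a)) ≤
        C * l ^ (-δ / 2) * (X ^ (2 - δ) * M ^ (p - 2 + δ)) := by
  set q := 2 / δ / (2 / δ - 1) with hq
  have hr : 2 < 2 / δ := by rw [lt_div_iff₀ hδ]; linarith
  have hr1 : 0 < 2 / δ - 1 := by linarith
  have hq1 : 1 ≤ q := by rw [hq, le_div_iff₀ hr1]; linarith
  obtain ⟨C₁, hC₁, h₁⟩ := exists_green_bound (2 / δ) hr
  obtain ⟨C₂, hC₂, h₂⟩ := exists_gagliardo (p * q) (by nlinarith)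
  have e1 : -1 / (2 / δ) = -δ / 2 := by field_simp
  have e2 : 1 - 1 / (2 / δ) = 1 - δ / 2 := by field_simp
  have hqe : q * (1 - δ / 2) = 1 := by
    have : (2 : ℝ) - δ ≠ 0 := by linarith
    rw [hq]; field_simp
  rw [e1, e2] at h₁
  refine ⟨C₁ * C₂ ^ (1 - δ / 2), by positivity, fun l hl a X M hX hM hU hG => ?_⟩
  obtain ⟨hi, hle⟩ := h₂ (bessel a) M hM hG
  have hae : (fun x => |nonlin p a x| ^ q) =ᵐ[volume] fun x => |bessel (bessel a) x| ^ (p * q) := by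
    filter_upwards [coeFn_nonlin (show 1 < p by linarith) a] with x hx
    rw [hx, abs_of_nonneg (Real.rpow_nonneg (abs_nonneg _) _), ← Real.rpow_mul (abs_nonneg _)]
  have h3 := h₁ l hl (nonlin p a) (hi.congr hae.symm)
  rw [integral_congr_ae hae] at h3
  refine h3.trans ?_
  have h4 : (∫ x, |bessel (bessel a) x| ^ (p * q)) ^ (1 - δ / 2) ≤
      C₂ ^ (1 - δ / 2) * (X ^ (2 - δ) * M ^ (p - 2 + δ)) := by
    have h5 : ∫ x, |bessel (bessel a) x| ^ (p * q) ≤ C₂ * (X ^ (2 : ℝ) * M ^ (p * q - 2)) := by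
      refine hle.trans ?_
      rw [Real.rpow_two]
      gcongr
    refine (Real.rpow_le_rpow (integral_nonneg fun x => Real.rpow_nonneg (abs_nonneg _) _) h5
      (by linarith)).trans_eq ?_
    rw [Real.mul_rpow hC₂.le (by positivity), Real.mul_rpow (by positivity) (by positivity),
      ← Real.rpow_mul hX, ← Real.rpow_mul hM.le]
    have e3 : (2 : ℝ) * (1 - δ / 2) = 2 - δ := by ring
    have e4 : (p * q - 2) * (1 - δ / 2) = p - 2 + δ := by linear_combination p * hqe
    rw [e3, e4]
  calc C₁ * l ^ (-δ / 2) * (∫ x, |bessel (bessel a) x| ^ (p * q)) ^ (1 - δ / 2) ≤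
      C₁ * l ^ (-δ / 2) * (C₂ ^ (1 - δ / 2) * (X ^ (2 - δ) * M ^ (p - 2 + δ))) := by gcongr
    _ = _ := by ring

theorem greenEnergy_smul (μ l : ℝ) (hl : 0 < l) (c s : ℝ) (a b : L2) :
    greenEnergy μ l hl (c • a) (c • b) s = c ^ 2 * greenEnergy μ l hl a b s := by
  simp only [greenEnergy, bessel, mult_smul_right, smul_comm s c, ← smul_add, inner_smul_left,
    inner_smul_right, conj_trivial]
  ring

/-- The first two terms of the energy at time 1 fall under the dual inequality, since the data are
in every L^q. The third is at most ‖u‖², which is absorbed because λ^{-δ/2} is bounded below for λ ≤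
μ - 2. -/
theorem exists_greenEnergy_one_bound {μ δ : ℝ} (hμ : 2 < μ) (hδ : 0 < δ) (hδ1 : δ ≤ 1 / 4)
    {a b : L2} (h1 : ∀ q : ℝ, 0 < q → Integrable fun x => |bessel (bessel a) x| ^ q)
    (h2 : ∀ q : ℝ, 0 < q → Integrable fun x => |(bessel b + bessel (bessel a) : L2) x| ^ q) :
    ∃ C : ℝ, 0 < C ∧ ∀ (l : ℝ) (hl : 0 < l), l ≤ μ - 2 →
      √(greenEnergy μ l hl a b 1) ≤ C * l ^ (-δ / 2) := by
  have hr : 2 < 2 / δ := by rw [lt_div_iff₀ hδ]; linarith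
  have hr1 : 0 < 2 / δ - 1 := by linarith
  have hq0 : 0 < 2 / δ / (2 / δ - 1) := by positivity
  obtain ⟨C, hC, h⟩ := exists_green_bound (2 / δ) hr
  have e1 : -1 / (2 / δ) = -δ / 2 := by field_simp
  rw [e1] at h
  set I₁ := (∫ x, |(bessel b + bessel (bessel a) : L2) x| ^ (2 / δ / (2 / δ - 1))) ^
    (1 - 1 / (2 / δ)) with hI₁
  set I₂ := (∫ x, |bessel (bessel a) x| ^ (2 / δ / (2 / δ - 1))) ^ (1 - 1 / (2 / δ)) with hI₂
  have hI₁0 : 0 ≤ I₁ := Real.rpow_nonneg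
    (integral_nonneg fun x => Real.rpow_nonneg (abs_nonneg _) _) _
  have hI₂0 : 0 ≤ I₂ := Real.rpow_nonneg
    (integral_nonneg fun x => Real.rpow_nonneg (abs_nonneg _) _) _
  have hμ0 : 0 < μ - 2 := by linarith
  refine ⟨C * I₁ + √(μ - 2) * (C * I₂) + ‖bessel (bessel a)‖ * (μ - 2) ^ (δ / 2) + 1,
    by positivity, fun l hl hlμ => ?_⟩
  have g1 := h l hl _ (h2 _ hq0)
  have g2 := h l hl _ (h1 _ hq0)
  rw [← hI₁] at g1
  rw [← hI₂] at g2
  have g3 := inner_green_sub_eq l hl (bessel a)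
  have g4 := inner_green_nonneg l hl (bessel (bessel a))
  set Q := inner ℝ (green l hl (bessel (bessel a))) (bessel (bessel a))
  have hE : greenEnergy μ l hl a b 1 ≤
      inner ℝ (green l hl (bessel b + bessel (bessel a))) (bessel b + bessel (bessel a)) +
        (μ - 2) * Q + ‖bessel (bessel a)‖ ^ 2 := by
    rw [greenEnergy, one_smul]
    nlinarith [mul_nonneg hl.le g4]
  set Q₁ := inner ℝ (green l hl (bessel b + bessel (bessel a))) (bessel b + bessel (bessel a))
  have hs := Real.sqrt_le_sqrt hE
  have hadd : ∀ x y : ℝ, 0 ≤ x → 0 ≤ y → √(x + y) ≤ √x + √y := fun x y hx hy => by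
    rw [Real.sqrt_le_left (by positivity)]
    nlinarith [Real.sq_sqrt hx, Real.sq_sqrt hy, Real.sqrt_nonneg x, Real.sqrt_nonneg y,
      mul_nonneg (Real.sqrt_nonneg x) (Real.sqrt_nonneg y)]
  have hQ₁ : 0 ≤ Q₁ := inner_green_nonneg _ _ _
  have s1 := hadd (Q₁ + (μ - 2) * Q) (‖bessel (bessel a)‖ ^ 2) (by positivity) (sq_nonneg _)
  have s2 := hadd Q₁ ((μ - 2) * Q) hQ₁ (by positivity)
  rw [Real.sqrt_sq (norm_nonneg _)] at s1
  rw [Real.sqrt_mul hμ0.le] at s2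
  have hone : 1 ≤ (μ - 2) ^ (δ / 2) * l ^ (-δ / 2) := by
    rw [neg_div, Real.rpow_neg hl.le, ← div_eq_mul_inv, one_le_div (by positivity)]
    exact Real.rpow_le_rpow hl.le hlμ (by positivity)
  have s3 := mul_le_mul_of_nonneg_left hone (norm_nonneg (bessel (bessel a)))
  have s4 := mul_le_mul_of_nonneg_left g2 (Real.sqrt_nonneg (μ - 2))
  have s5 : 0 ≤ l ^ (-δ / 2) := by positivity
  calc √(greenEnergy μ l hl a b 1) ≤ √Q₁ + √(μ - 2) * √Q + ‖bessel (bessel a)‖ := by linarith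
    _ ≤ C * l ^ (-δ / 2) * I₁ + √(μ - 2) * (C * l ^ (-δ / 2) * I₂) +
        ‖bessel (bessel a)‖ * ((μ - 2) ^ (δ / 2) * l ^ (-δ / 2)) := by linarith
    _ ≤ _ := by linarith

/-- Decay of the `L²` norm under the bootstrap hypotheses. -/
theorem exists_norm_decay {μ p δ : ℝ} (hμ₂ : 2 < μ) (hp : 2 < p) (hδ : 0 < δ)
    (hδ1 : δ ≤ 1 / 4) (hδp : 4 * δ ≤ p - 2) {a₀ b₀ : L2}
    (h1 : ∀ q : ℝ, 0 < q → Integrable fun x => |bessel (bessel a₀) x| ^ q)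
    (h2 : ∀ q : ℝ, 0 < q → Integrable fun x => |(bessel b₀ + bessel (bessel a₀) : L2) x| ^ q) :
    ∃ C : ℝ, 0 < C ∧ ∀ (ε B T : ℝ) (a b : ℝ → L2), 0 ≤ ε → 0 < B → 1 ≤ T → IsStrong μ p T a b →
      a 1 = ε • a₀ → b 1 = ε • b₀ →
      (∀ s ∈ Ico 1 T, ‖bessel (bessel (a s))‖ ≤ B * s ^ (-(1 - δ)) ∧
        ‖bessel (a s)‖ ^ 2 - ‖bessel (bessel (a s))‖ ^ 2 ≤ (B * s ^ (-(μ / 2))) ^ 2) →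
      ‖bessel (bessel (a T))‖ ≤ C * (ε + B ^ p) * T ^ (-(1 - δ)) := by
  obtain ⟨C₁, hC₁, hdata⟩ := exists_greenEnergy_one_bound hμ₂ hδ hδ1 h1 h2
  obtain ⟨C₂, hC₂, hnon⟩ := exists_green_nonlin_bound hp hδ hδ1
  have hμ0 : 0 < μ - 2 := by linarith
  set c := (μ - 2) ^ (-δ / 2) with hc
  have c0 : 0 < c := by positivity
  refine ⟨c * (C₁ + C₂ / (2 * δ)), by positivity, fun ε B T a b hε hB hT h ha hb hyp => ?_⟩
  have T0 : 0 < T := by linarith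
  -- The parameter λ depends on the final time only; it is frozen while the energy is followed from
  -- 1 to T, and λ^{-δ/2} costs a factor T^δ.
  have hl : 0 < (μ - 2) * T ^ (-2 : ℝ) := by positivity
  set l := (μ - 2) * T ^ (-2 : ℝ) with hldef
  have hlT : l * T ^ 2 = μ - 2 := by
    rw [hldef, mul_assoc, ← Real.rpow_natCast, ← Real.rpow_add T0]; norm_num
  have hlμ : l ≤ μ - 2 := by
    rw [hldef]
    exact mul_le_of_le_one_right hμ0.le (Real.rpow_le_one_of_one_le_of_nonpos hT (by norm_num))
  have hlp : l ^ (-δ / 2) = c * T ^ δ := by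
    rw [hldef, Real.mul_rpow hμ0.le (by positivity), ← Real.rpow_mul T0.le, hc]
    congr 2; ring
  have hA : 0 ≤ C₂ * (c * T ^ δ) * B ^ p := by positivity
  have hgr := h.sqrt_greenEnergy_le hμ₂ hT l hl (A := C₂ * (c * T ^ δ) * B ^ p) (η := 2 * δ) hA
    (by positivity) fun t ht => by
      have t0 : 0 < t := by linarith [ht.1]
      obtain ⟨hy1, hy2⟩ := hyp t ⟨ht.1.le, ht.2⟩
      have := hnon l hl (a t) _ _ (by positivity) (by positivity) hy1 hy2
      rw [hlp] at this
      have e : t * (C₂ * (c * T ^ δ) * ((B * t ^ (-(1 - δ))) ^ (2 - δ) *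
          (B * t ^ (-(μ / 2))) ^ (p - 2 + δ))) =
          C₂ * (c * T ^ δ) * B ^ p *
            t ^ (1 + (-(1 - δ) * (2 - δ) + -(μ / 2) * (p - 2 + δ))) := by
        have hBp : B ^ p = B ^ (2 - δ) * B ^ (p - 2 + δ) := by
          rw [← Real.rpow_add hB]; congr 1; ring
        rw [hBp, Real.mul_rpow hB.le (by positivity), Real.mul_rpow hB.le (by positivity),
          ← Real.rpow_mul t0.le, ← Real.rpow_mul t0.le, Real.rpow_add t0, Real.rpow_add t0,
          Real.rpow_one]
        ring
      refine (mul_le_mul_of_nonneg_left this t0.le).trans (e.trans_le ?_)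
      refine mul_le_mul_of_nonneg_left (Real.rpow_le_rpow_of_exponent_le ht.1.le ?_) hA
      -- As μ ≥ 2, the exponent is at most 1 - (1-δ)(2-δ) - (p-2+δ), which is at most -1 - 2δ since
      -- p - 2 ≥ 4δ.
      nlinarith [mul_nonneg (show 0 ≤ μ / 2 - 1 by linarith) (show 0 ≤ p - 2 + δ by linarith),
        sq_nonneg δ]
  have hlow := Real.sqrt_le_sqrt (sq_mul_norm_sq_le_greenEnergy hl hlT (a T) (b T))
  rw [← mul_pow, Real.sqrt_sq (by positivity)] at hlow
  rw [ha, hb, greenEnergy_smul, Real.sqrt_mul (sq_nonneg ε), Real.sqrt_sq hε] at hgr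
  have hd := mul_le_mul_of_nonneg_left (hdata l hl hlμ) hε
  rw [hlp] at hd
  have hfin : T * ‖bessel (bessel (a T))‖ ≤ c * (C₁ + C₂ / (2 * δ)) * (ε + B ^ p) * T ^ δ := by
    refine (hlow.trans (hgr.trans (add_le_add_left hd _))).trans ?_
    have hBp : 0 ≤ B ^ p := by positivity
    have e : c * (C₁ + C₂ / (2 * δ)) * (ε + B ^ p) * T ^ δ = ε * (C₁ * (c * T ^ δ)) +
        C₂ * (c * T ^ δ) * B ^ p / (2 * δ) + (c * T ^ δ) * (C₁ * B ^ p + C₂ / (2 * δ) * ε) := by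
      ring
    rw [e]
    have : 0 ≤ (c * T ^ δ) * (C₁ * B ^ p + C₂ / (2 * δ) * ε) := by positivity
    linarith
  rw [neg_sub, Real.rpow_sub T0, Real.rpow_one, ← mul_div_assoc, le_div_iff₀ T0]
  linarith

end DampedWave

/-! ### The weighted energy of ∂ₜu and ∇u. -/

namespace DampedWave

open Filter Topology

/-- The weighted energy controlling `∂ₜ u` and `∇u`. -/
def waveEnergy (μ : ℝ) (a b : L2) (t : ℝ) : ℝ :=
  t ^ μ * (‖bessel b‖ ^ 2 + (‖bessel a‖ ^ 2 - ‖bessel (bessel a)‖ ^ 2)) +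
    μ * t ^ (μ - 1) * inner ℝ (bessel (bessel a)) (bessel b) +
    μ / 2 * t ^ (μ - 2) * ‖bessel (bessel a)‖ ^ 2

/-- The coefficients μ and μ/2 of the corrections are those for which ‖∂ₜu‖², ‖∇u‖² and ⟨u, ∂ₜu⟩ all
drop out of the derivative. -/
theorem IsStrong.hasDerivWithinAt_waveEnergy {μ p T : ℝ} {a b : ℝ → L2} (h : IsStrong μ p T a b)
    {t : ℝ} (ht : t ∈ Icc 1 T) :
    HasDerivWithinAt (fun s => waveEnergy μ (a s) (b s) s)
      (μ / 2 * (μ - 2) * t ^ (μ - 3) * ‖bessel (bessel (a t))‖ ^ 2 +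
        2 * t ^ μ * inner ℝ (bessel (b t)) (nonlin p (a t)) +
        μ * t ^ (μ - 1) * inner ℝ (bessel (bessel (a t))) (nonlin p (a t))) (Icc 1 T) t := by
  have t0 : 0 < t := one_pos.trans_le ht.1
  have hP := h.deriv_fst t ht
  have hU : HasDerivWithinAt (fun r => bessel (bessel (a r))) (bessel (b t)) (Icc 1 T) t :=
    hasDerivWithinAt_mult besselSymbol hP
  have hV := h.deriv_snd t ht
  have hr : ∀ q : ℝ, HasDerivWithinAt (fun s : ℝ => s ^ q) (q * t ^ (q - 1)) (Icc 1 T) t :=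
    fun q => (Real.hasDerivAt_rpow_const (Or.inl t0.ne')).hasDerivWithinAt
  have hy := (((hr μ).mul (hV.norm_sq.add (hP.norm_sq.sub hU.norm_sq))).add
    (((hr (μ - 1)).const_mul μ).mul (hU.inner ℝ hV))).add
    (((hr (μ - 2)).const_mul (μ / 2)).mul hU.norm_sq)
  refine hy.congr_deriv ?_
  have e3 : t ^ (μ - 2 - 1) = t ^ (μ - 3) := by congr 1; ring
  have e2 : t ^ (μ - 1 - 1) = t ^ (μ - 3) * t := by
    rw [← Real.rpow_add_one t0.ne']; congr 1; ring
  have e2' : t ^ (μ - 2) = t ^ (μ - 3) * t := by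
    rw [← Real.rpow_add_one t0.ne']; congr 1; ring
  have e1 : t ^ (μ - 1) = t ^ (μ - 3) * t * t := by
    rw [← Real.rpow_add_one t0.ne', ← Real.rpow_add_one t0.ne']; congr 1; ring
  have e0 : t ^ μ = t ^ (μ - 3) * t * t * t := by
    rw [← Real.rpow_add_one t0.ne', ← Real.rpow_add_one t0.ne', ← Real.rpow_add_one t0.ne']
    congr 1; ring
  have i1 : inner ℝ (bessel (a t)) (b t) = inner ℝ (bessel (b t)) (a t) := by
    rw [inner_bessel_left, real_inner_comm]
  have i2 : inner ℝ (bessel (bessel (a t))) (a t) = ‖bessel (a t)‖ ^ 2 := by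
    rw [inner_bessel_left, real_inner_self_eq_norm_sq]
  simp only [Pi.add_apply, Pi.sub_apply]
  change _ * (‖bessel (b t)‖ ^ 2 + (‖bessel (a t)‖ ^ 2 - ‖bessel (bessel (a t))‖ ^ 2)) + _ * (_ +
    (2 * inner ℝ (bessel (a t)) (b t) - 2 * inner ℝ (bessel (bessel (a t))) (bessel (b t)))) +
    (_ * inner ℝ (bessel (bessel (a t))) (bessel (b t)) + _ * (_ +
      inner ℝ (bessel (b t)) (bessel (b t)))) + (_ * ‖bessel (bessel (a t))‖ ^ 2 +
      _ * (2 * inner ℝ (bessel (bessel (a t))) (bessel (b t)))) = _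
  rw [i1]
  generalize hx : bessel (bessel (a t)) = U at *
  generalize bessel (b t) = V at *
  simp only [inner_add_right, inner_sub_right, inner_neg_right, inner_smul_right, i2,
    real_inner_self_eq_norm_sq, real_inner_comm U V, e3, e2, e2', e1, e0]
  field_simp
  ring

/-- Completing the square. The energy alone is not coercive, and the missing multiple of t^{μ-2}‖u‖²
must come from the L² decay. -/
theorem waveEnergy_eq {μ t : ℝ} (ht : 0 < t) (a b : L2) :
    waveEnergy μ a b t + μ / 4 * (μ - 2) * t ^ (μ - 2) * ‖bessel (bessel a)‖ ^ 2 =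
      t ^ (μ - 2) * ‖t • bessel b + (μ / 2) • bessel (bessel a)‖ ^ 2 +
        t ^ μ * (‖bessel a‖ ^ 2 - ‖bessel (bessel a)‖ ^ 2) := by
  have e1 : t ^ (μ - 1) = t ^ (μ - 2) * t := by
    rw [← Real.rpow_add_one ht.ne']; congr 1; ring
  have e0 : t ^ μ = t ^ (μ - 2) * t * t := by
    rw [← Real.rpow_add_one ht.ne', ← Real.rpow_add_one ht.ne']; congr 1; ring
  rw [waveEnergy, norm_add_sq_real, norm_smul, norm_smul, inner_smul_left, inner_smul_right,
    mul_pow, mul_pow, Real.norm_eq_abs, Real.norm_eq_abs, sq_abs, sq_abs, e1, e0,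
    real_inner_comm (bessel (bessel a)) (bessel b)]
  simp only [conj_trivial]
  ring

theorem waveEnergy_smul_one (μ c : ℝ) (a b : L2) :
    waveEnergy μ (c • a) (c • b) 1 = c ^ 2 * waveEnergy μ a b 1 := by
  simp only [waveEnergy, bessel, mult_smul_right, inner_smul_left, inner_smul_right, conj_trivial,
    norm_smul, mul_pow, Real.norm_eq_abs, sq_abs, Real.one_rpow]
  ring

theorem waveEnergy_deriv_le {μ p δ B N C t : ℝ} (hμ₂ : 2 < μ) (hμ₃ : μ < 3) (hp : 2 < p)
    (hδ1 : δ ≤ 1 / 4) (hδp : 4 * δ ≤ p - 2) (hB : 0 < B)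
    (hC : 0 < C) (ht1 : 1 ≤ t) {a b F : L2}
    (hy1 : ‖bessel (bessel a)‖ ≤ B * t ^ (-(1 - δ))) (hy3 : ‖bessel b‖ ≤ B * t ^ (-(μ / 2)))
    (hyN : ‖bessel (bessel a)‖ ≤ N * t ^ (-(1 - δ)))
    (hF : ‖F‖ ≤ C * (B * t ^ (-(1 - δ)) * (B * t ^ (-(μ / 2))) ^ (p - 1))) :
    μ / 2 * (μ - 2) * t ^ (μ - 3) * ‖bessel (bessel a)‖ ^ 2 + 2 * t ^ μ * inner ℝ (bessel b) F +
      μ * t ^ (μ - 1) * inner ℝ (bessel (bessel a)) F ≤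
      (3 / 2 * N ^ 2 + 5 * C * B ^ (p + 1)) * t ^ (-1 - 2 * δ) := by
  have t0 : 0 < t := by linarith
  have tm : ∀ q : ℝ, q ≤ -1 - 2 * δ → t ^ q ≤ t ^ (-1 - 2 * δ) := fun q hq =>
    Real.rpow_le_rpow_of_exponent_le ht1 hq
  have hpμ : (p - 2) * 1 ≤ (p - 2) * (μ / 2) :=
    mul_le_mul_of_nonneg_left (by linarith) (by linarith)
  have eB : B ^ (p + 1) = B * B * B ^ (p - 1) := by
    rw [show p + 1 = 1 + 1 + (p - 1) by ring, Real.rpow_add hB, Real.rpow_add hB, Real.rpow_one]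
  have k1 : μ / 2 * (μ - 2) * t ^ (μ - 3) * ‖bessel (bessel a)‖ ^ 2 ≤
      3 / 2 * N ^ 2 * t ^ (-1 - 2 * δ) := by
    have e : t ^ (μ - 3) * (N * t ^ (-(1 - δ))) ^ 2 = N ^ 2 * t ^ (μ - 3 - 2 * (1 - δ)) := by
      rw [mul_pow, ← Real.rpow_natCast (t ^ (-(1 - δ))) 2, ← Real.rpow_mul t0.le,
        show μ - 3 - 2 * (1 - δ) = μ - 3 + -(1 - δ) * ((2 : ℕ) : ℝ) by push_cast; ring,
        Real.rpow_add t0]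
      ring
    have h1 : t ^ (μ - 3) * ‖bessel (bessel a)‖ ^ 2 ≤ N ^ 2 * t ^ (-1 - 2 * δ) := by
      calc _ ≤ t ^ (μ - 3) * (N * t ^ (-(1 - δ))) ^ 2 := by gcongr
        _ = _ := e
        _ ≤ _ := by
          -- The exponent μ - 5 + 2δ is at most -1 - 2δ because μ < 3 ≤ 4 - 4δ.
          refine mul_le_mul_of_nonneg_left (tm _ ?_) (sq_nonneg N)
          linarith
    have h2 : μ / 2 * (μ - 2) ≤ 3 / 2 := by nlinarith
    have h3 : 0 ≤ N ^ 2 * t ^ (-1 - 2 * δ) := by positivity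
    have h4 : 0 ≤ μ / 2 * (μ - 2) := mul_nonneg (by linarith) (by linarith)
    calc _ = μ / 2 * (μ - 2) * (t ^ (μ - 3) * ‖bessel (bessel a)‖ ^ 2) := by ring
      _ ≤ μ / 2 * (μ - 2) * (N ^ 2 * t ^ (-1 - 2 * δ)) := mul_le_mul_of_nonneg_left h1 h4
      _ ≤ 3 / 2 * (N ^ 2 * t ^ (-1 - 2 * δ)) := mul_le_mul_of_nonneg_right h2 h3
      _ = _ := by ring
  have eM : (B * t ^ (-(μ / 2))) ^ (p - 1) = B ^ (p - 1) * t ^ (-(μ / 2) * (p - 1)) := by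
    rw [Real.mul_rpow hB.le (by positivity), ← Real.rpow_mul t0.le]
  have k2 : 2 * t ^ μ * inner ℝ (bessel b) F ≤
      2 * C * B ^ (p + 1) * t ^ (-1 - 2 * δ) := by
    have h1 : inner ℝ (bessel b) F ≤ (B * t ^ (-(μ / 2))) *
        (C * (B * t ^ (-(1 - δ)) * (B * t ^ (-(μ / 2))) ^ (p - 1))) :=
      (real_inner_le_norm _ _).trans (mul_le_mul hy3 hF (norm_nonneg _) (by positivity))
    calc _ ≤ 2 * t ^ μ * ((B * t ^ (-(μ / 2))) *
        (C * (B * t ^ (-(1 - δ)) * (B * t ^ (-(μ / 2))) ^ (p - 1)))) := by gcongr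
      _ = 2 * C * B ^ (p + 1) *
          t ^ (μ + (-(μ / 2) + (-(1 - δ) + -(μ / 2) * (p - 1)))) := by
        rw [eM, eB, Real.rpow_add t0, Real.rpow_add t0, Real.rpow_add t0]; ring
      _ ≤ _ := by
        refine mul_le_mul_of_nonneg_left (tm _ ?_) (by positivity)
        linarith
  have k3 : μ * t ^ (μ - 1) * inner ℝ (bessel (bessel a)) F ≤
      3 * C * B ^ (p + 1) * t ^ (-1 - 2 * δ) := by
    have h1 : inner ℝ (bessel (bessel a)) F ≤ (B * t ^ (-(1 - δ))) *
        (C * (B * t ^ (-(1 - δ)) * (B * t ^ (-(μ / 2))) ^ (p - 1))) :=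
      (real_inner_le_norm _ _).trans (mul_le_mul hy1 hF (norm_nonneg _) (by positivity))
    have hμ0 : 0 < μ := by linarith
    calc _ ≤ μ * t ^ (μ - 1) * ((B * t ^ (-(1 - δ))) *
        (C * (B * t ^ (-(1 - δ)) * (B * t ^ (-(μ / 2))) ^ (p - 1)))) :=
          mul_le_mul_of_nonneg_left h1 (by positivity)
      _ ≤ 3 * t ^ (μ - 1) * ((B * t ^ (-(1 - δ))) *
        (C * (B * t ^ (-(1 - δ)) * (B * t ^ (-(μ / 2))) ^ (p - 1)))) := by gcongr
      _ = 3 * C * B ^ (p + 1) *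
          t ^ (μ - 1 + (-(1 - δ) + (-(1 - δ) + -(μ / 2) * (p - 1)))) := by
        rw [eM, eB, Real.rpow_add t0, Real.rpow_add t0, Real.rpow_add t0]; ring
      _ ≤ _ := by
        refine mul_le_mul_of_nonneg_left (tm _ ?_) (by positivity)
        linarith
  linarith

/-- Decay of the energy under the bootstrap hypotheses. -/
theorem exists_energy_decay {μ p δ : ℝ} (hμ₂ : 2 < μ) (hμ₃ : μ < 3) (hp : 2 < p) (hδ : 0 < δ)
    (hδ1 : δ ≤ 1 / 4) (hδp : 4 * δ ≤ p - 2) (a₀ b₀ : L2) :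
    ∃ C : ℝ, 0 < C ∧ ∀ (ε B N T : ℝ) (a b : ℝ → L2), 0 < B → 0 ≤ N → 1 ≤ T →
      IsStrong μ p T a b → a 1 = ε • a₀ → b 1 = ε • b₀ →
      (∀ s ∈ Ico 1 T, ‖bessel (bessel (a s))‖ ≤ B * s ^ (-(1 - δ)) ∧
        ‖bessel (a s)‖ ^ 2 - ‖bessel (bessel (a s))‖ ^ 2 ≤ (B * s ^ (-(μ / 2))) ^ 2 ∧
        ‖bessel (b s)‖ ≤ B * s ^ (-(μ / 2))) →
      (∀ s ∈ Icc 1 T, ‖bessel (bessel (a s))‖ ≤ N * s ^ (-(1 - δ))) →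
      T ^ μ * ‖bessel (b T)‖ ^ 2 ≤ C * (ε ^ 2 + N ^ 2 + B ^ (p + 1)) ∧
      T ^ μ * (‖bessel (a T)‖ ^ 2 - ‖bessel (bessel (a T))‖ ^ 2) ≤
        C * (ε ^ 2 + N ^ 2 + B ^ (p + 1)) := by
  obtain ⟨C, hC, hnon⟩ := exists_norm_nonlin_bound hp
  set c := |waveEnergy μ a₀ b₀ 1| with hc
  have c0 : 0 ≤ c := abs_nonneg _
  -- The terms are twice the initial energy, the time integral of the derivative bound, and 7 = 2 +
  -- 5 for the multiples of N² lost in the coercivity estimates.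
  refine ⟨2 * c + (3 + 10 * C) / δ + 7, by positivity,
    fun ε B N T a b hB hN hT h ha hb hyp hUN => ?_⟩
  have T0 : 0 < T := by linarith
  have hBp : 0 < B ^ (p + 1) := by positivity
  have hD : 0 ≤ 3 / 2 * N ^ 2 + 5 * C * B ^ (p + 1) := by positivity
  have hgr := le_add_div_of_deriv_le (y := fun s => waveEnergy μ (a s) (b s) s) hT hD
    (show 0 < 2 * δ by positivity) (fun t ht => h.hasDerivWithinAt_waveEnergy ht) fun t ht => by
      have t0 : 0 < t := by linarith [ht.1]
      obtain ⟨hy1, hy2, hy3⟩ := hyp t ⟨ht.1.le, ht.2⟩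
      have hyN := hUN t (Ioo_subset_Icc_self ht)
      have hF := hnon (a t) _ _ (by positivity) (by positivity) hy1 hy2
      exact waveEnergy_deriv_le hμ₂ hμ₃ hp hδ1 hδp hB hC ht.1.le hy1 hy3 hyN hF
  beta_reduce at hgr
  rw [ha, hb, waveEnergy_smul_one] at hgr
  have hc1 : ε ^ 2 * waveEnergy μ a₀ b₀ 1 ≤ ε ^ 2 * c :=
    mul_le_mul_of_nonneg_left (le_abs_self _) (sq_nonneg ε)
  have hD2 : (3 / 2 * N ^ 2 + 5 * C * B ^ (p + 1)) / (2 * δ) ≤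
      (3 + 10 * C) / δ * (N ^ 2 + B ^ (p + 1)) / 2 := by
    have e : (3 + 10 * C) / δ * (N ^ 2 + B ^ (p + 1)) / 2 =
        ((3 + 10 * C) * (N ^ 2 + B ^ (p + 1))) / (2 * δ) := by field_simp
    rw [e]
    refine div_le_div_of_nonneg_right ?_ (by positivity)
    have := mul_pos hC hBp
    have := mul_nonneg hC.le (sq_nonneg N)
    linarith [sq_nonneg N]
  have hUT : T ^ (μ - 2) * ‖bessel (bessel (a T))‖ ^ 2 ≤ N ^ 2 := by
    calc _ ≤ T ^ (μ - 2) * (N * T ^ (-(1 - δ))) ^ 2 := by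
          gcongr; exact hUN T ⟨hT, le_rfl⟩
      _ = N ^ 2 * T ^ (μ - 2 - 2 * (1 - δ)) := by
          rw [mul_pow, ← Real.rpow_natCast (T ^ (-(1 - δ))) 2, ← Real.rpow_mul T0.le,
            show μ - 2 - 2 * (1 - δ) = μ - 2 + -(1 - δ) * ((2 : ℕ) : ℝ) by push_cast; ring,
            Real.rpow_add T0]
          ring
      _ ≤ N ^ 2 * 1 := by
          refine mul_le_mul_of_nonneg_left ?_ (sq_nonneg N)
          exact Real.rpow_le_one_of_one_le_of_nonpos hT (by linarith)
      _ = N ^ 2 := mul_one _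
  have heq := waveEnergy_eq (μ := μ) T0 (a T) (b T)
  set Y := T ^ (μ - 2) * ‖bessel (bessel (a T))‖ ^ 2 with hY
  have hY0 : 0 ≤ Y := by positivity
  have h4 : μ / 4 * (μ - 2) * T ^ (μ - 2) * ‖bessel (bessel (a T))‖ ^ 2 ≤ N ^ 2 := by
    have h5 : μ / 4 * (μ - 2) ≤ 1 := by nlinarith
    calc _ = μ / 4 * (μ - 2) * Y := by rw [hY]; ring
      _ ≤ 1 * Y := mul_le_mul_of_nonneg_right h5 hY0
      _ ≤ N ^ 2 := by linarith
  have hgrad : 0 ≤ T ^ μ * (‖bessel (a T)‖ ^ 2 - ‖bessel (bessel (a T))‖ ^ 2) :=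
    mul_nonneg (by positivity)
      (sub_nonneg.mpr (pow_le_pow_left₀ (norm_nonneg _) (norm_bessel_le _) 2))
  have hsq : 0 ≤ T ^ (μ - 2) * ‖T • bessel (b T) + (μ / 2) • bessel (bessel (a T))‖ ^ 2 := by
    positivity
  -- From the square of T∂ₜu + (μ/2)u; the constant 5 is 2 · 5/2, with (μ/2)² ≤ 5/2.
  have hV : T ^ μ * ‖bessel (b T)‖ ^ 2 ≤
      2 * (T ^ (μ - 2) * ‖T • bessel (b T) + (μ / 2) • bessel (bessel (a T))‖ ^ 2) +
        5 * Y := by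
    have e0 : T ^ μ = T ^ (μ - 2) * T ^ 2 := by
      rw [← Real.rpow_natCast, ← Real.rpow_add T0]; congr 1; push_cast; ring
    have h5 : T ^ 2 * ‖bessel (b T)‖ ^ 2 ≤
        2 * ‖T • bessel (b T) + (μ / 2) • bessel (bessel (a T))‖ ^ 2 +
          5 * ‖bessel (bessel (a T))‖ ^ 2 := by
      have h6 := norm_sub_le (T • bessel (b T) + (μ / 2) • bessel (bessel (a T)))
        ((μ / 2) • bessel (bessel (a T)))
      rw [add_sub_cancel_right, norm_smul, norm_smul, Real.norm_of_nonneg T0.le,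
        Real.norm_of_nonneg (by linarith : 0 ≤ μ / 2)] at h6
      have h7 := pow_le_pow_left₀ (by positivity) h6 2
      have h8 : (μ / 2) ^ 2 ≤ 5 / 2 := by nlinarith
      have h9 := mul_le_mul_of_nonneg_right h8 (sq_nonneg ‖bessel (bessel (a T))‖)
      nlinarith [sq_nonneg (‖T • bessel (b T) + (μ / 2) • bessel (bessel (a T))‖ -
        μ / 2 * ‖bessel (bessel (a T))‖)]
    rw [e0, hY, mul_assoc]
    have := mul_le_mul_of_nonneg_left h5 (show 0 ≤ T ^ (μ - 2) by positivity)
    linarith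
  have hK : 0 ≤ (3 + 10 * C) / δ := by positivity
  have hfin : 2 * (ε ^ 2 * c + (3 + 10 * C) / δ * (N ^ 2 + B ^ (p + 1)) / 2 + N ^ 2) + 5 * N ^ 2 ≤
      (2 * c + (3 + 10 * C) / δ + 7) * (ε ^ 2 + N ^ 2 + B ^ (p + 1)) := by
    generalize (3 + 10 * C) / δ = K at hK
    have k1 := mul_nonneg c0 (sq_nonneg N)
    have k2 := mul_nonneg c0 hBp.le
    have k3 := mul_nonneg hK (sq_nonneg ε)
    linarith [sq_nonneg ε]
  have hpos : 0 ≤ ε ^ 2 * c + (3 + 10 * C) / δ * (N ^ 2 + B ^ (p + 1)) / 2 + N ^ 2 := by positivity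
  constructor
  · linarith
  · linarith [sq_nonneg N]

end DampedWave

/-! ### The bootstrap. -/

namespace DampedWave

open Filter Topology

theorem le_mul_rpow_neg_iff {q s x B : ℝ} (hs : 0 < s) (hx : 0 ≤ x) (hB : 0 ≤ B) :
    x ≤ B * s ^ (-q) ↔ s ^ (2 * q) * x ^ 2 ≤ B ^ 2 := by
  have hsq : 0 < s ^ q := Real.rpow_pos_of_pos hs q
  have e : s ^ (2 * q) * x ^ 2 = (x * s ^ q) ^ 2 := by
    rw [mul_comm 2 q, Real.rpow_mul hs.le, Real.rpow_two]; ring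
  rw [e, pow_le_pow_iff_left₀ (by positivity) hB two_ne_zero, Real.rpow_neg hs.le,
    ← div_eq_mul_inv, le_div_iff₀ hsq]

/-- For p > 2 and B ≤ 1, both B^{2p} and B^{p+1} are at most B³, so after expansion every term is a
multiple of ε² + B³. It is essential that the L² constant occurs as C₁(ε + B^p): a term C₂B² could
not be absorbed. -/
theorem exists_bootstrap_radius {p C₁ C₂ : ℝ} (hp : 2 < p) (hC₂ : 0 < C₂) :
    ∃ ε₀ : ℝ, 0 < ε₀ ∧ ∀ ε : ℝ, 0 < ε → ε < ε₀ → ∃ B : ℝ, 0 < B ∧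
      (C₁ * (ε + B ^ p)) ^ 2 < B ^ 2 ∧
      C₂ * (ε ^ 2 + (C₁ * (ε + B ^ p)) ^ 2 + B ^ (p + 1)) < B ^ 2 := by
  set K := 1 + 2 * C₁ ^ 2 + C₂ * (1 + 2 * C₁ ^ 2) with hK
  have hK1 : 1 ≤ K := by
    have : 0 ≤ C₂ * (1 + 2 * C₁ ^ 2) := by positivity
    linarith [sq_nonneg C₁]
  have hK0 : 0 < K := by linarith
  refine ⟨1 / (8 * K ^ 2), by positivity, fun ε hε hlt => ?_⟩
  rw [lt_div_iff₀ (by positivity)] at hlt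
  -- Then Kε² ≤ B²/4 since K ≥ 1, and KB³ ≤ B²/4 for small ε.
  set B := 2 * K * ε with hB
  have hB0 : 0 < B := by positivity
  have hBK : 4 * (K * B) < 1 := by rw [hB]; linarith
  have hB1 : B ≤ 1 := by nlinarith
  have p1 : B ^ p ≤ B ^ 2 := by
    rw [← Real.rpow_two]; exact Real.rpow_le_rpow_of_exponent_ge hB0 hB1 hp.le
  have p3 : B ^ (p + 1) ≤ B ^ 3 := by
    rw [← Real.rpow_natCast B 3]
    exact Real.rpow_le_rpow_of_exponent_ge hB0 hB1 (by push_cast; linarith)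
  have p0 : 0 < B ^ p := Real.rpow_pos_of_pos hB0 p
  have p2 : (B ^ p) ^ 2 ≤ B ^ 3 := by
    calc (B ^ p) ^ 2 ≤ (B ^ 2) ^ 2 := by gcongr
      _ = B ^ 3 * B := by ring
      _ ≤ B ^ 3 := mul_le_of_le_one_right (by positivity) hB1
  have hN : (C₁ * (ε + B ^ p)) ^ 2 ≤ 2 * C₁ ^ 2 * (ε ^ 2 + B ^ 3) := by
    have h1 : (ε + B ^ p) ^ 2 ≤ 2 * (ε ^ 2 + B ^ 3) := by nlinarith [sq_nonneg (ε - B ^ p)]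
    rw [mul_pow]
    have := mul_le_mul_of_nonneg_left h1 (sq_nonneg C₁)
    linarith
  have hmain : K * (ε ^ 2 + B ^ 3) < B ^ 2 := by
    have h1 : K * ε ^ 2 ≤ B ^ 2 / 4 := by
      have : B ^ 2 / 4 = K * (K * ε ^ 2) := by rw [hB]; ring
      rw [this]
      exact le_mul_of_one_le_left (by positivity) hK1
    have h2 : K * B ^ 3 ≤ B ^ 2 / 4 := by
      have : K * B ^ 3 = B ^ 2 * (K * B) := by ring
      rw [this]
      nlinarith [sq_nonneg B]
    nlinarith [pow_pos hB0 2]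
  have hS : 0 < ε ^ 2 + B ^ 3 := by positivity
  refine ⟨B, hB0, lt_of_le_of_lt ?_ hmain, lt_of_le_of_lt ?_ hmain⟩
  · refine hN.trans (mul_le_mul_of_nonneg_right ?_ hS.le)
    have : 0 ≤ C₂ * (1 + 2 * C₁ ^ 2) := by positivity
    linarith
  · have h1 : C₂ * (ε ^ 2 + (C₁ * (ε + B ^ p)) ^ 2 + B ^ (p + 1)) ≤
        C₂ * ((1 + 2 * C₁ ^ 2) * (ε ^ 2 + B ^ 3)) :=
      mul_le_mul_of_nonneg_left (by linarith) hC₂.le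
    refine h1.trans ?_
    rw [← mul_assoc]
    refine mul_le_mul_of_nonneg_right ?_ hS.le
    linarith [sq_nonneg C₁]

/-- Solutions with small data stay bounded in `H¹`, on every interval. -/
theorem exists_apriori_bound {μ p : ℝ} (hμ₂ : 2 < μ) (hμ₃ : μ < 3) (hp : 2 < p) {a₀ b₀ : L2}
    (h1 : ∀ q : ℝ, 0 < q → Integrable fun x => |bessel (bessel a₀) x| ^ q)
    (h2 : ∀ q : ℝ, 0 < q → Integrable fun x => |(bessel b₀ + bessel (bessel a₀) : L2) x| ^ q) :
    ∃ ε₀ : ℝ, 0 < ε₀ ∧ ∀ ε : ℝ, 0 < ε → ε < ε₀ → ∃ m : ℝ, ∀ (T : ℝ) (a b : ℝ → L2), 1 ≤ T →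
      IsStrong μ p T a b → a 1 = ε • a₀ → b 1 = ε • b₀ → ‖bessel (a T)‖ ≤ m := by
  -- The bound 1/4 serves the range μ < 3 in the second energy; 4δ ≤ p - 2 is the margin that makes
  -- the source integrable.
  obtain ⟨δ, hδ, hδ1, hδp⟩ : ∃ δ : ℝ, 0 < δ ∧ δ ≤ 1 / 4 ∧ 4 * δ ≤ p - 2 :=
    ⟨min (1 / 4) ((p - 2) / 4), lt_min (by norm_num) (by linarith), min_le_left _ _, by
      linarith [min_le_right (1 / 4) ((p - 2) / 4)]⟩
  obtain ⟨C₁, hC₁, hdecay⟩ := exists_norm_decay hμ₂ hp hδ hδ1 hδp h1 h2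
  obtain ⟨C₂, hC₂, henergy⟩ := exists_energy_decay hμ₂ hμ₃ hp hδ hδ1 hδp a₀ b₀
  obtain ⟨ε₀, hε₀, hsmall⟩ := exists_bootstrap_radius (C₁ := C₁) hp hC₂
  refine ⟨ε₀, hε₀, fun ε hε hlt => ?_⟩
  obtain ⟨B, hB, hBN, hBE⟩ := hsmall ε hε hlt
  refine ⟨2 * B, fun T a b hT h ha hb => ?_⟩
  have hN0 : 0 ≤ C₁ * (ε + B ^ p) := by positivity
  -- The three bootstrap bounds together amount to g ≤ B².
  set g : ℝ → ℝ := fun s => max (max (s ^ (2 * (1 - δ)) * ‖bessel (bessel (a s))‖ ^ 2)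
    (s ^ μ * ‖bessel (b s)‖ ^ 2)) (s ^ μ * (‖bessel (a s)‖ ^ 2 - ‖bessel (bessel (a s))‖ ^ 2))
    with hg
  have hgc : ContinuousOn g (Icc 1 T) := by
    have hr : ∀ q : ℝ, ContinuousOn (fun s : ℝ => s ^ q) (Icc 1 T) := fun q =>
      continuousOn_id.rpow_const fun s hs => Or.inl (one_pos.trans_le hs.1).ne'
    have cP := (continuousOn_bessel h.cont_fst).norm.pow 2
    have cU := (continuousOn_bessel (continuousOn_bessel h.cont_fst)).norm.pow 2
    have cV := (continuousOn_bessel h.cont_snd).norm.pow 2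
    exact (((hr _).mul cU).sup ((hr μ).mul cV)).sup ((hr μ).mul (cP.sub cU))
  have hglt := le_of_continuous_induction (M := B ^ 2) hgc fun t ht hs => by
    have hyp : ∀ s ∈ Ico 1 t, ‖bessel (bessel (a s))‖ ≤ B * s ^ (-(1 - δ)) ∧
        ‖bessel (a s)‖ ^ 2 - ‖bessel (bessel (a s))‖ ^ 2 ≤ (B * s ^ (-(μ / 2))) ^ 2 ∧
        ‖bessel (b s)‖ ≤ B * s ^ (-(μ / 2)) := by
      intro s hs'
      have s0 : 0 < s := one_pos.trans_le hs'.1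
      have hm := hs s hs'
      rw [hg, max_le_iff, max_le_iff] at hm
      obtain ⟨⟨m1, m2⟩, m3⟩ := hm
      refine ⟨(le_mul_rpow_neg_iff s0 (norm_nonneg _) hB.le).mpr m1, ?_,
        (le_mul_rpow_neg_iff s0 (norm_nonneg _) hB.le).mpr (by
          rwa [mul_div_cancel₀ μ two_ne_zero])⟩
      have e : (B * s ^ (-(μ / 2))) ^ 2 = B ^ 2 / s ^ μ := by
        rw [mul_pow, ← Real.rpow_natCast (s ^ (-(μ / 2))) 2, ← Real.rpow_mul s0.le,
          show -(μ / 2) * ((2 : ℕ) : ℝ) = -μ by push_cast; ring, Real.rpow_neg s0.le,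
          div_eq_mul_inv]
      rw [e, le_div_iff₀ (Real.rpow_pos_of_pos s0 μ), mul_comm]
      exact m3
    -- The L² estimate is used on every [1, s] before the energy estimate, so that the latter sees
    -- the improved constant throughout.
    have hUN : ∀ s ∈ Icc 1 t, ‖bessel (bessel (a s))‖ ≤
        C₁ * (ε + B ^ p) * s ^ (-(1 - δ)) := fun s hs' =>
      hdecay ε B s a b hε.le hB hs'.1 (h.mono (hs'.2.trans ht.2)) ha hb fun r hr =>
        have := hyp r ⟨hr.1, hr.2.trans_le hs'.2⟩
        ⟨this.1, this.2.1⟩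
    obtain ⟨e1, e2⟩ := henergy ε B (C₁ * (ε + B ^ p)) t a b hB hN0 ht.1 (h.mono ht.2) ha hb hyp hUN
    have e0 := (le_mul_rpow_neg_iff (one_pos.trans_le ht.1) (norm_nonneg _) hN0).mp
      (hUN t ⟨ht.1, le_rfl⟩)
    exact max_lt (max_lt (e0.trans_lt hBN) (e1.trans_lt hBE)) (e2.trans_lt hBE)
  have hfin := hglt T ⟨hT, le_rfl⟩
  rw [hg, max_lt_iff, max_lt_iff] at hfin
  obtain ⟨⟨m1, -⟩, m3⟩ := hfin
  have hpow : ∀ q : ℝ, 0 ≤ q → 1 ≤ T ^ q := fun q hq => Real.one_le_rpow hT hq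
  have hgrad : 0 ≤ ‖bessel (a T)‖ ^ 2 - ‖bessel (bessel (a T))‖ ^ 2 :=
    sub_nonneg.mpr (pow_le_pow_left₀ (norm_nonneg _) (norm_bessel_le _) 2)
  have k1 := le_mul_of_one_le_left (sq_nonneg ‖bessel (bessel (a T))‖)
    (hpow (2 * (1 - δ)) (by linarith))
  have k2 := le_mul_of_one_le_left hgrad (hpow μ (by linarith))
  refine (pow_le_pow_iff_left₀ (norm_nonneg _) (by positivity) two_ne_zero).mp ?_
  rw [mul_pow]
  linarith [sq_nonneg B]

end DampedWave

namespace DampedWave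

open Filter Topology

/-! ### Global solutions -/

theorem IsStrong.congr {μ p T : ℝ} {a b a' b' : ℝ → L2} (h : IsStrong μ p T a b)
    (ha : EqOn a' a (Icc 1 T)) (hb : EqOn b' b (Icc 1 T)) : IsStrong μ p T a' b' := by
  refine ⟨h.cont_fst.congr ha, h.cont_snd.congr hb, fun t ht => ?_, fun t ht => ?_⟩
  · rw [hb ht]
    exact (h.deriv_fst t ht).congr (fun s hs => by rw [ha hs]) (by rw [ha ht])
  · rw [ha ht, hb ht]
    exact (h.deriv_snd t ht).congr (fun s hs => by rw [hb hs]) (by rw [hb ht])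

/-- Solutions on bounded intervals fit together. -/
theorem exists_strong_global {μ p : ℝ} (hp : 2 < p) {a₀ b₀ : L2}
    (h : ∀ T : ℝ, 1 ≤ T → ∃ a b, IsStrong μ p T a b ∧ a 1 = a₀ ∧ b 1 = b₀) :
    ∃ a b : ℝ → L2, (∀ T, IsStrong μ p T a b) ∧ a 1 = a₀ ∧ b 1 = b₀ := by
  -- Solutions on [1, n+1]; by uniqueness they agree where they overlap, and at time t the one with
  -- n = ⌈t⌉ is taken.
  choose A B hAB hA hB using fun n : ℕ => h (n + 1) (by linarith [n.cast_nonneg (α := ℝ)])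
  have hagree : ∀ m n : ℕ, m ≤ n → ∀ t ∈ Icc (1 : ℝ) (m + 1), A m t = A n t ∧ B m t = B n t :=
    fun m n hmn => (hAB m).unique hp ((hAB n).mono (by gcongr)) (by rw [hA, hA]) (by rw [hB, hB])
  have hmem : ∀ t : ℝ, 1 ≤ t → t ∈ Icc (1 : ℝ) ((⌈t⌉₊ : ℝ) + 1) := fun t ht =>
    ⟨ht, (Nat.le_ceil t).trans (by linarith)⟩
  refine ⟨fun t => A ⌈t⌉₊ t, fun t => B ⌈t⌉₊ t, fun T => ?_, hA _, hB _⟩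
  have hT : T ≤ (⌈T⌉₊ : ℝ) + 1 := (Nat.le_ceil T).trans (by linarith)
  refine ((hAB ⌈T⌉₊).mono hT).congr (fun t ht => ?_) fun t ht => ?_
  · exact (hagree _ _ (Nat.ceil_le_ceil ht.2) t (hmem t ht.1)).1
  · exact (hagree _ _ (Nat.ceil_le_ceil ht.2) t (hmem t ht.1)).2

theorem Icc_mem_nhdsWithin_Ici (t : ℝ) : Icc 1 (t + 1) ∈ 𝓝[Ici 1] t := by
  rw [← Ici_inter_Iic]
  exact inter_mem self_mem_nhdsWithin (mem_nhdsWithin_of_mem_nhds (Iic_mem_nhds (lt_add_one t)))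

section

variable {E : Type*} [NormedAddCommGroup E] [NormedSpace ℝ E]

theorem derivWithin_eqOn_Ici {f f' : ℝ → E}
    (h : ∀ t ∈ Ici (1 : ℝ), HasDerivWithinAt f (f' t) (Ici 1) t) :
    EqOn (derivWithin f (Ici 1)) f' (Ici 1) := fun t ht =>
  (h t ht).derivWithin (uniqueDiffOn_Ici 1 t ht)

theorem contDiffOn_one_of_hasDerivWithinAt {f f' : ℝ → E}
    (h : ∀ t ∈ Ici (1 : ℝ), HasDerivWithinAt f (f' t) (Ici 1) t) (hc : ContinuousOn f' (Ici 1)) :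
    ContDiffOn ℝ 1 f (Ici 1) := by
  rw [show (1 : WithTop ℕ∞) = 0 + 1 from rfl, contDiffOn_succ_iff_derivWithin (uniqueDiffOn_Ici 1)]
  exact ⟨fun t ht => (h t ht).differentiableWithinAt, by simp,
    contDiffOn_zero.mpr (hc.congr (derivWithin_eqOn_Ici h))⟩

theorem contDiffOn_two_of_hasDerivWithinAt {f f' f'' : ℝ → E}
    (h : ∀ t ∈ Ici (1 : ℝ), HasDerivWithinAt f (f' t) (Ici 1) t)
    (h' : ∀ t ∈ Ici (1 : ℝ), HasDerivWithinAt f' (f'' t) (Ici 1) t)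
    (hc : ContinuousOn f'' (Ici 1)) : ContDiffOn ℝ 2 f (Ici 1) := by
  rw [show (2 : WithTop ℕ∞) = 1 + 1 from one_add_one_eq_two.symm,
    contDiffOn_succ_iff_derivWithin (uniqueDiffOn_Ici 1)]
  exact ⟨fun t ht => (h t ht).differentiableWithinAt, by simp,
    (contDiffOn_one_of_hasDerivWithinAt h' hc).congr (derivWithin_eqOn_Ici h)⟩

theorem iteratedDerivWithin_two_eqOn_Ici {f f' f'' : ℝ → E}
    (h : ∀ t ∈ Ici (1 : ℝ), HasDerivWithinAt f (f' t) (Ici 1) t)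
    (h' : ∀ t ∈ Ici (1 : ℝ), HasDerivWithinAt f' (f'' t) (Ici 1) t) :
    EqOn (iteratedDerivWithin 2 f (Ici 1)) f'' (Ici 1) := fun t ht => by
  rw [iteratedDerivWithin_succ, derivWithin_congr (f := f')
    (fun s hs => by rw [iteratedDerivWithin_one]; exact derivWithin_eqOn_Ici h hs)
    (by rw [iteratedDerivWithin_one]; exact derivWithin_eqOn_Ici h ht)]
  exact derivWithin_eqOn_Ici h' ht

end

/-- A strong solution on every `[1, T]` gives a global solution of the Cauchy
problem. -/
theorem isGlobalSolution_besselEmb {μ p : ℝ} (hp : 2 < p) {f₀ f₁ : Plane → ℝ} {a b : ℝ → L2}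
    (h : ∀ T, IsStrong μ p T a b) (h₀ : ∀ᵐ x, bessel (bessel (a 1)) x = f₀ x)
    (h₁ : ∀ᵐ x, bessel (b 1) x = f₁ x) :
    IsGlobalSolution μ p f₀ f₁ fun t => besselEmb 2 (a t) := by
  have ca : ContinuousOn a (Ici 1) := fun t ht =>
    ((h (t + 1)).cont_fst t ⟨ht, (lt_add_one t).le⟩).mono_of_mem_nhdsWithin
      (Icc_mem_nhdsWithin_Ici t)
  have cb : ContinuousOn b (Ici 1) := fun t ht =>
    ((h (t + 1)).cont_snd t ⟨ht, (lt_add_one t).le⟩).mono_of_mem_nhdsWithin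
      (Icc_mem_nhdsWithin_Ici t)
  have da : ∀ t ∈ Ici (1 : ℝ), HasDerivWithinAt (fun s => bessel (a s)) (b t) (Ici 1) t :=
    fun t ht => ((h (t + 1)).deriv_fst t ⟨ht, (lt_add_one t).le⟩).mono_of_mem_nhdsWithin
      (Icc_mem_nhdsWithin_Ici t)
  have db : ∀ t ∈ Ici (1 : ℝ), HasDerivWithinAt (fun s => bessel (b s)) (-a t +
      bessel (bessel (a t)) - (μ / t) • bessel (b t) + nonlin p (a t)) (Ici 1) t :=
    fun t ht => ((h (t + 1)).deriv_snd t ⟨ht, (lt_add_one t).le⟩).mono_of_mem_nhdsWithin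
      (Icc_mem_nhdsWithin_Ici t)
  have dA : ∀ t ∈ Ici (1 : ℝ), HasDerivWithinAt (fun s => toL2 (besselEmb 2 (a s))) (bessel (b t))
      (Ici 1) t := fun t ht => by
    simp only [toL2_besselEmb_two]
    exact hasDerivWithinAt_mult besselSymbol (da t ht)
  have c2 : ContinuousOn (fun t => -a t + bessel (bessel (a t)) - (μ / t) • bessel (b t) +
      nonlin p (a t)) (Ici 1) := by
    have c1 : ContinuousOn (fun t => (μ / t) • bessel (b t)) (Ici 1) :=
      ContinuousOn.smul (continuousOn_const.div continuousOn_id fun t ht =>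
        (one_pos.trans_le ht).ne') (continuousOn_bessel cb)
    have c2 : ContinuousOn (fun t => nonlin p (a t)) (Ici 1) := by
      simpa only [Function.comp_def] using (continuous_nonlin hp).comp_continuousOn ca
    exact ((ca.neg.add (continuousOn_bessel (continuousOn_bessel ca))).sub c1).add c2
  refine ⟨(besselEmb 2).continuous.comp_continuousOn ca, ?_,
    contDiffOn_two_of_hasDerivWithinAt dA db c2, fun t ht => ?_, ?_, ?_⟩
  · simp only [incl_besselEmb]
    exact contDiffOn_one_of_hasDerivWithinAt
      (fun t ht => (besselEmb 1).hasFDerivAt.comp_hasDerivWithinAt t (da t ht))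
      ((besselEmb 1).continuous.comp_continuousOn cb)
  · rw [iteratedDerivWithin_two_eqOn_Ici dA db ht, derivWithin_eqOn_Ici dA ht, laplacian_besselEmb,
      toL2_besselEmb_two]
    beta_reduce
    have e : -a t + bessel (bessel (a t)) - (μ / t) • bessel (b t) + nonlin p (a t) =
        (bessel (bessel (a t)) - a t) - (μ / t) • bessel (b t) + nonlin p (a t) := by abel
    rw [e]
    filter_upwards [Lp.coeFn_add (bessel (bessel (a t)) - a t - (μ / t) • bessel (b t))
      (nonlin p (a t)), Lp.coeFn_sub (bessel (bessel (a t)) - a t) ((μ / t) • bessel (b t)),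
      Lp.coeFn_smul (μ / t) (bessel (b t)), coeFn_nonlin (show 1 < p by linarith) (a t)]
      with x e1 e2 e3 e4
    rw [e1, Pi.add_apply, e2, Pi.sub_apply, e3, Pi.smul_apply, e4, smul_eq_mul]
    ring
  · simpa only [toL2_besselEmb_two] using h₀
  · rw [derivWithin_eqOn_Ici dA self_mem_Ici]
    exact h₁

/-- The time derivative of a global solution in `H¹`. -/
def velocity (u : ℝ → Sobolev 2) (t : ℝ) : Sobolev 1 :=
  derivWithin (fun s => incl one_le_two (u s)) (Ici 1) t

theorem halfLap_incl (f : Sobolev 2) : halfLap (incl one_le_two f) = bessel (oneSubLap f) := by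
  conv_lhs => rw [← besselEmb_oneSubLap f, incl_besselEmb, halfLap_besselEmb]

/-- The bounded operator ⟨D⟩ : H¹ → L² is applied to the differentiable curve in H¹; on H² it equals
⟨D⟩⁻¹(1 - Δ). -/
theorem IsGlobalSolution.hasDerivWithinAt_bessel {μ p : ℝ} {f₀ f₁ : Plane → ℝ} {u : ℝ → Sobolev 2}
    (h : IsGlobalSolution μ p f₀ f₁ u) {t : ℝ} (ht : t ∈ Ici (1 : ℝ)) :
    HasDerivWithinAt (fun s => bessel (oneSubLap (u s))) (halfLap (velocity u t)) (Ici 1) t := by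
  have h1 : HasDerivWithinAt (fun s => incl one_le_two (u s)) (velocity u t) (Ici 1) t :=
    ((h.contDiff_H1.differentiableOn one_ne_zero) t ht).hasDerivWithinAt
  have h2 := halfLap.hasFDerivAt.comp_hasDerivWithinAt t h1
  simpa only [Function.comp_def, halfLap_incl] using h2

/-- One more ⟨D⟩⁻¹ identifies the time derivative taken in L² with the one taken in H¹, linking the
equation to the variables (a, b). -/
theorem IsGlobalSolution.derivWithin_toL2 {μ p : ℝ} {f₀ f₁ : Plane → ℝ} {u : ℝ → Sobolev 2}
    (h : IsGlobalSolution μ p f₀ f₁ u) {t : ℝ} (ht : t ∈ Ici (1 : ℝ)) :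
    derivWithin (fun s => toL2 (u s)) (Ici 1) t = bessel (halfLap (velocity u t)) := by
  have h1 := hasDerivWithinAt_mult besselSymbol (h.hasDerivWithinAt_bessel ht)
  have e : (fun s => mult besselSymbol (bessel (oneSubLap (u s)))) = fun s => toL2 (u s) :=
    funext fun s => bessel_bessel_oneSubLap (u s)
  rw [e] at h1
  exact h1.derivWithin (uniqueDiffOn_Ici 1 t ht)

/-- A global solution gives a strong solution on every `[1, T]`. -/
theorem IsGlobalSolution.isStrong {μ p : ℝ} {f₀ f₁ : Plane → ℝ} {u : ℝ → Sobolev 2}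
    (h : IsGlobalSolution μ p f₀ f₁ u) (hp : 2 < p) (T : ℝ) :
    IsStrong μ p T (fun t => oneSubLap (u t)) fun t => halfLap (velocity u t) := by
  have hs : Icc 1 T ⊆ Ici 1 := Icc_subset_Ici_self
  refine ⟨(oneSubLap.continuous.comp_continuousOn h.continuous_H2).mono hs, ?_,
    fun t ht => (h.hasDerivWithinAt_bessel (hs ht)).mono hs, fun t ht => ?_⟩
  · have h1 := h.contDiff_H1.continuousOn_derivWithin (uniqueDiffOn_Ici 1) le_rfl
    exact (halfLap.continuous.comp_continuousOn h1).mono hs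
  · have ht1 : t ∈ Ici (1 : ℝ) := hs ht
    have h2 := h.contDiff_L2
    rw [show (2 : WithTop ℕ∞) = 1 + 1 from one_add_one_eq_two.symm,
      contDiffOn_succ_iff_derivWithin (uniqueDiffOn_Ici 1)] at h2
    have h3 := ((h2.2.2.differentiableOn one_ne_zero) t ht1).hasDerivWithinAt
    have e1 : derivWithin (derivWithin (fun s => toL2 (u s)) (Ici 1)) (Ici 1) t =
        iteratedDerivWithin 2 (fun s => toL2 (u s)) (Ici 1) t := by
      rw [iteratedDerivWithin_succ]
      exact derivWithin_congr (fun s _ => by rw [iteratedDerivWithin_one])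
        (by rw [iteratedDerivWithin_one])
    rw [e1] at h3
    have h4 := (h3.congr (fun s hs => (h.derivWithin_toL2 hs).symm)
      (h.derivWithin_toL2 ht1).symm).mono hs
    refine h4.congr_deriv ?_
    have heq := h.equation t ht1
    rw [h.derivWithin_toL2 ht1] at heq
    generalize iteratedDerivWithin 2 (fun s => toL2 (u s)) (Ici 1) t = X at *
    rw [bessel_bessel_oneSubLap]
    have e2 : laplacian (u t) = toL2 (u t) - oneSubLap (u t) := by
      rw [oneSubLap_apply, sub_sub_cancel]
    have e3 : -oneSubLap (u t) + toL2 (u t) = laplacian (u t) := by rw [e2]; abel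
    rw [e3]
    have hnl := coeFn_nonlin (show 1 < p by linarith) (oneSubLap (u t))
    rw [bessel_bessel_oneSubLap] at hnl
    refine Lp.ext ?_
    filter_upwards [heq, hnl,
      Lp.coeFn_add (laplacian (u t) - (μ / t) • bessel (halfLap (velocity u t)))
      (nonlin p (oneSubLap (u t))), Lp.coeFn_sub (laplacian (u t))
        ((μ / t) • bessel (halfLap (velocity u t))),
      Lp.coeFn_smul (μ / t) (bessel (halfLap (velocity u t)))] with x g1 g2 g3 g4 g5
    rw [g3, Pi.add_apply, g4, Pi.sub_apply, g5, Pi.smul_apply, smul_eq_mul, g2, ← g1]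
    ring

theorem integrable_abs_rpow_of_ae_eq {f : L2} {φ : Plane → ℝ} (h : f =ᵐ[volume] φ)
    (hc : Continuous φ) (hs : HasCompactSupport φ) {q : ℝ} (hq : 0 < q) :
    Integrable fun x => |f x| ^ q := by
  have h1 : Continuous fun x => |φ x| ^ q := hc.abs.rpow_const fun x => Or.inr hq.le
  have h2 : HasCompactSupport fun x => |φ x| ^ q :=
    hs.comp_left (g := fun y : ℝ => |y| ^ q) (by simp [hq.ne'])
  refine (h1.integrable_of_hasCompactSupport h2).congr ?_
  filter_upwards [h] with x hx
  rw [hx]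

theorem coeFn_smul_toL2 {φ : Plane → ℝ} (h : IsTest φ) (ε : ℝ) :
    (ε • h.toL2 : L2) =ᵐ[volume] fun x => ε * φ x := by
  filter_upwards [Lp.coeFn_smul ε h.toL2, h.coeFn_toL2] with x e1 e2
  rw [e1, Pi.smul_apply, e2, smul_eq_mul]

/-- Global existence and uniqueness for small test data. -/
theorem exists_global_of_isTest {μ p : ℝ} (hμ₂ : 2 < μ) (hμ₃ : μ < 3) (hp : 2 < p)
    {u₀ u₁ : Plane → ℝ} (h₀ : IsTest u₀) (h₁ : IsTest u₁) :
    ∃ ε₀ : ℝ, 0 < ε₀ ∧ ∀ ε : ℝ, 0 < ε → ε < ε₀ →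
      ∃ u : ℝ → Sobolev 2,
        IsGlobalSolution μ p (fun x => ε * u₀ x) (fun x => ε * u₁ x) u ∧
        ∀ v : ℝ → Sobolev 2,
          IsGlobalSolution μ p (fun x => ε * u₀ x) (fun x => ε * u₁ x) v → EqOn v u (Ici 1) := by
  -- The pair a₀ = (1 - Δ)u₀, b₀ = ⟨D⟩u₁, the latter written as ⟨D⟩⁻¹(1 - Δ)u₁.
  set a₀ : L2 := h₀.oneSubLaplace.toL2 with ha₀
  set b₀ : L2 := bessel h₁.oneSubLaplace.toL2 with hb₀
  have ea : bessel (bessel a₀) = h₀.toL2 := h₀.bessel_bessel_oneSub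
  have eb : bessel b₀ = h₁.toL2 := h₁.bessel_bessel_oneSub
  obtain ⟨ε₀, hε₀, hbound⟩ := exists_apriori_bound hμ₂ hμ₃ hp (a₀ := a₀) (b₀ := b₀)
    (fun q hq => by
      rw [ea]
      exact integrable_abs_rpow_of_ae_eq h₀.coeFn_toL2 h₀.1.continuous h₀.2 hq)
    (fun q hq => by
      rw [ea, eb]
      refine integrable_abs_rpow_of_ae_eq (φ := u₁ + u₀) ?_
        (h₁.1.continuous.add h₀.1.continuous) (h₁.2.add h₀.2) hq
      filter_upwards [Lp.coeFn_add h₁.toL2 h₀.toL2, h₀.coeFn_toL2, h₁.coeFn_toL2] with x e1 e2 e3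
      rw [e1, Pi.add_apply, e2, e3, Pi.add_apply])
  refine ⟨ε₀, hε₀, fun ε hε hlt => ?_⟩
  obtain ⟨m, hm⟩ := hbound ε hε hlt
  obtain ⟨a, b, hab, ha1, hb1⟩ := exists_strong_global (μ := μ) hp (a₀ := ε • a₀) (b₀ := ε • b₀)
    fun T hT => exists_strong μ hp hT fun T' hT' a b h ha hb => hm T' a b hT'.1 h ha hb
  have eBa : bessel (bessel (ε • a₀)) = ε • h₀.toL2 := by
    rw [← ea]; simp only [bessel, mult_smul_right]
  have eBb : bessel (ε • b₀) = ε • h₁.toL2 := by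
    rw [← eb]; simp only [bessel, mult_smul_right]
  refine ⟨fun t => besselEmb 2 (a t), isGlobalSolution_besselEmb hp hab ?_ ?_, fun v hv t ht => ?_⟩
  · rw [ha1, eBa]; exact coeFn_smul_toL2 h₀ ε
  · rw [hb1, eBb]; exact coeFn_smul_toL2 h₁ ε
  -- A competing solution is also strong, and injectivity of ⟨D⟩⁻¹ shows that it starts from the
  -- same pair (a, b).
  · have hva : oneSubLap (v 1) = a 1 := by
      refine bessel_injective (bessel_injective ?_)
      rw [bessel_bessel_oneSubLap, ha1, eBa]
      exact Lp.ext (EventuallyEq.trans hv.initial_value (coeFn_smul_toL2 h₀ ε).symm)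
    have hvb : halfLap (velocity v 1) = b 1 := by
      refine bessel_injective ?_
      rw [← hv.derivWithin_toL2 self_mem_Ici, hb1, eBb]
      exact Lp.ext (EventuallyEq.trans hv.initial_velocity (coeFn_smul_toL2 h₁ ε).symm)
    have := ((hv.isStrong hp t).unique hp (hab t) hva hvb t ⟨ht, le_rfl⟩).1
    rw [← besselEmb_oneSubLap (v t)]
    exact congrArg (besselEmb 2) this

end DampedWave

end

theorem theorem1p1 (μ p : ℝ) (hμ₂ : 2 < μ) (hμ₃ : μ < 3) (hp : 2 < p)
    (u₀ u₁ : DampedWave.Plane → ℝ)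
    (hu₀ : ContDiff ℝ ∞ u₀) (hu₁ : ContDiff ℝ ∞ u₁)
    (hsupp₀ : tsupport u₀ ⊆ Metric.ball 0 1) (hsupp₁ : tsupport u₁ ⊆ Metric.ball 0 1) :
    ∃ ε₀ : ℝ, 0 < ε₀ ∧ ∀ ε : ℝ, 0 < ε → ε < ε₀ →
      ∃ u : ℝ → DampedWave.Sobolev 2,
        DampedWave.IsGlobalSolution μ p (fun x => ε * u₀ x) (fun x => ε * u₁ x) u ∧
        ∀ v : ℝ → DampedWave.Sobolev 2,
          DampedWave.IsGlobalSolution μ p (fun x => ε * u₀ x) (fun x => ε * u₁ x) v →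
            Set.EqOn v u (Set.Ici 1) := by
  have hcomp : ∀ φ : DampedWave.Plane → ℝ, tsupport φ ⊆ Metric.ball 0 1 → HasCompactSupport φ :=
    fun φ h => IsCompact.of_isClosed_subset (isCompact_closedBall 0 1) (isClosed_tsupport φ)
      (h.trans Metric.ball_subset_closedBall)
  exact DampedWave.exists_global_of_isTest hμ₂ hμ₃ hp ⟨hu₀, hcomp u₀ hsupp₀⟩ ⟨hu₁, hcomp u₁ hsupp₁⟩
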